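/- Let $\Bbbk$ be a field. A Hopf brace $(A,\cdot,\bullet)$ over $\Bbbk$ consists of two Hopf algebra structures $(A,\cdot,1,\Delta,\varepsilon,S)$ and $(A,\bullet,1,\Delta,\varepsilon,T)$ on the same coalgebra with the same unit such that $a\bullet(b\cdot c)=(a_1\bullet b)\cdot S(a_2)\cdot(a_3\bullet c)$ for all $a,b,c\in A$ (Sweedler notation); it is cocommutative if $\Delta$ is. Morphisms are the linear maps preserving $\cdot,\bullet,1,\Delta,\varepsilon$. A sub-Hopf brace of $A$ is a subspace containing $1$ and closed under $\cdot,\bullet,\Delta,S,T$. A sub-Hopf brace $B$ is normal if $a_1\cdot b\cdot S(a_2)$, $a_1\bullet b\bullet T(a_2)$ and $S(a_1)\cdot(a_2\bullet b)$ lie in $B$ for all $a\in A$, $b\in B$. The normal sub-Hopf brace generated by a subset of $A$ is the intersection of all normal sub-Hopf braces of $A$ containing it. Two sub-Hopf braces $X,Y$ of a cocommutative Hopf brace $A$ commute in the sense of Huq if there is a morphism of Hopf braces $p:X\otimes Y\to A$ (where $X\otimes Y$, with componentwise operations, is the product of $X$ and $Y$ in the category of cocommutative Hopf braces) such that $p(x\otimes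 1)=x$ and $p(1\otimes y)=y$ for all $x\in X$, $y\in Y$. The Huq commutator $[X,Y]_{\mathrm{Huq}}$ of two normal sub-Hopf braces $X,Y$ of $A$ is the smallest normal sub-Hopf brace $K$ of $A$ such that, for the cokernel $q:A\to Q$ of the inclusion $K\hookrightarrow A$ in the category of cocommutative Hopf braces, the images $q(X)$ and $q(Y)$ commute in the sense of Huq. Proposition. Let $X$ and $Y$ be two normal sub-Hopf braces of a cocommutative Hopf brace $(A,\cdot,\bullet)$, and let $[X,Y]$ be the normal sub-Hopf brace of $A$ generated by all the elements $$x_1\cdot y_1\cdot S(x_2)\cdot S(y_2),\qquad S(x_1)\cdot(x_2\bullet y_1)\cdot S(y_2),\qquad x_1\bullet y_1\bullet T(x_2)\bullet T(y_2)\qquad(x\in X,\ y\in Y).$$ Then the Huq commutator of $X$ and $Y$ exists and $[X,Y]=[X,Y]_{\mathrm{Huq}}$. -/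

import Mathlib

open scoped TensorProduct
open Coalgebra

universe u v

/-- A Hopf brace `(A, ·, •, 1, Δ, ε, S, T)` over a field `k`. The Hopf algebra
`(A, ·, 1, Δ, ε, S)` is the Mathlib structure `HopfAlgebra k A`; the remaining fields say that
`(A, •, 1, Δ, ε, T)` is a Hopf algebra on the same coalgebra with the same unit, and that
`a • (b · c) = (a₁ • b) · S(a₂) · (a₃ • c)`. -/
class HopfBrace (k : Type v) (A : Type u) [Field k] [Ring A] extends HopfAlgebra k A where
  /-- the second multiplication `a • b` -/
  bullet (k) : A →ₗ[k] A →ₗ[k] A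
  /-- the antipode `T` of the second Hopf algebra structure -/
  bulletAntipode (k) : A →ₗ[k] A
  bullet_assoc : ∀ a b c : A, bullet (bullet a b) c = bullet a (bullet b c)
  one_bullet : ∀ a : A, bullet 1 a = a
  bullet_one : ∀ a : A, bullet a 1 = a
  counit_bullet : ∀ a b : A,
    Coalgebra.counit (R := k) (bullet a b) = Coalgebra.counit (R := k) a * Coalgebra.counit (R := k) b
  /-- `Δ(a • b) = (a₁ • b₁) ⊗ (a₂ • b₂)` -/
  comul_bullet : ∀ a b : A,
    Coalgebra.comul (R := k) (bullet a b)
      = TensorProduct.map₂ bullet bullet (Coalgebra.comul (R := k) a) (Coalgebra.comul (R := k) b)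
  /-- `T(a₁) • a₂ = ε(a) 1` -/
  bulletAntipode_left : ∀ a : A,
    TensorProduct.lift bullet
      (TensorProduct.map bulletAntipode LinearMap.id (Coalgebra.comul (R := k) a))
        = Coalgebra.counit (R := k) a • (1 : A)
  /-- `a₁ • T(a₂) = ε(a) 1` -/
  bulletAntipode_right : ∀ a : A,
    TensorProduct.lift bullet
      (TensorProduct.map LinearMap.id bulletAntipode (Coalgebra.comul (R := k) a))
        = Coalgebra.counit (R := k) a • (1 : A)
  /-- `a • (b · c) = (a₁ • b) · (S(a₂) · (a₃ • c))` -/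
  bullet_mul : ∀ a b c : A,
    bullet a (b * c)
      = LinearMap.mul' k A
          (TensorProduct.map (bullet.flip b)
            (LinearMap.mul' k A ∘ₗ
              TensorProduct.map (HopfAlgebra.antipode k) (bullet.flip c) ∘ₗ Coalgebra.comul (R := k))
            (Coalgebra.comul (R := k) a))

/-- A morphism of Hopf braces: a linear map preserving `1`, `·`, `•`, `Δ` and `ε`. -/
structure HopfBraceHom (k : Type v) (A B : Type*) [Field k] [Ring A] [Ring B]
    [HopfBrace k A] [HopfBrace k B] extends A →ₐc[k] B where
  map_bullet' : ∀ a b : A,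
    toFun (HopfBrace.bullet k a b) = HopfBrace.bullet k (toFun a) (toFun b)

namespace HopfBraceHom

variable {k : Type v} {A B : Type*} [Field k] [Ring A] [Ring B] [HopfBrace k A] [HopfBrace k B]

instance : CoeFun (HopfBraceHom k A B) (fun _ => A → B) := ⟨fun f => f.toBialgHom⟩

/-- The underlying linear map. -/
def lin (f : HopfBraceHom k A B) : A →ₗ[k] B := f.toLinearMap

theorem lin_apply (f : HopfBraceHom k A B) (a : A) : f.lin a = f a := rfl

theorem map_bullet (f : HopfBraceHom k A B) (a b : A) :
    f (HopfBrace.bullet k a b) = HopfBrace.bullet k (f a) (f b) := f.map_bullet' a b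

theorem lin_comul (f : HopfBraceHom k A B) (a : A) :
    TensorProduct.map f.lin f.lin (comul (R := k) a) = comul (R := k) (f a) :=
  LinearMap.congr_fun f.map_comp_comul a

theorem lin_counit (f : HopfBraceHom k A B) (a : A) :
    counit (R := k) (f a) = counit (R := k) a :=
  LinearMap.congr_fun f.counit_comp a

end HopfBraceHom

namespace HopfBrace

theorem map_assoc_rTensor {k : Type v} {M N : Type*} [Field k] [AddCommGroup M] [Module k M]
    [AddCommGroup N] [Module k N] (f : M →ₗ[k] N) (D : M →ₗ[k] M ⊗[k] M)
    (E : N →ₗ[k] N ⊗[k] N) (h : ∀ x, TensorProduct.map f f (D x) = E (f x)) (t : M ⊗[k] M) :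
    TensorProduct.map f (TensorProduct.map f f) (TensorProduct.assoc k M M M (D.rTensor M t))
      = TensorProduct.assoc k N N N (E.rTensor N (TensorProduct.map f f t)) := by
  induction t with
  | zero => simp
  | add x y hx hy => simp only [map_add, hx, hy]
  | tmul x y =>
    simp only [LinearMap.rTensor_tmul, TensorProduct.map_tmul]
    rw [← h x]
    generalize D x = s
    induction s with
    | zero => simp
    | add x y hx hy => simp only [map_add, TensorProduct.add_tmul, hx, hy]
    | tmul a b => simp

theorem map_lTensor {k : Type v} {M N : Type*} [Field k] [AddCommGroup M] [Module k M]
    [AddCommGroup N] [Module k N] (f : M →ₗ[k] N) (D : M →ₗ[k] M ⊗[k] M)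
    (E : N →ₗ[k] N ⊗[k] N) (h : ∀ x, TensorProduct.map f f (D x) = E (f x)) (t : M ⊗[k] M) :
    TensorProduct.map f (TensorProduct.map f f) (D.lTensor M t)
      = E.lTensor N (TensorProduct.map f f t) := by
  induction t with
  | zero => simp
  | add x y hx hy => simp only [map_add, hx, hy]
  | tmul x y => simp [h]

/-- A left and a right convolution inverse of the same map agree. -/
theorem conv_inv_unique {k : Type v} {C : Type*} {K : Type*} [Field k] [AddCommGroup C]
    [Module k C] [Coalgebra k C] [AddCommGroup K] [Module k K] (m : K →ₗ[k] K →ₗ[k] K) (e : K)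
    (hm : ∀ a b c, m (m a b) c = m a (m b c)) (h1 : ∀ a, m e a = a) (h2 : ∀ a, m a e = a)
    (L F R : C →ₗ[k] K)
    (hL : ∀ c, TensorProduct.lift m (TensorProduct.map L F (comul (R := k) c))
      = counit (R := k) c • e)
    (hR : ∀ c, TensorProduct.lift m (TensorProduct.map F R (comul (R := k) c))
      = counit (R := k) c • e) : L = R := by
  have key : ∀ t : (C ⊗[k] C) ⊗[k] C,
      TensorProduct.lift m (TensorProduct.map L (TensorProduct.lift m ∘ₗ TensorProduct.map F R)
        (TensorProduct.assoc k C C C t))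
      = TensorProduct.lift m (TensorProduct.map (TensorProduct.lift m ∘ₗ TensorProduct.map L F) R
        t) := by
    intro t
    induction t with
    | zero => simp
    | add x y hx hy => simp only [map_add, hx, hy]
    | tmul x z =>
      induction x with
      | zero => simp
      | add x y hx hy => simp only [map_add, hx, hy, TensorProduct.add_tmul]
      | tmul x y => simp [hm]
  ext c
  have h := key ((comul (R := k)).rTensor C (comul (R := k) c))
  rw [Coalgebra.coassoc_apply] at h
  have hR' : (TensorProduct.lift m ∘ₗ TensorProduct.map F R) ∘ₗ comul (R := k)
      = (LinearMap.toSpanSingleton k K e) ∘ₗ counit (R := k) := by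
    ext c; simpa using hR c
  have hL' : (TensorProduct.lift m ∘ₗ TensorProduct.map L F) ∘ₗ comul (R := k)
      = (LinearMap.toSpanSingleton k K e) ∘ₗ counit (R := k) := by
    ext c; simpa using hL c
  have e1 : ∀ t : C ⊗[k] C, TensorProduct.lift m (TensorProduct.map L
      (TensorProduct.lift m ∘ₗ TensorProduct.map F R) ((comul (R := k)).lTensor C t))
      = L (TensorProduct.rid k C ((counit (R := k)).lTensor C t)) := by
    intro t
    induction t with
    | zero => simp
    | add x y hx hy => simp only [map_add, hx, hy]
    | tmul x y =>
      have := LinearMap.congr_fun hR' y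
      simp only [LinearMap.comp_apply] at this
      simp [this, h2]
  have e2 : ∀ t : C ⊗[k] C, TensorProduct.lift m (TensorProduct.map
      (TensorProduct.lift m ∘ₗ TensorProduct.map L F) R ((comul (R := k)).rTensor C t))
      = R (TensorProduct.lid k C ((counit (R := k)).rTensor C t)) := by
    intro t
    induction t with
    | zero => simp
    | add x y hx hy => simp only [map_add, hx, hy]
    | tmul x y =>
      have := LinearMap.congr_fun hL' x
      simp only [LinearMap.comp_apply] at this
      simp [this, h1]
  rw [e1, e2] at h
  simpa using h

end HopfBrace

namespace HopfBraceHom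

variable {k : Type v} {A B : Type*} [Field k] [Ring A] [Ring B] [HopfBrace k A] [HopfBrace k B]

/-- Morphisms of Hopf braces automatically preserve `S`. -/
theorem map_antipode (f : HopfBraceHom k A B) (a : A) :
    f (HopfAlgebra.antipode k a) = HopfAlgebra.antipode k (f a) := by
  have hmul : ∀ t : A ⊗[k] A, LinearMap.mul' k B (TensorProduct.map f.lin f.lin t)
      = f.lin (LinearMap.mul' k A t) := by
    intro t
    induction t with
    | zero => simp
    | add x y hx hy => simp only [map_add, hx, hy]
    | tmul x y => simp [lin_apply]
  have h := HopfBrace.conv_inv_unique (k := k) (LinearMap.mul k B) 1 (fun a b c => mul_assoc a b c)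
    (fun a => one_mul a) (fun a => mul_one a)
    (f.lin ∘ₗ HopfAlgebra.antipode k) f.lin (HopfAlgebra.antipode k ∘ₗ f.lin) ?_ ?_
  · exact LinearMap.congr_fun h a
  · intro c
    have h1 := HopfAlgebra.mul_antipode_rTensor_comul_apply (R := k) c
    have h2 := hmul ((HopfAlgebra.antipode k).rTensor A (comul (R := k) c))
    rw [h1, LinearMap.rTensor, TensorProduct.map_map] at h2
    refine h2.trans ?_
    rw [Algebra.algebraMap_eq_smul_one, map_smul, lin_apply]
    simp
  · intro c
    have h1 := HopfAlgebra.mul_antipode_lTensor_comul_apply (R := k) (f c)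
    rw [← f.lin_comul, LinearMap.lTensor, TensorProduct.map_map, f.lin_counit,
      Algebra.algebraMap_eq_smul_one] at h1
    exact h1

/-- Morphisms of Hopf braces automatically preserve `T`. -/
theorem map_bulletAntipode (f : HopfBraceHom k A B) (a : A) :
    f (HopfBrace.bulletAntipode k a) = HopfBrace.bulletAntipode k (f a) := by
  have hmul : ∀ t : A ⊗[k] A,
      TensorProduct.lift (HopfBrace.bullet k) (TensorProduct.map f.lin f.lin t)
      = f.lin (TensorProduct.lift (HopfBrace.bullet k) t) := by
    intro t
    induction t with
    | zero => simp
    | add x y hx hy => simp only [map_add, hx, hy]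
    | tmul x y => simp [lin_apply, map_bullet]
  have h := HopfBrace.conv_inv_unique (k := k) (HopfBrace.bullet k (A := B)) 1
    HopfBrace.bullet_assoc HopfBrace.one_bullet HopfBrace.bullet_one
    (f.lin ∘ₗ HopfBrace.bulletAntipode k) f.lin (HopfBrace.bulletAntipode k ∘ₗ f.lin) ?_ ?_
  · exact LinearMap.congr_fun h a
  · intro c
    have h1 := HopfBrace.bulletAntipode_left (k := k) c
    have h2 := hmul (TensorProduct.map (HopfBrace.bulletAntipode k) LinearMap.id
      (comul (R := k) c))
    rw [h1, TensorProduct.map_map] at h2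
    refine h2.trans ?_
    rw [map_smul, lin_apply]
    simp
  · intro c
    have h1 := HopfBrace.bulletAntipode_right (k := k) (f c)
    rw [← f.lin_comul, TensorProduct.map_map, f.lin_counit] at h1
    exact h1

end HopfBraceHom

/-! ### Sub-Hopf braces -/

/-- A sub-Hopf brace: a subspace containing `1` and closed under `·`, `•`, `Δ`, `S` and `T`.
Closure under `Δ` means `Δ(X) ⊆ X ⊗ X`, where `X ⊗ X` is viewed inside `A ⊗ A`. -/
structure SubHopfBrace (k : Type v) (A : Type u) [Field k] [Ring A] [HopfBrace k A]
    extends Subalgebra k A where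
  bullet_mem' : ∀ {a b : A}, a ∈ carrier → b ∈ carrier → HopfBrace.bullet k a b ∈ carrier
  comul_mem' : ∀ {a : A}, a ∈ carrier →
    comul (R := k) a ∈ LinearMap.range
      (TensorProduct.map toSubalgebra.val.toLinearMap toSubalgebra.val.toLinearMap)
  antipode_mem' : ∀ {a : A}, a ∈ carrier → HopfAlgebra.antipode k a ∈ carrier
  bulletAntipode_mem' : ∀ {a : A}, a ∈ carrier → HopfBrace.bulletAntipode k a ∈ carrier

namespace SubHopfBrace

variable {k : Type v} {A : Type u} [Field k] [Ring A] [HopfBrace k A]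

instance : SetLike (SubHopfBrace k A) A where
  coe X := X.carrier
  coe_injective X Y h := by
    obtain ⟨X, _, _, _, _⟩ := X
    obtain ⟨Y, _, _, _, _⟩ := Y
    have : X = Y := SetLike.coe_injective h
    subst this
    rfl

/-- Sub-Hopf braces are ordered by inclusion. -/
instance : PartialOrder (SubHopfBrace k A) := PartialOrder.ofSetLike (SubHopfBrace k A) A

/-- The underlying vector space of a sub-Hopf brace. -/
abbrev Carrier (X : SubHopfBrace k A) : Type u := ↥X.toSubalgebra

/-- The inclusion of a sub-Hopf brace, as a linear map. -/
def incl (X : SubHopfBrace k A) : X.Carrier →ₗ[k] A := X.toSubalgebra.val.toLinearMap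

theorem incl_apply (X : SubHopfBrace k A) (x : X.Carrier) : X.incl x = x := rfl

theorem incl_injective (X : SubHopfBrace k A) : Function.Injective X.incl :=
  Subtype.val_injective

theorem map_incl_injective (X : SubHopfBrace k A) :
    Function.Injective (TensorProduct.map X.incl X.incl) :=
  TensorProduct.map_injective_of_flat_flat _ _ X.incl_injective X.incl_injective

/-- The restriction of `Δ` to a map `X → X ⊗ X`. -/
noncomputable def comulRestrict (X : SubHopfBrace k A) : X.Carrier →ₗ[k] X.Carrier ⊗[k] X.Carrier :=
  (LinearEquiv.ofInjective _ X.map_incl_injective).symm.toLinearMap ∘ₗ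
    LinearMap.codRestrict _ (comul (R := k) ∘ₗ X.incl) (fun x => X.comul_mem' x.2)

theorem map_comulRestrict (X : SubHopfBrace k A) (x : X.Carrier) :
    TensorProduct.map X.incl X.incl (X.comulRestrict x) = comul (R := k) (x : A) := by
  have h := LinearEquiv.apply_symm_apply (LinearEquiv.ofInjective _ X.map_incl_injective)
    (LinearMap.codRestrict _ (comul (R := k) ∘ₗ X.incl) (fun x => X.comul_mem' x.2) x)
  exact congrArg Subtype.val h

noncomputable instance instCoalgebraStruct (X : SubHopfBrace k A) :
    CoalgebraStruct k X.Carrier where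
  comul := X.comulRestrict
  counit := counit (R := k) ∘ₗ X.incl

theorem map_incl_comul (X : SubHopfBrace k A) (x : X.Carrier) :
    TensorProduct.map X.incl X.incl (comul (R := k) x) = comul (R := k) (x : A) :=
  X.map_comulRestrict x

theorem counit_coe (X : SubHopfBrace k A) (x : X.Carrier) :
    counit (R := k) x = counit (R := k) (x : A) := rfl

noncomputable instance instCoalgebra (X : SubHopfBrace k A) : Coalgebra k X.Carrier where
  coassoc := by
    ext x
    have hinj : Function.Injective
        (TensorProduct.map X.incl (TensorProduct.map X.incl X.incl)) :=
      TensorProduct.map_injective_of_flat_flat _ _ X.incl_injective X.map_incl_injective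
    apply hinj
    have hD : ∀ y : X.Carrier, TensorProduct.map X.incl X.incl (comul (R := k) y)
        = comul (R := k) (X.incl y) := X.map_incl_comul
    simp only [LinearMap.comp_apply, LinearEquiv.coe_coe]
    rw [HopfBrace.map_assoc_rTensor _ _ _ hD, HopfBrace.map_lTensor _ _ _ hD, hD,
      Coalgebra.coassoc_apply]
  rTensor_counit_comp_comul := by
    ext x
    have hinj : Function.Injective (X.incl.lTensor k) :=
      Module.Flat.lTensor_preserves_injective_linearMap _ X.incl_injective
    apply hinj
    have e1 : ∀ t : X.Carrier ⊗[k] X.Carrier,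
        X.incl.lTensor k ((counit (R := k)).rTensor _ t)
        = (counit (R := k)).rTensor _ (TensorProduct.map X.incl X.incl t) := by
      intro t
      induction t with
      | zero => simp
      | add x y hx hy => simp only [map_add, hx, hy]
      | tmul x y => simp [incl_apply, counit_coe]
    simp only [LinearMap.comp_apply]
    rw [e1, X.map_incl_comul, Coalgebra.rTensor_counit_comul]
    simp [incl_apply]
  lTensor_counit_comp_comul := by
    ext x
    have hinj : Function.Injective (X.incl.rTensor k) :=
      Module.Flat.rTensor_preserves_injective_linearMap _ X.incl_injective
    apply hinj
    have e1 : ∀ t : X.Carrier ⊗[k] X.Carrier,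
        X.incl.rTensor k ((counit (R := k)).lTensor _ t)
        = (counit (R := k)).lTensor _ (TensorProduct.map X.incl X.incl t) := by
      intro t
      induction t with
      | zero => simp
      | add x y hx hy => simp only [map_add, hx, hy]
      | tmul x y => simp [incl_apply, counit_coe]
    simp only [LinearMap.comp_apply]
    rw [e1, X.map_incl_comul, Coalgebra.lTensor_counit_comul]
    simp [incl_apply]

noncomputable instance instBialgebra (X : SubHopfBrace k A) : Bialgebra k X.Carrier :=
  Bialgebra.mk' k X.Carrier
    (by change counit (R := k) (1 : A) = 1; simp)
    (by intro a b
        change counit (R := k) ((a : A) * (b : A)) = counit (R := k) (a : A) * counit (R := k) (b : A)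
        simp)
    (by apply X.map_incl_injective
        refine (X.map_incl_comul 1).trans ?_
        simp [Algebra.TensorProduct.one_def, incl_apply])
    (by intro a b
        apply X.map_incl_injective
        refine (X.map_incl_comul (a * b)).trans ?_
        have e : ∀ s t : X.Carrier ⊗[k] X.Carrier,
            TensorProduct.map X.incl X.incl (s * t)
              = TensorProduct.map X.incl X.incl s * TensorProduct.map X.incl X.incl t := by
          intro s t
          exact map_mul (Algebra.TensorProduct.map X.toSubalgebra.val X.toSubalgebra.val) s t
        refine Eq.trans ?_ (e _ _).symm
        rw [X.map_incl_comul a, X.map_incl_comul b]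
        simp)

/-- The restriction of `S` to a sub-Hopf brace. -/
def antipodeRestrict (X : SubHopfBrace k A) : X.Carrier →ₗ[k] X.Carrier :=
  LinearMap.codRestrict (Subalgebra.toSubmodule X.toSubalgebra) (HopfAlgebra.antipode k ∘ₗ X.incl)
    (fun x => X.antipode_mem' x.2)

/-- The restriction of `T` to a sub-Hopf brace. -/
def bulletAntipodeRestrict (X : SubHopfBrace k A) : X.Carrier →ₗ[k] X.Carrier :=
  LinearMap.codRestrict (Subalgebra.toSubmodule X.toSubalgebra)
    (HopfBrace.bulletAntipode k ∘ₗ X.incl) (fun x => X.bulletAntipode_mem' x.2)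

/-- The restriction of `•` to a sub-Hopf brace. -/
def bulletRestrict (X : SubHopfBrace k A) : X.Carrier →ₗ[k] X.Carrier →ₗ[k] X.Carrier :=
  LinearMap.mk₂ k (fun x y => ⟨HopfBrace.bullet k (x : A) (y : A), X.bullet_mem' x.2 y.2⟩)
    (fun x y z => Subtype.ext (by simp)) (fun c x y => Subtype.ext (by simp))
    (fun x y z => Subtype.ext (by simp)) (fun c x y => Subtype.ext (by simp))

noncomputable instance instHopfAlgebra (X : SubHopfBrace k A) : HopfAlgebra k X.Carrier where
  antipode := X.antipodeRestrict
  mul_antipode_rTensor_comul := by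
    ext x
    have e : ∀ t : X.Carrier ⊗[k] X.Carrier,
        ((LinearMap.mul' k X.Carrier (X.antipodeRestrict.rTensor _ t) : X.Carrier) : A)
          = LinearMap.mul' k A ((HopfAlgebra.antipode k).rTensor A
              (TensorProduct.map X.incl X.incl t)) := by
      intro t
      induction t with
      | zero => simp
      | add x y hx hy => simp only [map_add, Subalgebra.coe_add, hx, hy]
      | tmul x y => rfl
    refine (e _).trans ?_
    rw [X.map_incl_comul, HopfAlgebra.mul_antipode_rTensor_comul_apply]
    rfl
  mul_antipode_lTensor_comul := by
    ext x
    have e : ∀ t : X.Carrier ⊗[k] X.Carrier,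
        ((LinearMap.mul' k X.Carrier (X.antipodeRestrict.lTensor _ t) : X.Carrier) : A)
          = LinearMap.mul' k A ((HopfAlgebra.antipode k).lTensor A
              (TensorProduct.map X.incl X.incl t)) := by
      intro t
      induction t with
      | zero => simp
      | add x y hx hy => simp only [map_add, Subalgebra.coe_add, hx, hy]
      | tmul x y => rfl
    refine (e _).trans ?_
    rw [X.map_incl_comul, HopfAlgebra.mul_antipode_lTensor_comul_apply]
    rfl

theorem coe_lift_bullet (X : SubHopfBrace k A) (f : X.Carrier →ₗ[k] X.Carrier)
    (g : X.Carrier →ₗ[k] X.Carrier) (F G : A →ₗ[k] A) (hf : ∀ x, (f x : A) = F x)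
    (hg : ∀ x, (g x : A) = G x) (t : X.Carrier ⊗[k] X.Carrier) :
    ((TensorProduct.lift X.bulletRestrict (TensorProduct.map f g t) : X.Carrier) : A)
      = TensorProduct.lift (HopfBrace.bullet k)
          (TensorProduct.map F G (TensorProduct.map X.incl X.incl t)) := by
  induction t with
  | zero => simp
  | add x y hx hy => simp only [map_add, Subalgebra.coe_add, hx, hy]
  | tmul x y => simp [incl_apply, bulletRestrict, hf, hg]

/-- A sub-Hopf brace is a Hopf brace with the restricted operations. -/
noncomputable instance instHopfBrace (X : SubHopfBrace k A) : HopfBrace k X.Carrier where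
  bullet := X.bulletRestrict
  bulletAntipode := X.bulletAntipodeRestrict
  bullet_assoc a b c := Subtype.ext (HopfBrace.bullet_assoc (a : A) b c)
  one_bullet a := Subtype.ext (HopfBrace.one_bullet (a : A))
  bullet_one a := Subtype.ext (HopfBrace.bullet_one (a : A))
  counit_bullet a b := HopfBrace.counit_bullet (a : A) b
  comul_bullet a b := by
    apply X.map_incl_injective
    refine (X.map_incl_comul _).trans ?_
    refine (HopfBrace.comul_bullet (a : A) b).trans ?_
    rw [← X.map_incl_comul a, ← X.map_incl_comul b]
    generalize comul (R := k) a = s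
    generalize comul (R := k) b = t
    induction s with
    | zero => simp
    | add x y hx hy => simp only [map_add, LinearMap.add_apply, hx, hy]
    | tmul x y =>
      induction t with
      | zero => simp
      | add x y hx hy => simp only [map_add, hx, hy]
      | tmul z w => rfl
  bulletAntipode_left a := Subtype.ext (by
    rw [X.coe_lift_bullet _ _ (HopfBrace.bulletAntipode k) LinearMap.id (fun _ => rfl)
      (fun _ => rfl), X.map_incl_comul, HopfBrace.bulletAntipode_left]
    rfl)
  bulletAntipode_right a := Subtype.ext (by
    rw [X.coe_lift_bullet _ _ LinearMap.id (HopfBrace.bulletAntipode k) (fun _ => rfl)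
      (fun _ => rfl), X.map_incl_comul, HopfBrace.bulletAntipode_right]
    rfl)
  bullet_mul a b c := Subtype.ext (by
    refine (HopfBrace.bullet_mul (a : A) b c).trans ?_
    rw [← X.map_incl_comul a]
    generalize comul (R := k) a = s
    induction s with
    | zero => simp
    | add x y hx hy => simp only [map_add, Subalgebra.coe_add, hx, hy]
    | tmul x y =>
      simp only [TensorProduct.map_tmul, LinearMap.mul'_apply, LinearMap.comp_apply,
        LinearMap.flip_apply, incl_apply, Subalgebra.coe_mul]
      rw [← X.map_incl_comul y]
      congr 1
      generalize comul (R := k) y = t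
      induction t with
      | zero => simp
      | add x y hx hy => simp only [map_add, Subalgebra.coe_add, hx, hy]
      | tmul z w => rfl)

/-- The image of a sub-Hopf brace under a morphism. -/
def map {B : Type*} [Ring B] [HopfBrace k B] (f : HopfBraceHom k A B) (X : SubHopfBrace k A) :
    SubHopfBrace k B where
  toSubalgebra := X.toSubalgebra.map (f.toBialgHom : A →ₐ[k] B)
  bullet_mem' := by
    rintro _ _ ⟨a, ha, rfl⟩ ⟨b, hb, rfl⟩
    exact ⟨HopfBrace.bullet k a b, X.bullet_mem' ha hb, f.map_bullet a b⟩
  comul_mem' := by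
    rintro _ ⟨a, ha, rfl⟩
    obtain ⟨t, ht⟩ := X.comul_mem' ha
    let g : X.toSubalgebra →ₗ[k] (X.toSubalgebra.map (f.toBialgHom : A →ₐ[k] B)) :=
      LinearMap.codRestrict
        (Subalgebra.toSubmodule (X.toSubalgebra.map (f.toBialgHom : A →ₐ[k] B)))
        (f.lin ∘ₗ X.incl) (fun x => ⟨x, x.2, rfl⟩)
    refine ⟨TensorProduct.map g g t, ?_⟩
    refine Eq.trans ?_ (f.lin_comul a)
    rw [← ht]
    exact (TensorProduct.map_map _ _ _ _ t).trans
      (TensorProduct.map_map f.lin f.lin X.incl X.incl t).symm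
  antipode_mem' := by
    rintro _ ⟨a, ha, rfl⟩
    exact ⟨HopfAlgebra.antipode k a, X.antipode_mem' ha, f.map_antipode a⟩
  bulletAntipode_mem' := by
    rintro _ ⟨a, ha, rfl⟩
    exact ⟨HopfBrace.bulletAntipode k a, X.bulletAntipode_mem' ha, f.map_bulletAntipode a⟩

end SubHopfBrace

/-! ### The tensor product Hopf brace -/

namespace HopfBrace

section Tensor

variable {k : Type v} {H : Type*} {K : Type*} [Field k] [Ring H] [Ring K] [HopfBrace k H]
  [HopfBrace k K]

theorem map_map₂_lift (m : H →ₗ[k] H →ₗ[k] H) (n : K →ₗ[k] K →ₗ[k] K) (f g : H →ₗ[k] H)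
    (f' g' : K →ₗ[k] K) (s : H ⊗[k] H) (t : K ⊗[k] K) :
    TensorProduct.lift (TensorProduct.map₂ m n)
      (TensorProduct.map (TensorProduct.map f f') (TensorProduct.map g g')
        (TensorProduct.tensorTensorTensorComm k H H K K (s ⊗ₜ[k] t)))
      = TensorProduct.lift m (TensorProduct.map f g s) ⊗ₜ[k]
        TensorProduct.lift n (TensorProduct.map f' g' t) := by
  induction s with
  | zero => simp
  | add x y hx hy => simp only [map_add, TensorProduct.add_tmul, hx, hy]
  | tmul a b =>
    induction t with
    | zero => simp
    | add x y hx hy => simp only [map_add, TensorProduct.tmul_add, hx, hy]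
    | tmul c d => simp

theorem mul'_map_tensorComm (f g : H →ₗ[k] H) (f' g' : K →ₗ[k] K) (s : H ⊗[k] H)
    (t : K ⊗[k] K) :
    LinearMap.mul' k (H ⊗[k] K)
      (TensorProduct.map (TensorProduct.map f f') (TensorProduct.map g g')
        (TensorProduct.tensorTensorTensorComm k H H K K (s ⊗ₜ[k] t)))
      = LinearMap.mul' k H (TensorProduct.map f g s) ⊗ₜ[k]
        LinearMap.mul' k K (TensorProduct.map f' g' t) := by
  induction s with
  | zero => simp
  | add x y hx hy => simp only [map_add, TensorProduct.add_tmul, hx, hy]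
  | tmul a b =>
    induction t with
    | zero => simp
    | add x y hx hy => simp only [map_add, TensorProduct.tmul_add, hx, hy]
    | tmul c d => simp

theorem comul_tmul' (x : H) (y : K) :
    comul (R := k) (x ⊗ₜ[k] y)
      = TensorProduct.tensorTensorTensorComm k H H K K (comul (R := k) x ⊗ₜ[k] comul (R := k) y) :=
  rfl

/-- The tensor product of two Hopf braces, with componentwise operations: on top of Mathlib's
tensor product of Hopf algebras for `(·, S)`, one has `(h ⊗ k) • (h' ⊗ k') = (h • h') ⊗ (k • k')`
and the antipode `T ⊗ T`. For cocommutative Hopf braces it is their binary product. -/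
noncomputable instance instTensor : HopfBrace k (H ⊗[k] K) where
  bullet := TensorProduct.map₂ (bullet k) (bullet k)
  bulletAntipode := TensorProduct.map (bulletAntipode k) (bulletAntipode k)
  bullet_assoc a b c := by
    induction a with
    | zero => simp
    | add x y hx hy => simp only [map_add, LinearMap.add_apply, hx, hy]
    | tmul a a' =>
      induction b with
      | zero => simp
      | add x y hx hy => simp only [map_add, LinearMap.add_apply, hx, hy]
      | tmul b b' =>
        induction c with
        | zero => simp
        | add x y hx hy => simp only [map_add, hx, hy]
        | tmul c c' => simp [bullet_assoc]
  one_bullet a := by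
    induction a with
    | zero => simp
    | add x y hx hy => simp only [map_add, hx, hy]
    | tmul a a' => simp [Algebra.TensorProduct.one_def, one_bullet]
  bullet_one a := by
    induction a with
    | zero => simp
    | add x y hx hy => simp only [map_add, LinearMap.add_apply, hx, hy]
    | tmul a a' => simp [Algebra.TensorProduct.one_def, bullet_one]
  counit_bullet a b := by
    induction a with
    | zero => simp
    | add x y hx hy => simp only [map_add, LinearMap.add_apply, hx, hy, add_mul]
    | tmul a a' =>
      induction b with
      | zero => simp
      | add x y hx hy => simp only [map_add, hx, hy, mul_add]
      | tmul b b' => simp [counit_bullet]; ring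
  comul_bullet a b := by
    induction a with
    | zero => simp
    | add x y hx hy => simp only [map_add, LinearMap.add_apply, hx, hy]
    | tmul a a' =>
      induction b with
      | zero => simp
      | add x y hx hy => simp only [map_add, hx, hy]
      | tmul b b' =>
        rw [TensorProduct.map₂_apply_tmul, TensorProduct.map_tmul, comul_tmul', comul_tmul',
          comul_tmul', comul_bullet, comul_bullet]
        generalize comul (R := k) a = p
        generalize comul (R := k) b = q
        generalize comul (R := k) a' = r
        generalize comul (R := k) b' = s
        induction p with
        | zero => simp
        | add x y hx hy => simp only [map_add, LinearMap.add_apply, TensorProduct.add_tmul, hx, hy]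
        | tmul p p' =>
          induction q with
          | zero => simp
          | add x y hx hy => simp only [map_add, TensorProduct.add_tmul, hx, hy]
          | tmul q q' =>
            induction r with
            | zero => simp
            | add x y hx hy =>
              simp only [map_add, LinearMap.add_apply, TensorProduct.tmul_add, hx, hy]
            | tmul r r' =>
              induction s with
              | zero => simp
              | add x y hx hy => simp only [map_add, TensorProduct.tmul_add, hx, hy]
              | tmul s s' => simp
  bulletAntipode_left a := by
    induction a with
    | zero => simp
    | add x y hx hy => simp only [map_add, hx, hy, add_smul]
    | tmul a a' =>
      rw [comul_tmul', ← TensorProduct.map_id, map_map₂_lift, bulletAntipode_left,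
        bulletAntipode_left, TensorProduct.counit_tmul, TensorProduct.smul_tmul_smul,
        Algebra.TensorProduct.one_def, smul_eq_mul, mul_comm]
  bulletAntipode_right a := by
    induction a with
    | zero => simp
    | add x y hx hy => simp only [map_add, hx, hy, add_smul]
    | tmul a a' =>
      rw [comul_tmul', ← TensorProduct.map_id, map_map₂_lift, bulletAntipode_right,
        bulletAntipode_right, TensorProduct.counit_tmul, TensorProduct.smul_tmul_smul,
        Algebra.TensorProduct.one_def, smul_eq_mul, mul_comm]
  bullet_mul a b c := by
    induction b with
    | zero => simp
    | add x y hx hy =>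
      simp only [map_add, add_mul, TensorProduct.map_add_left, LinearMap.add_apply, hx, hy]
    | tmul b b' =>
      induction c with
      | zero => simp
      | add x y hx hy =>
        simp only [map_add, mul_add, TensorProduct.map_add_right, LinearMap.add_apply,
          LinearMap.comp_add, LinearMap.add_comp, hx, hy]
      | tmul c c' =>
        have hflip : ∀ (x : H) (y : K),
            (TensorProduct.map₂ (bullet k) (bullet k)).flip (x ⊗ₜ[k] y)
              = TensorProduct.map ((bullet k).flip x) ((bullet k).flip y) := by
          intro x y
          ext p q
          simp
        have hG : LinearMap.mul' k (H ⊗[k] K) ∘ₗ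
            TensorProduct.map (HopfAlgebra.antipode k)
              (TensorProduct.map ((bullet k).flip c) ((bullet k).flip c')) ∘ₗ comul (R := k)
            = TensorProduct.map
              (LinearMap.mul' k H ∘ₗ
                TensorProduct.map (HopfAlgebra.antipode k) ((bullet k).flip c) ∘ₗ comul (R := k))
              (LinearMap.mul' k K ∘ₗ
                TensorProduct.map (HopfAlgebra.antipode k) ((bullet k).flip c') ∘ₗ
                  comul (R := k)) := by
          ext p q
          exact mul'_map_tensorComm _ _ _ _ _ _
        rw [hflip, hflip, hG]
        induction a with
        | zero => simp
        | add x y hx hy => simp only [map_add, LinearMap.add_apply, hx, hy]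
        | tmul a a' =>
          rw [comul_tmul', mul'_map_tensorComm, ← bullet_mul, ← bullet_mul]
          simp

end Tensor

end HopfBrace

/-! ### Intersections, normality, generation -/

namespace SubHopfBrace

theorem eq_of_lTensor_functional {k : Type v} {M N : Type*} [Field k] [AddCommGroup M] [Module k M]
    [AddCommGroup N] [Module k N] (s t : M ⊗[k] N)
    (h : ∀ φ : N →ₗ[k] k, TensorProduct.rid k M (φ.lTensor M s)
      = TensorProduct.rid k M (φ.lTensor M t)) : s = t := by
  classical
  let b := Module.Basis.ofVectorSpace k N
  have e : ∀ (z : M ⊗[k] N) i, TensorProduct.equivFinsuppOfBasisRight (M := M) b z i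
      = TensorProduct.rid k M ((b.coord i).lTensor M z) := by
    intro z i
    induction z with
    | zero => simp
    | add x y hx hy => simp only [map_add, Finsupp.add_apply, hx, hy]
    | tmul x y => simp
  apply (TensorProduct.equivFinsuppOfBasisRight (M := M) b).injective
  ext i
  rw [e, e, h]

/-- Over a field, a tensor lies in `W ⊗ W` as soon as all its one-sided slices lie in `W`. -/
theorem mem_range_map_of_slices {k : Type v} {W M : Type*} [Field k] [AddCommGroup W] [Module k W]
    [AddCommGroup M] [Module k M] (i : W →ₗ[k] M) (hi : Function.Injective i) (t : M ⊗[k] M)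
    (h1 : ∀ φ : M →ₗ[k] k, TensorProduct.rid k M (φ.lTensor M t) ∈ LinearMap.range i)
    (h2 : ∀ φ : M →ₗ[k] k, TensorProduct.lid k M (φ.rTensor M t) ∈ LinearMap.range i) :
    t ∈ LinearMap.range (TensorProduct.map i i) := by
  obtain ⟨r, hr⟩ := i.exists_leftInverse_of_injective (LinearMap.ker_eq_bot.mpr hi)
  have hP : ∀ a ∈ LinearMap.range i, i (r a) = a := by
    rintro _ ⟨w, rfl⟩
    have := LinearMap.congr_fun hr w
    simp only [LinearMap.comp_apply, LinearMap.id_apply] at this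
    rw [this]
  have e1 : (i ∘ₗ r).rTensor M t = t := by
    apply eq_of_lTensor_functional
    intro φ
    have : ∀ z : M ⊗[k] M, TensorProduct.rid k M (φ.lTensor M ((i ∘ₗ r).rTensor M z))
        = i (r (TensorProduct.rid k M (φ.lTensor M z))) := by
      intro z
      induction z with
      | zero => simp
      | add x y hx hy => simp only [map_add, hx, hy]
      | tmul x y => simp
    rw [this, hP _ (h1 φ)]
  have e2 : (i ∘ₗ r).lTensor M t = t := by
    apply (TensorProduct.comm k M M).injective
    apply eq_of_lTensor_functional
    intro φ
    have : ∀ z : M ⊗[k] M, TensorProduct.rid k M (φ.lTensor M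
          (TensorProduct.comm k M M ((i ∘ₗ r).lTensor M z)))
        = i (r (TensorProduct.lid k M (φ.rTensor M z))) := by
      intro z
      induction z with
      | zero => simp
      | add x y hx hy => simp only [map_add, hx, hy]
      | tmul x y => simp
    have h' : ∀ z : M ⊗[k] M, TensorProduct.rid k M (φ.lTensor M (TensorProduct.comm k M M z))
        = TensorProduct.lid k M (φ.rTensor M z) := by
      intro z
      induction z with
      | zero => simp
      | add x y hx hy => simp only [map_add, hx, hy]
      | tmul x y => simp
    rw [this, hP _ (h2 φ), h']
  refine ⟨TensorProduct.map r r t, ?_⟩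
  rw [TensorProduct.map_map]
  have : ∀ z : M ⊗[k] M, TensorProduct.map (i ∘ₗ r) (i ∘ₗ r) z
      = (i ∘ₗ r).rTensor M ((i ∘ₗ r).lTensor M z) := by
    intro z
    induction z with
    | zero => simp
    | add x y hx hy => simp only [map_add, hx, hy]
    | tmul x y => simp
  rw [this, e2, e1]

variable {k : Type v} {A : Type u} [Field k] [Ring A] [HopfBrace k A]

theorem slices_mem (X : SubHopfBrace k A) {a : A} (ha : a ∈ X) (φ : A →ₗ[k] k) :
    TensorProduct.rid k A (φ.lTensor A (comul (R := k) a)) ∈ X ∧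
      TensorProduct.lid k A (φ.rTensor A (comul (R := k) a)) ∈ X := by
  obtain ⟨t, ht⟩ := X.comul_mem' ha
  rw [← ht]
  clear ht
  change _ ∈ X.toSubalgebra ∧ _ ∈ X.toSubalgebra
  induction t with
  | zero => simp [zero_mem]
  | add x y hx hy =>
    simp only [map_add]
    exact ⟨add_mem hx.1 hy.1, add_mem hx.2 hy.2⟩
  | tmul x y =>
    simp only [TensorProduct.map_tmul, LinearMap.lTensor_tmul, LinearMap.rTensor_tmul,
      TensorProduct.rid_tmul, TensorProduct.lid_tmul]
    exact ⟨X.toSubalgebra.smul_mem x.2 _, X.toSubalgebra.smul_mem y.2 _⟩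

/-- The intersection of a family of sub-Hopf braces. -/
def sInter (F : Set (SubHopfBrace k A)) : SubHopfBrace k A where
  carrier := {a | ∀ X ∈ F, a ∈ X}
  mul_mem' ha hb := fun X hX => X.mul_mem' (ha X hX) (hb X hX)
  add_mem' ha hb := fun X hX => X.add_mem' (ha X hX) (hb X hX)
  algebraMap_mem' r := fun X _ => X.algebraMap_mem' r
  bullet_mem' ha hb := fun X hX => X.bullet_mem' (ha X hX) (hb X hX)
  comul_mem' ha := by
    apply mem_range_map_of_slices
    · exact Subtype.val_injective
    · intro φ
      exact ⟨⟨_, fun X hX => (X.slices_mem (ha X hX) φ).1⟩, rfl⟩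
    · intro φ
      exact ⟨⟨_, fun X hX => (X.slices_mem (ha X hX) φ).2⟩, rfl⟩
  antipode_mem' ha := fun X hX => X.antipode_mem' (ha X hX)
  bulletAntipode_mem' ha := fun X hX => X.bulletAntipode_mem' (ha X hX)

theorem mem_sInter (F : Set (SubHopfBrace k A)) (a : A) : a ∈ sInter F ↔ ∀ X ∈ F, a ∈ X :=
  Iff.rfl

end SubHopfBrace

namespace HopfBrace

variable (k : Type v) {A : Type u} [Field k] [Ring A] [HopfBrace k A]

/-- The action `a ⇀ b = S(a₁) · (a₂ • b)`. -/
noncomputable def act : A →ₗ[k] A →ₗ[k] A :=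
  LinearMap.mk₂ k
    (fun a b => LinearMap.mul' k A
      (TensorProduct.map (HopfAlgebra.antipode k) ((bullet k).flip b) (comul (R := k) a)))
    (fun a b c => by simp) (fun c a b => by simp)
    (fun a b c => by simp [TensorProduct.map_add_right])
    (fun c a b => by simp [TensorProduct.map_smul_right])

/-- `a₁ · b · S(a₂)` -/
noncomputable def conj (a b : A) : A :=
  LinearMap.mul' k A
    (TensorProduct.map ((LinearMap.mul k A).flip b) (HopfAlgebra.antipode k) (comul (R := k) a))

/-- `a₁ • b • T(a₂)` -/
noncomputable def bulletConj (a b : A) : A :=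
  TensorProduct.lift (bullet k)
    (TensorProduct.map ((bullet k).flip b) (bulletAntipode k) (comul (R := k) a))

/-- `x₁ · y₁ · S(x₂) · S(y₂)` -/
noncomputable def dotCommutator (x y : A) : A :=
  LinearMap.mul' k A
    (TensorProduct.map₂ (LinearMap.mul k A)
      ((LinearMap.mul k A).compl₁₂ (HopfAlgebra.antipode k) (HopfAlgebra.antipode k))
      (comul (R := k) x) (comul (R := k) y))

/-- `S(x₁) · (x₂ • y₁) · S(y₂) = (x ⇀ y₁) · S(y₂)` -/
noncomputable def starCommutator (x y : A) : A :=
  LinearMap.mul' k A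
    (TensorProduct.map (act k x) (HopfAlgebra.antipode k) (comul (R := k) y))

/-- `x₁ • y₁ • T(x₂) • T(y₂)` -/
noncomputable def bulletCommutator (x y : A) : A :=
  TensorProduct.lift (bullet k)
    (TensorProduct.map₂ (bullet k)
      ((bullet k).compl₁₂ (bulletAntipode k) (bulletAntipode k))
      (comul (R := k) x) (comul (R := k) y))

end HopfBrace

namespace SubHopfBrace

variable {k : Type v} {A : Type u} [Field k] [Ring A] [HopfBrace k A]

/-- A sub-Hopf brace `B` of `A` is normal if `a₁ · b · S(a₂)`, `a₁ • b • T(a₂)` and `a ⇀ b` lie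
in `B` for all `a ∈ A` and `b ∈ B`. -/
structure IsNormal (B : SubHopfBrace k A) : Prop where
  conj_mem : ∀ a : A, ∀ b ∈ B, HopfBrace.conj k a b ∈ B
  bulletConj_mem : ∀ a : A, ∀ b ∈ B, HopfBrace.bulletConj k a b ∈ B
  act_mem : ∀ a : A, ∀ b ∈ B, HopfBrace.act k a b ∈ B

/-- The normal sub-Hopf brace generated by a set: the intersection of all normal sub-Hopf braces
containing it. -/
def normalClosure (E : Set A) : SubHopfBrace k A :=
  sInter {B : SubHopfBrace k A | B.IsNormal ∧ E ⊆ B}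

/-- `[X, Y]`: the normal sub-Hopf brace generated by all the elements
`x₁ · y₁ · S(x₂) · S(y₂)`, `S(x₁) · (x₂ • y₁) · S(y₂)` and `x₁ • y₁ • T(x₂) • T(y₂)`
with `x ∈ X` and `y ∈ Y`. -/
def commutator (X Y : SubHopfBrace k A) : SubHopfBrace k A :=
  normalClosure {a : A | ∃ x ∈ X, ∃ y ∈ Y,
    a = HopfBrace.dotCommutator k x y ∨ a = HopfBrace.starCommutator k x y ∨
      a = HopfBrace.bulletCommutator k x y}

/-! ### The Huq commutator -/

/-- `X` and `Y` commute in the sense of Huq: there is a morphism of Hopf braces `p : X ⊗ Y → A`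
on the product `X ⊗ Y` with `p ∘ i₁` and `p ∘ i₂` the inclusions of `X` and of `Y`, where
`i₁ x = x ⊗ 1` and `i₂ y = 1 ⊗ y`. -/
def HuqCommute (X Y : SubHopfBrace k A) : Prop :=
  ∃ p : HopfBraceHom k (X.Carrier ⊗[k] Y.Carrier) A,
    (∀ x : X.Carrier, p (x ⊗ₜ[k] 1) = x) ∧ ∀ y : Y.Carrier, p (1 ⊗ₜ[k] y) = y

/-- `q : A → Q` is a cokernel, in the category of cocommutative Hopf braces, of the inclusion of
the sub-Hopf brace `K`: it restricts to the zero morphism `x ↦ ε(x) 1` on `K` and every morphism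
to a cocommutative Hopf brace with this property factors uniquely through `q`. -/
def IsCokernel (K : SubHopfBrace k A) {Q : Type u} [Ring Q] [HopfBrace k Q]
    (q : HopfBraceHom k A Q) : Prop :=
  (∀ x ∈ K, q x = counit (R := k) x • (1 : Q)) ∧
    ∀ (C : Type u) [Ring C] [HopfBrace k C] [Coalgebra.IsCocomm k C] (h : HopfBraceHom k A C),
      (∀ x ∈ K, h x = counit (R := k) x • (1 : C)) →
        ∃! g : HopfBraceHom k Q C, ∀ a : A, g (q a) = h a

/-- `K` has a cokernel `q : A → Q` in the category of cocommutative Hopf braces such that the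
images `q(X)` and `q(Y)` commute in the sense of Huq. -/
def CommuteModulo (K X Y : SubHopfBrace k A) : Prop :=
  ∃ (Q : Type u) (_ : Ring Q) (_ : HopfBrace k Q) (_ : Coalgebra.IsCocomm k Q)
    (q : HopfBraceHom k A Q), K.IsCokernel q ∧ HuqCommute (X.map q) (Y.map q)

/-- `K` is the Huq commutator of `X` and `Y`: the smallest normal sub-Hopf brace such that the
images of `X` and `Y` under its cokernel commute in the sense of Huq. -/
def IsHuqCommutator (X Y K : SubHopfBrace k A) : Prop :=
  IsLeast {N : SubHopfBrace k A | N.IsNormal ∧ N.CommuteModulo X Y} K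

end SubHopfBrace

/-!
The cokernel of a normal sub-Hopf brace `N` of a cocommutative Hopf brace `A` is `A → A/AN⁺`, with
`N⁺ = N ∩ ker ε`. Indeed `AN⁺` is a two-sided ideal for `·` because `N` is stable under the adjoint
action, and it is equal to `A • N⁺`: from `a • (b · x) = (a₁ • b) · (a₂ ⇀ x)` and
`b · x = b₁ • (T(b₂) ⇀ x)` the stability of `N` under `⇀` gives both inclusions. Hence it is a Hopf
ideal for `•` as well (`SubHopfBrace.exists_quotient`, `SubHopfBrace.isCokernel_of_surjective`).

Two sub-Hopf braces commute in the sense of Huq iff `x · y = y · x`, `x • y = x · y` and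
`x • y = y • x` for all elements `x`, `y` of them; the morphism `p` is then `x ⊗ y ↦ x · y`
(`SubHopfBrace.huqCommute_iff`). In the convolution algebra of linear maps `X ⊗ Y → A` coalgebra
morphisms are invertible, with inverse `S ∘ -`, and the three families of generators of `[X, Y]`
are convolution products: for instance the first one is the group commutator `u v u⁻¹ v⁻¹` of
`u = x ε(y)` and `v = ε(x) y`. Therefore `q(X)` and `q(Y)` commute in the sense of Huq iff
`q` sends every generator to the scalar `ε(x) ε(y)` (`SubHopfBrace.huqCommute_map_iff`). This holds
for the cokernel `q` of `[X, Y]`, since the generators lie in `[X, Y]`.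

Conversely let `N` be normal and suppose that `q(X)` and `q(Y)` commute, where `q` is a cokernel of
`N`. By the universal property `A → A/AN⁺` factors through `q`, so that the generators become
trivial in `A/AN⁺`. By cocommutativity they are values of coalgebra morphisms `φ : X ⊗ Y → A`, so
`c = φ(t)` satisfies `c₁ ⊗ c₂ = c ⊗ 1` in `A ⊗ A/AN⁺`. That such a `c` lies in `N` is the
injectivity half of Newman's correspondence between Hopf subalgebras and quotients of a
cocommutative Hopf algebra (`CocommHopf.mem_of_mem_coinvariants`), which carries the weight of the
argument.

To prove it for a Hopf subalgebra `K`, let the commutative algebra `A*` act on `A` by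
`φ ⇀ a = φ(a₂) a₁`, so that the submodules of `A` are its subcoalgebras and are locally finite. Let
`J ⊆ A*` be the ideal of functionals vanishing on `K`. Fitting's lemma decomposes `A` as the direct
sum of the union `B` of the wedge powers `Kₙ` (elements killed by `Jⁿ`) and of the part `B'` on
which `J` acts as an identity; both are stable under right multiplication by `K`, and the
decomposition forces `c ∈ B`. The quotients `Kₙ₊₁/Kₙ` are Hopf modules over `K`, hence free over
`K`, and this lets one descend from `c ∈ Kₙ₊₁` to `c ∈ Kₙ`, down to `K₁ = K`.
-/

/-! ### Cocommutative Hopf algebras -/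

namespace CocommHopf

open WithConv LinearMap

section Antipode

variable {k : Type*} {H : Type*} [Field k] [Ring H] [HopfAlgebra k H]

/-- Precomposition with a coalgebra morphism preserves convolution products. -/
theorem toConv_mul_comp {C D : Type*} [AddCommGroup C] [Module k C] [Coalgebra k C]
    [AddCommGroup D] [Module k D] [Coalgebra k D] (f g : C →ₗ[k] H) (h : D →ₗc[k] C) :
    toConv ((toConv f * toConv g).ofConv ∘ₗ h.toLinearMap)
      = toConv (f ∘ₗ h.toLinearMap) * toConv (g ∘ₗ h.toLinearMap) := by
  rw [convMul_comp_coalgHom_distrib]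

theorem one_comp {C D : Type*} [AddCommGroup C] [Module k C] [Coalgebra k C]
    [AddCommGroup D] [Module k D] [Coalgebra k D] (h : D →ₗc[k] C) :
    toConv ((1 : WithConv (C →ₗ[k] H)).ofConv ∘ₗ h.toLinearMap) = 1 := by
  ext d
  simp [LinearMap.convOne_def]

/-- A coalgebra morphism `u` into a Hopf algebra has the convolution inverse `S ∘ u`. -/
theorem mul_antipode_comp {C : Type*} [AddCommGroup C] [Module k C] [Coalgebra k C]
    (u : C →ₗc[k] H) :
    toConv u.toLinearMap * toConv (HopfAlgebra.antipode k ∘ₗ u.toLinearMap) = 1 := by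
  rw [← one_comp u, ← id_mul_antipode, toConv_mul_comp]; rfl

theorem antipode_comp_mul {C : Type*} [AddCommGroup C] [Module k C] [Coalgebra k C]
    (u : C →ₗc[k] H) :
    toConv (HopfAlgebra.antipode k ∘ₗ u.toLinearMap) * toConv u.toLinearMap = 1 := by
  rw [← one_comp u, ← antipode_mul_id, toConv_mul_comp]; rfl

variable [IsCocomm k H]

/-- Both sides are the convolution inverse of `Δ`: the left one because `Δ` is an algebra
morphism, the right one because `Δ` is a coalgebra morphism by cocommutativity. -/
theorem comul_antipode (a : H) :
    comul (R := k) (HopfAlgebra.antipode k a)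
      = TensorProduct.map (HopfAlgebra.antipode k) (HopfAlgebra.antipode k) (comul (R := k) a) := by
  have h1 := comul_right_inv (R := k) (C := H)
  have h2 : toConv (TensorProduct.map (HopfAlgebra.antipode k) (HopfAlgebra.antipode k)
      ∘ₗ comul (R := k) (A := H)) * toConv (comul (R := k) (A := H)) = 1 := by
    have h3 := TensorProduct.map_convMul_map (R := k) (f := toConv (HopfAlgebra.antipode k (A := H)))
      (g := toConv (HopfAlgebra.antipode k (A := H))) (h := toConv (id (R := k) (M := H)))
      (k := toConv (id (R := k) (M := H)))
    rw [antipode_mul_id] at h3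
    have h4 := toConv_mul_comp (k := k) (H := H ⊗[k] H)
      (TensorProduct.map (HopfAlgebra.antipode k) (HopfAlgebra.antipode k))
      (TensorProduct.map (id (R := k) (M := H)) (id (R := k) (M := H))) (comulCoalgHom k H)
    have h5 := one_comp (k := k) (H := H ⊗[k] H) (comulCoalgHom k H)
    simp only at h3
    rw [h3] at h4
    have h6 : toConv (TensorProduct.map (1 : WithConv (H →ₗ[k] H)).ofConv
        (1 : WithConv (H →ₗ[k] H)).ofConv) = (1 : WithConv (H ⊗[k] H →ₗ[k] H ⊗[k] H)) := by
      apply WithConv.ext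
      ext x y
      simp [LinearMap.convOne_def, Algebra.algebraMap_eq_smul_one, TensorProduct.smul_tmul',
        Algebra.TensorProduct.one_def, smul_smul, mul_comm]
    rw [h6, h5, TensorProduct.map_id] at h4
    exact h4.symm
  have := left_inv_eq_right_inv h2 h1
  exact (LinearMap.congr_fun (congrArg WithConv.ofConv this) a).symm

variable (k H) in
/-- The antipode of a cocommutative Hopf algebra is a morphism of coalgebras. -/
noncomputable def antipodeCoalgHom : H →ₗc[k] H where
  __ := HopfAlgebra.antipode k
  counit_comp := by ext; simp
  map_comp_comul := by ext a; exact (comul_antipode a).symm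

/-- `S ∘ S` and the identity are both convolution inverses of the coalgebra morphism `S`. -/
theorem antipode_antipode (a : H) :
    HopfAlgebra.antipode k (HopfAlgebra.antipode k a) = a := by
  have h := left_inv_eq_right_inv (antipode_comp_mul (antipodeCoalgHom k H))
    (antipode_mul_id (R := k) (C := H))
  exact LinearMap.congr_fun (congrArg WithConv.ofConv h) a

end Antipode

section Augmentation

variable (k : Type*) {H : Type*} [Field k] [Ring H] [HopfAlgebra k H]

/-- The left ideal `H · K⁺` generated by the augmentation ideal `K⁺ = K ∩ ker ε` of a subset
`K`. -/
def augIdeal (K : Set H) : Ideal H := Ideal.span {x | x ∈ K ∧ counit (R := k) x = 0}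

variable {k}

theorem sub_counit_mem_augIdeal {K : Submodule k H} (h1 : (1 : H) ∈ K) {x : H} (hx : x ∈ K) :
    x - counit (R := k) x • (1 : H) ∈ augIdeal k (K : Set H) :=
  Ideal.subset_span ⟨K.sub_mem hx (K.smul_mem _ h1), by simp⟩

/-- The adjoint action `a₁ · b · S(a₂)`. -/
noncomputable def adjAction (a b : H) : H :=
  LinearMap.mul' k H
    (TensorProduct.map ((LinearMap.mul k H).flip b) (HopfAlgebra.antipode k) (comul (R := k) a))

theorem counit_adjAction (a b : H) :
    counit (R := k) (adjAction (k := k) a b) = counit (R := k) a * counit (R := k) b := by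
  have e : ∀ t : H ⊗[k] H, counit (R := k) (LinearMap.mul' k H (TensorProduct.map
      ((LinearMap.mul k H).flip b) (HopfAlgebra.antipode k) t))
      = counit (R := k) (TensorProduct.rid k H ((counit (R := k)).lTensor H t))
        * counit (R := k) b := by
    intro t
    induction t with
    | zero => simp
    | add x y hx hy => simp only [map_add, hx, hy, add_mul]
    | tmul x y => simp; ring
  rw [adjAction, e]; simp

theorem toConv_mul_flip_comp {C : Type*} [AddCommGroup C] [Module k C] [Coalgebra k C]
    (f g : C →ₗ[k] H) (x : H) :
    toConv f * toConv ((LinearMap.mul k H).flip x ∘ₗ g)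
      = toConv ((LinearMap.mul k H).flip x ∘ₗ (toConv f * toConv g).ofConv) := by
  ext c
  simp only [LinearMap.convMul_apply, LinearMap.comp_apply]
  generalize comul (R := k) c = t
  induction t with
  | zero => simp
  | add x y hx hy => simp only [map_add, hx, hy]
  | tmul a b => simp [mul_assoc]

theorem mul'_map_mem (I : Ideal H) (f g : H →ₗ[k] H) (hg : ∀ y, g y ∈ I) (t : H ⊗[k] H) :
    LinearMap.mul' k H (TensorProduct.map f g t) ∈ I := by
  induction t with
  | zero => simp
  | add x y hx hy => simpa only [map_add] using I.add_mem hx hy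
  | tmul a b => simpa using I.mul_mem_left _ (hg b)

variable [IsCocomm k H]

/-- `x · a = a₁ · (S(a₂) · x · a₃)`, where the bracket is the adjoint action of `S(a₂)` on `x`
since `S` is a coalgebra morphism with `S ∘ S = id`. -/
theorem mul_eq_mul'_adjAction (x a : H) :
    x * a = LinearMap.mul' k H (TensorProduct.map LinearMap.id
      ((toConv ((LinearMap.mul k H).flip x) * toConv (HopfAlgebra.antipode k)).ofConv
        ∘ₗ HopfAlgebra.antipode k) (comul (R := k) a)) := by
  have h1 := toConv_mul_comp (k := k) ((LinearMap.mul k H).flip x) (HopfAlgebra.antipode k)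
    (antipodeCoalgHom k H)
  have h2 : HopfAlgebra.antipode k ∘ₗ (antipodeCoalgHom k H).toLinearMap = LinearMap.id := by
    ext a; exact antipode_antipode a
  rw [h2] at h1
  have h3 : toConv (LinearMap.mul k H x)
      = toConv LinearMap.id * (toConv ((LinearMap.mul k H).flip x
        ∘ₗ (antipodeCoalgHom k H).toLinearMap) * toConv LinearMap.id) := by
    rw [← mul_assoc, toConv_mul_flip_comp]
    have h4 := id_mul_antipode (R := k) (C := H)
    change toConv LinearMap.id * toConv (antipodeCoalgHom k H).toLinearMap = 1 at h4
    rw [h4]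
    ext c
    have e : ∀ t : H ⊗[k] H, LinearMap.mul' k H (TensorProduct.map ((LinearMap.mul k H).flip x ∘ₗ
        (1 : WithConv (H →ₗ[k] H)).ofConv) LinearMap.id t)
        = x * TensorProduct.lid k H ((counit (R := k)).rTensor H t) := by
      intro t
      induction t with
      | zero => simp
      | add x y hx hy => simp only [map_add, mul_add, hx, hy]
      | tmul a b => simp [LinearMap.convOne_def, Algebra.algebraMap_eq_smul_one]
    simp only [LinearMap.convMul_apply, e]
    simp
  rw [← h1] at h3
  exact LinearMap.congr_fun (congrArg WithConv.ofConv h3) a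

/-- For a subset `K` stable under the adjoint action, `H · K⁺` is a two-sided ideal. -/
theorem augIdeal_isTwoSided {K : Set H} (hK : ∀ a, ∀ x ∈ K, adjAction (k := k) a x ∈ K) :
    (augIdeal k K).IsTwoSided := by
  constructor
  intro b a hb
  induction hb using Submodule.span_induction with
  | zero => simp
  | add x y _ _ hx hy => simpa only [add_mul] using Ideal.add_mem _ hx hy
  | smul c x _ hx => simpa only [smul_eq_mul, mul_assoc] using Ideal.mul_mem_left _ c hx
  | mem x hx =>
    rw [mul_eq_mul'_adjAction (k := k)]
    apply mul'_map_mem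
    intro y
    exact Ideal.subset_span (s := {x | x ∈ K ∧ counit (R := k) x = 0})
      ⟨hK (HopfAlgebra.antipode k y) x hx.1,
        (counit_adjAction (HopfAlgebra.antipode k y) x).trans (by rw [hx.2, mul_zero])⟩

end Augmentation

/-! ### Commutators of coalgebra morphisms -/

section Commutator

variable {k : Type*} {C D H : Type*} [Field k]
  [AddCommGroup C] [Module k C] [Coalgebra k C] [AddCommGroup D] [Module k D] [Coalgebra k D]

variable (k C D) in
/-- The projection `x ⊗ y ↦ ε(y) x`. -/
noncomputable def prLeft : C ⊗[k] D →ₗc[k] C :=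
  (Coalgebra.TensorProduct.rid k k C).toCoalgHom.comp (CoalgHom.lTensor C (counitCoalgHom k D))

variable (k C D) in
/-- The projection `x ⊗ y ↦ ε(x) y`. -/
noncomputable def prRight : C ⊗[k] D →ₗc[k] D :=
  (Coalgebra.TensorProduct.lid k D).toCoalgHom.comp (CoalgHom.rTensor D (counitCoalgHom k C))

theorem prLeft_tmul (x : C) (y : D) : prLeft k C D (x ⊗ₜ y) = counit (R := k) y • x := rfl

theorem prRight_tmul (x : C) (y : D) : prRight k C D (x ⊗ₜ y) = counit (R := k) x • y := rfl

variable [Ring H] [HopfAlgebra k H]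

theorem conv_tmul (F G : C ⊗[k] D →ₗ[k] H) (x : C) (y : D) :
    (toConv F * toConv G) (x ⊗ₜ[k] y)
      = LinearMap.mul' k H (TensorProduct.map F G
        (TensorProduct.tensorTensorTensorComm k C C D D (comul (R := k) x ⊗ₜ comul (R := k) y))) :=
  rfl

theorem conv_prLeft_comp (f : C →ₗ[k] H) (G : C ⊗[k] D →ₗ[k] H) (x : C) (y : D) :
    (toConv (f ∘ₗ (prLeft k C D).toLinearMap) * toConv G) (x ⊗ₜ[k] y)
      = LinearMap.mul' k H (TensorProduct.map f (G ∘ₗ (TensorProduct.mk k C D).flip y)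
          (comul (R := k) x)) := by
  rw [conv_tmul]
  generalize comul (R := k) x = s
  have e : ∀ t : D ⊗[k] D, LinearMap.mul' k H (TensorProduct.map
      (f ∘ₗ (prLeft k C D).toLinearMap) G
      (TensorProduct.tensorTensorTensorComm k C C D D (s ⊗ₜ t)))
      = LinearMap.mul' k H (TensorProduct.map f (G ∘ₗ (TensorProduct.mk k C D).flip
        (TensorProduct.lid k D ((counit (R := k)).rTensor D t))) s) := by
    intro t
    induction s with
    | zero => simp
    | add a b ha hb => simp only [map_add, TensorProduct.add_tmul, ha, hb]
    | tmul a b =>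
      induction t with
      | zero => simp
      | add c d hc hd =>
        rw [TensorProduct.tmul_add, map_add, map_add, map_add, hc, hd]
        simp [TensorProduct.tmul_add]
      | tmul c d => simp [prLeft_tmul]
  rw [e]
  simp

theorem conv_prLeft_prRight (f : C →ₗ[k] H) (g : D →ₗ[k] H) (x : C) (y : D) :
    (toConv (f ∘ₗ (prLeft k C D).toLinearMap) * toConv (g ∘ₗ (prRight k C D).toLinearMap))
      (x ⊗ₜ[k] y) = f x * g y := by
  rw [conv_prLeft_comp]
  have e : ∀ t : C ⊗[k] C, LinearMap.mul' k H (TensorProduct.map f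
      ((g ∘ₗ (prRight k C D).toLinearMap) ∘ₗ (TensorProduct.mk k C D).flip y) t)
      = f (TensorProduct.rid k C ((counit (R := k)).lTensor C t)) * g y := by
    intro t
    induction t with
    | zero => simp
    | add x y hx hy => simp only [map_add, add_mul, hx, hy]
    | tmul a b => simp [prRight_tmul]
  rw [e]; simp

theorem conv_prRight_prLeft (f : C →ₗ[k] H) (g : D →ₗ[k] H) (x : C) (y : D) :
    (toConv (g ∘ₗ (prRight k C D).toLinearMap) * toConv (f ∘ₗ (prLeft k C D).toLinearMap))
      (x ⊗ₜ[k] y) = g y * f x := by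
  rw [conv_tmul]
  have e : ∀ (s : C ⊗[k] C) (t : D ⊗[k] D), LinearMap.mul' k H (TensorProduct.map
      (g ∘ₗ (prRight k C D).toLinearMap) (f ∘ₗ (prLeft k C D).toLinearMap)
      (TensorProduct.tensorTensorTensorComm k C C D D (s ⊗ₜ t)))
      = g (TensorProduct.rid k D ((counit (R := k)).lTensor D t)) *
        f (TensorProduct.lid k C ((counit (R := k)).rTensor C s)) := by
    intro s t
    induction s with
    | zero => simp
    | add a b ha hb => simp only [map_add, TensorProduct.add_tmul, ha, hb, mul_add]
    | tmul a b =>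
      induction t with
      | zero => simp
      | add c d hc hd => simp only [map_add, TensorProduct.tmul_add, hc, hd, add_mul]
      | tmul c d => simp [prLeft_tmul, prRight_tmul, mul_comm, smul_smul]
  rw [e]; simp

/-- `x₁ · y₁ · S(x₂) · S(y₂)` -/
noncomputable def hopfCommutator (x y : H) : H :=
  LinearMap.mul' k H
    (TensorProduct.map₂ (LinearMap.mul k H)
      ((LinearMap.mul k H).compl₁₂ (HopfAlgebra.antipode k) (HopfAlgebra.antipode k))
      (comul (R := k) x) (comul (R := k) y))

/-- The commutator `x ⊗ y ↦ [f(x), g(y)]` is the convolution commutator `u v u⁻¹ v⁻¹` of the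
extensions `u`, `v` of `f`, `g` to the tensor product. -/
theorem conv_commutator (f : C →ₗc[k] H) (g : D →ₗc[k] H) (x : C) (y : D) :
    ((toConv (f.toLinearMap ∘ₗ (prLeft k C D).toLinearMap)
        * toConv (g.toLinearMap ∘ₗ (prRight k C D).toLinearMap))
      * (toConv ((HopfAlgebra.antipode k ∘ₗ f.toLinearMap) ∘ₗ (prLeft k C D).toLinearMap)
        * toConv ((HopfAlgebra.antipode k ∘ₗ g.toLinearMap) ∘ₗ (prRight k C D).toLinearMap)))
      (x ⊗ₜ[k] y) = hopfCommutator (k := k) (f x) (g y) := by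
  rw [hopfCommutator]
  have h1 : comul (R := k) (f x) = TensorProduct.map f.toLinearMap f.toLinearMap (comul x) :=
    (LinearMap.congr_fun f.map_comp_comul x).symm
  have h2 : comul (R := k) (g y) = TensorProduct.map g.toLinearMap g.toLinearMap (comul y) :=
    (LinearMap.congr_fun g.map_comp_comul y).symm
  rw [h1, h2]
  change LinearMap.mul' k H (TensorProduct.map _ _
    (TensorProduct.tensorTensorTensorComm k C C D D (comul (R := k) x ⊗ₜ comul (R := k) y))) = _
  generalize comul (R := k) x = s
  generalize comul (R := k) y = t
  induction s with
  | zero => simp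
  | add a b ha hb =>
    simp only [map_add, TensorProduct.add_tmul, ha, hb, LinearMap.add_apply]
  | tmul a b =>
    induction t with
    | zero => simp
    | add c d hc hd =>
      simp only [map_add, TensorProduct.tmul_add, hc, hd]
    | tmul c d =>
      simp only [TensorProduct.tensorTensorTensorComm_tmul, TensorProduct.map_tmul,
        LinearMap.mul'_apply, TensorProduct.map₂_apply_tmul]
      exact congrArg₂ (· * ·) (conv_prLeft_prRight f.toLinearMap g.toLinearMap a c)
        (conv_prLeft_prRight (HopfAlgebra.antipode k ∘ₗ f.toLinearMap)
          (HopfAlgebra.antipode k ∘ₗ g.toLinearMap) b d)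

/-- The commutators of two coalgebra morphisms are trivial iff their images commute
elementwise. -/
theorem hopfCommutator_eq_counit_iff (f : C →ₗc[k] H) (g : D →ₗc[k] H) :
    (∀ x y, hopfCommutator (k := k) (f x) (g y)
        = (counit (R := k) x * counit (R := k) y) • (1 : H)) ↔
      ∀ x y, f x * g y = g y * f x := by
  set u := toConv (f.toLinearMap ∘ₗ (prLeft k C D).toLinearMap) with hu
  set v := toConv (g.toLinearMap ∘ₗ (prRight k C D).toLinearMap) with hv
  set u' := toConv ((HopfAlgebra.antipode k ∘ₗ f.toLinearMap) ∘ₗ (prLeft k C D).toLinearMap)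
    with hu'
  set v' := toConv ((HopfAlgebra.antipode k ∘ₗ g.toLinearMap) ∘ₗ (prRight k C D).toLinearMap)
    with hv'
  have huu : u * u' = 1 := mul_antipode_comp (f.comp (prLeft k C D))
  have hvv : v * v' = 1 := mul_antipode_comp (g.comp (prRight k C D))
  have huu' : u' * u = 1 := antipode_comp_mul (f.comp (prLeft k C D))
  have hvv' : v' * v = 1 := antipode_comp_mul (g.comp (prRight k C D))
  have h1 : (∀ x y, hopfCommutator (k := k) (f x) (g y)
      = (counit (R := k) x * counit (R := k) y) • (1 : H)) ↔ (u * v) * (u' * v') = 1 := by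
    constructor
    · intro h
      apply WithConv.ext
      ext x y
      refine (conv_commutator f g x y).trans ((h x y).trans ?_)
      simp [LinearMap.convOne_def, Algebra.algebraMap_eq_smul_one, mul_comm]
    · intro h x y
      rw [← conv_commutator]
      refine (congrArg (fun w : WithConv (C ⊗[k] D →ₗ[k] H) => w (x ⊗ₜ[k] y)) h).trans ?_
      simp [LinearMap.convOne_def, Algebra.algebraMap_eq_smul_one, mul_comm]
  have h2 : (∀ x y, f x * g y = g y * f x) ↔ u * v = v * u := by
    constructor
    · intro h
      apply WithConv.ext
      ext x y
      exact (conv_prLeft_prRight f.toLinearMap g.toLinearMap x y).trans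
        ((h x y).trans (conv_prRight_prLeft f.toLinearMap g.toLinearMap x y).symm)
    · intro h x y
      refine (conv_prLeft_prRight f.toLinearMap g.toLinearMap x y).symm.trans
        (Eq.trans ?_ (conv_prRight_prLeft f.toLinearMap g.toLinearMap x y))
      exact congrArg (fun w : WithConv (C ⊗[k] D →ₗ[k] H) => w (x ⊗ₜ[k] y)) h
  rw [h1, h2]
  constructor
  · intro h
    calc u * v = u * v * (u' * (v' * v) * u) := by rw [hvv', mul_one, huu', mul_one]
      _ = (u * v) * (u' * v') * (v * u) := by simp only [mul_assoc]
      _ = v * u := by rw [h, one_mul]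
  · intro h
    calc (u * v) * (u' * v') = v * (u * u') * v' := by rw [h]; simp only [mul_assoc]
      _ = 1 := by rw [huu, mul_one, hvv]

/-- The convolution product of two coalgebra morphisms out of a cocommutative coalgebra. -/
noncomputable def convHom [IsCocomm k C] (u v : C →ₗc[k] H) : C →ₗc[k] H :=
  ((Bialgebra.mulCoalgHom k H).comp (Coalgebra.TensorProduct.map u v)).comp (comulCoalgHom k C)

theorem toConv_convHom [IsCocomm k C] (u v : C →ₗc[k] H) :
    toConv (convHom u v).toLinearMap = toConv u.toLinearMap * toConv v.toLinearMap := rfl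

variable [IsCocomm k C] [IsCocomm k D] [IsCocomm k H]

/-- The commutator `x ⊗ y ↦ [f(x), g(y)]` of two coalgebra morphisms is a coalgebra morphism. -/
noncomputable def hopfCommutatorHom (f : C →ₗc[k] H) (g : D →ₗc[k] H) : C ⊗[k] D →ₗc[k] H :=
  convHom (convHom (f.comp (prLeft k C D)) (g.comp (prRight k C D)))
    (convHom (((antipodeCoalgHom k H).comp f).comp (prLeft k C D))
      (((antipodeCoalgHom k H).comp g).comp (prRight k C D)))

theorem hopfCommutatorHom_tmul (f : C →ₗc[k] H) (g : D →ₗc[k] H) (x : C) (y : D) :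
    hopfCommutatorHom f g (x ⊗ₜ[k] y) = hopfCommutator (k := k) (f x) (g y) :=
  conv_commutator f g x y

end Commutator

end CocommHopf

/-! ### The dual algebra acting on a cocommutative coalgebra -/

namespace CocommHopf

open WithConv LinearMap

section TensorSubspaces

variable {k : Type*} {A : Type*} [Field k] [AddCommGroup A] [Module k A]

/-- Every subspace is the image of a projection. -/
theorem exists_projection (U : Submodule k A) :
    ∃ p : A →ₗ[k] A, (∀ a, p a ∈ U) ∧ ∀ a ∈ U, p a = a := by
  obtain ⟨r, hr⟩ := U.subtype.exists_leftInverse_of_injective U.ker_subtype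
  refine ⟨U.subtype ∘ₗ r, fun a => (r a).2, fun a ha => ?_⟩
  exact congrArg Subtype.val (LinearMap.congr_fun hr ⟨a, ha⟩)

/-- A tensor all of whose slices on the right factor lie in `U` lies in `U ⊗ A`. -/
theorem mem_range_map_id_of_slices (U : Submodule k A) (t : A ⊗[k] A)
    (h : ∀ φ : A →ₗ[k] k, TensorProduct.rid k A (φ.lTensor A t) ∈ U) :
    t ∈ range (TensorProduct.map U.subtype (LinearMap.id (R := k) (M := A))) := by
  obtain ⟨p, hp, hpU⟩ := exists_projection U
  have e : p.rTensor A t = t := by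
    apply SubHopfBrace.eq_of_lTensor_functional
    intro φ
    have : ∀ z : A ⊗[k] A, TensorProduct.rid k A (φ.lTensor A (p.rTensor A z))
        = p (TensorProduct.rid k A (φ.lTensor A z)) := by
      intro z
      induction z with
      | zero => simp
      | add x y hx hy => simp only [map_add, hx, hy]
      | tmul x y => simp
    rw [this, hpU _ (h φ)]
  refine ⟨(p.codRestrict U hp).rTensor A t, ?_⟩
  rw [LinearMap.rTensor, TensorProduct.map_map]
  exact e

/-- Induction principle for tensors in the image of `U ⊗ V`. -/
theorem range_map_induction {B : Type*} [AddCommGroup B] [Module k B] {U : Submodule k A}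
    {V : Submodule k B} {P : A ⊗[k] B → Prop} (h0 : P 0)
    (hadd : ∀ s t, P s → P t → P (s + t)) (htmul : ∀ a ∈ U, ∀ b ∈ V, P (a ⊗ₜ b)) {t : A ⊗[k] B}
    (ht : t ∈ range (TensorProduct.map U.subtype V.subtype)) : P t := by
  obtain ⟨s, rfl⟩ := ht
  induction s with
  | zero => simpa using h0
  | add x y hx hy => simpa only [map_add] using hadd _ _ hx hy
  | tmul x y => exact htmul x x.2 y y.2

end TensorSubspaces

section DualAction

variable {k : Type*} {A : Type*} [Field k] [AddCommGroup A] [Module k A] [Coalgebra k A]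

/-- The action `φ ⇀ a = φ(a₂) a₁` of a functional `φ` on a coalgebra. -/
noncomputable def hit : (A →ₗ[k] k) →ₗ[k] A →ₗ[k] A where
  toFun φ := (TensorProduct.rid k A).toLinearMap ∘ₗ φ.lTensor A ∘ₗ comul (R := k)
  map_add' φ ψ := by ext; simp
  map_smul' c φ := by ext; simp

theorem hit_apply (φ : A →ₗ[k] k) (a : A) :
    hit φ a = TensorProduct.rid k A (φ.lTensor A (comul (R := k) a)) := rfl

theorem hit_mul (f g : WithConv (A →ₗ[k] k)) (a : A) :
    hit (f * g).ofConv a = hit f.ofConv (hit g.ofConv a) := by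
  let G : A ⊗[k] (A ⊗[k] A) →ₗ[k] A := (TensorProduct.rid k A).toLinearMap ∘ₗ
    (LinearMap.mul' k k ∘ₗ TensorProduct.map f.ofConv g.ofConv).lTensor A
  have e1 : ∀ t : A ⊗[k] A, hit f.ofConv (TensorProduct.rid k A (g.ofConv.lTensor A t))
      = G (TensorProduct.assoc k A A A ((comul (R := k)).rTensor A t)) := by
    intro t
    induction t with
    | zero => simp
    | add x y hx hy => simp only [map_add, hx, hy]
    | tmul x y =>
      simp only [LinearMap.lTensor_tmul, TensorProduct.rid_tmul, map_smul, hit_apply,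
        LinearMap.rTensor_tmul]
      generalize comul (R := k) x = s
      induction s with
      | zero => simp
      | add x y hx hy => simp only [map_add, smul_add, TensorProduct.add_tmul, hx, hy]
      | tmul a b => simp [G, smul_smul, mul_comm]
  have e2 : ∀ t : A ⊗[k] A, TensorProduct.rid k A ((f * g).ofConv.lTensor A t)
      = G ((comul (R := k)).lTensor A t) := by
    intro t
    induction t with
    | zero => simp
    | add x y hx hy => simp only [map_add, hx, hy]
    | tmul x y => simp [G]
  rw [hit_apply, e2, hit_apply g.ofConv, e1, Coalgebra.coassoc_apply]

theorem apply_hit (φ ψ : WithConv (A →ₗ[k] k)) (a : A) : φ (hit ψ.ofConv a) = (φ * ψ) a := by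
  rw [LinearMap.convMul_apply, hit_apply]
  generalize comul (R := k) a = t
  induction t with
  | zero => simp
  | add x y hx hy => simp only [map_add, hx, hy]
  | tmul x y => simp [mul_comm]

theorem hit_counit (a : A) : hit (counit (R := k)) a = a := by
  rw [hit_apply]; simp

variable (k A) in
/-- The dual of a cocommutative coalgebra, a commutative algebra under convolution. -/
def DualAlg : Type _ := WithConv (A →ₗ[k] k)

/-- A functional, as an element of the dual algebra. -/
def DualAlg.of (φ : A →ₗ[k] k) : DualAlg k A := toConv φ

/-- An element of the dual algebra, as a functional. -/
def DualAlg.toLin (f : DualAlg k A) : A →ₗ[k] k := WithConv.ofConv f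

variable [IsCocomm k A]

noncomputable instance : CommRing (DualAlg k A) :=
  inferInstanceAs (CommRing (WithConv (A →ₗ[k] k)))

noncomputable instance : Module k (DualAlg k A) :=
  inferInstanceAs (Module k (WithConv (A →ₗ[k] k)))

theorem DualAlg.toLin_add (f g : DualAlg k A) : (f + g).toLin = f.toLin + g.toLin := rfl

theorem DualAlg.toLin_zero : (0 : DualAlg k A).toLin = 0 := rfl

theorem DualAlg.toLin_one : (1 : DualAlg k A).toLin = counit (R := k) := by
  ext a
  exact (LinearMap.convOne_apply (R := k) (A := k) a).trans (by simp)

theorem DualAlg.toLin_smul (c : k) (f : DualAlg k A) : (c • f).toLin = c • f.toLin := rfl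

theorem DualAlg.mul_apply (f g : DualAlg k A) (a : A) :
    (f * g).toLin a
      = LinearMap.mul' k k (TensorProduct.map f.toLin g.toLin (comul (R := k) a)) := rfl

/-- A cocommutative coalgebra is a module over its dual algebra by `φ ⇀ a = φ(a₂) a₁`. -/
noncomputable instance instModuleCarrier : Module (DualAlg k A) A where
  smul f a := hit f.toLin a
  one_smul a := by
    change hit (1 : DualAlg k A).toLin a = a
    rw [DualAlg.toLin_one, hit_counit]
  mul_smul f g a := hit_mul f g a
  smul_zero f := map_zero _
  smul_add f a b := map_add _ a b
  add_smul f g a := by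
    change hit (f + g).toLin a = hit f.toLin a + hit g.toLin a
    rw [DualAlg.toLin_add, map_add]; rfl
  zero_smul a := by
    change hit (0 : DualAlg k A).toLin a = 0
    rw [DualAlg.toLin_zero, map_zero]; rfl

theorem smul_eq_hit (f : DualAlg k A) (a : A) : f • a = hit f.toLin a := rfl

instance : IsScalarTower k (DualAlg k A) A where
  smul_assoc c f a := by
    rw [smul_eq_hit, smul_eq_hit, DualAlg.toLin_smul, map_smul]; rfl

theorem apply_smul (φ ψ : DualAlg k A) (a : A) : φ.toLin (ψ • a) = (φ * ψ).toLin a :=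
  apply_hit φ ψ a

theorem counit_smul (φ : DualAlg k A) (a : A) : counit (R := k) (φ • a) = φ.toLin a := by
  have h := apply_smul (1 : DualAlg k A) φ a
  rwa [one_mul, DualAlg.toLin_one] at h

/-- Every element of a coalgebra generates a finite-dimensional subcoalgebra. -/
theorem span_finiteDimensional (a : A) :
    Module.Finite k (Submodule.span (DualAlg k A) {a}) := by
  obtain ⟨S, hS⟩ := TensorProduct.exists_finset (comul (R := k) a)
  have hle : (Submodule.span (DualAlg k A) {a}).restrictScalars k
      ≤ Submodule.span k (Prod.fst '' (S : Set (A × A))) := by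
    intro x hx
    obtain ⟨f, rfl⟩ := Submodule.mem_span_singleton.mp
      ((Submodule.restrictScalars_mem k _ x).mp hx)
    rw [smul_eq_hit, hit_apply, hS, map_sum, map_sum]
    refine Submodule.sum_mem _ fun i hi => ?_
    rw [LinearMap.lTensor_tmul, TensorProduct.rid_tmul]
    exact Submodule.smul_mem _ _ (Submodule.subset_span (Set.mem_image_of_mem Prod.fst hi))
  have hfin : Module.Finite k (Submodule.span k (Prod.fst '' (S : Set (A × A)))) :=
    Module.Finite.span_of_finite k (S.finite_toSet.image _)
  exact Submodule.finiteDimensional_of_le hle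

/-- Submodules over the dual algebra are subcoalgebras. -/
theorem comul_mem_of_mem (U : Submodule (DualAlg k A) A) {a : A} (ha : a ∈ U) :
    comul (R := k) a ∈ range (TensorProduct.map (U.restrictScalars k).subtype
      (U.restrictScalars k).subtype) := by
  apply SubHopfBrace.mem_range_map_of_slices _ Subtype.val_injective
  · intro φ
    rw [Submodule.range_subtype]
    exact U.smul_mem (DualAlg.of φ) ha
  · intro φ
    rw [Submodule.range_subtype]
    have h : TensorProduct.lid k A (φ.rTensor A (comul (R := k) a)) = DualAlg.of φ • a := by
      rw [smul_eq_hit, hit_apply]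
      change _ = TensorProduct.rid k A (φ.lTensor A (comul (R := k) a))
      conv_rhs => rw [← Coalgebra.comm_comul k a]
      generalize comul (R := k) a = t
      induction t with
      | zero => simp
      | add x y hx hy => simp only [map_add, hx, hy]
      | tmul x y => simp
    rw [h]
    exact U.smul_mem (DualAlg.of φ) ha

end DualAction

/-! ### Fitting decomposition -/

/-- If `a` generates a module of finite length, then `a` is, up to an element killed by a power of
`J`, a multiple `j • a` on which some element of `J` acts as the identity. -/
theorem exists_fitting {R M : Type*} [CommRing R] [AddCommGroup M] [Module R M] (J : Ideal R)
    (a : M) [IsArtinian R (Submodule.span R {a})] [IsNoetherian R (Submodule.span R {a})] :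
    ∃ j ∈ J, j • (j • a) = j • a ∧ ∃ n, ∀ r ∈ J ^ n, r • (a - j • a) = 0 := by
  set D := Submodule.span R {a}
  obtain ⟨n, hn⟩ := IsArtinian.monotone_stabilizes (R := R) (M := D)
    ⟨fun n => OrderDual.toDual (J ^ n • (⊤ : Submodule R D)), fun m n h =>
      OrderDual.toDual_le_toDual.mpr (Submodule.smul_mono_left (Ideal.pow_le_pow_right h))⟩
  have hn1 : J ^ n • (⊤ : Submodule R D) = J ^ (n + 1) • ⊤ := hn (n + 1) (Nat.le_succ n)
  have hle : J ^ n • (⊤ : Submodule R D) ≤ J • (J ^ n • ⊤) := by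
    rw [← mul_smul, ← pow_succ', ← hn1]
  obtain ⟨j, hj, hjN⟩ := Submodule.exists_mem_and_smul_eq_self_of_fg_of_le_smul J
    (J ^ n • (⊤ : Submodule R D)) (IsNoetherian.noetherian _) hle
  have hjN' : ∀ m, ∀ x ∈ J ^ n • (⊤ : Submodule R D), j ^ m • x = x := by
    intro m x hx
    induction m with
    | zero => simp
    | succ m ih => rw [pow_succ, mul_smul, hjN x hx, ih]
  let a' : D := ⟨a, Submodule.mem_span_singleton_self a⟩
  have ha' : ∀ r ∈ J ^ n, r • a' ∈ J ^ n • (⊤ : Submodule R D) := fun r hr =>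
    Submodule.smul_mem_smul hr trivial
  refine ⟨j ^ (n + 1), Ideal.pow_mem_of_mem J hj _ (Nat.succ_pos n), ?_, n, fun r hr => ?_⟩
  · have h := hjN' (n + 1) (j ^ (n + 1) • a') (by
      rw [hn1]; exact Submodule.smul_mem_smul (Ideal.pow_mem_pow hj _) trivial)
    exact congrArg Subtype.val h
  · have h := hjN' (n + 1) (r • a') (ha' r hr)
    have h2 : r • (a' - j ^ (n + 1) • a') = 0 := by
      rw [smul_sub, smul_comm, h, sub_self]
    exact congrArg Subtype.val h2

end CocommHopf

/-! ### Hopf subalgebras of cocommutative Hopf algebras -/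

namespace CocommHopf

open WithConv LinearMap

/-- `K` is a Hopf subalgebra: a subspace containing `1` and closed under `·`, `Δ` and `S`. -/
structure IsHopfSub {k : Type*} {A : Type*} [Field k] [Ring A] [HopfAlgebra k A]
    (K : Submodule k A) : Prop where
  one_mem : (1 : A) ∈ K
  mul_mem : ∀ {a b : A}, a ∈ K → b ∈ K → a * b ∈ K
  comul_mem : ∀ {a : A}, a ∈ K →
    comul (R := k) a ∈ range (TensorProduct.map K.subtype K.subtype)
  antipode_mem : ∀ {a : A}, a ∈ K → HopfAlgebra.antipode k a ∈ K

section Newman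

variable {k : Type*} {A : Type*} [Field k] [Ring A] [HopfAlgebra k A]

/-- For `t = ∑ y ⊗ z`, the slice of `Δ(a) · t` by `φ` is `∑ φ(a₂ z) a₁ y`, and `φ(a₂ z) a₁` is the
action of the functional `φ(- z)` on `a`. -/
theorem slice_mul_mem {F F' P : Submodule k A} (φ : A →ₗ[k] k) (a : A) {t : A ⊗[k] A}
    (ht : t ∈ range (TensorProduct.map F.subtype F'.subtype))
    (h : ∀ y ∈ F, ∀ z ∈ F', hit (φ ∘ₗ (LinearMap.mul k A).flip z) a * y ∈ P) :
    TensorProduct.rid k A (φ.lTensor A (comul (R := k) a * t)) ∈ P := by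
  refine range_map_induction (P := fun t => TensorProduct.rid k A
    (φ.lTensor A (comul (R := k) a * t)) ∈ P) (by simp) (fun s t hs ht => ?_)
    (fun y hy z hz => ?_) ht
  · simpa only [mul_add, map_add] using P.add_mem hs ht
  · convert h y hy z hz using 1
    rw [hit_apply]
    generalize comul (R := k) a = s
    induction s with
    | zero => simp
    | add p q hp hq => simp only [map_add, add_mul, hp, hq]
    | tmul p q => simp

/-- `Δ(y₁) · (1 ⊗ S(y₂)) = y ⊗ 1`. -/
theorem mul'_comul_antipode (y : A) :
    LinearMap.mul' k (A ⊗[k] A) (TensorProduct.map (comul (R := k))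
      ((TensorProduct.mk k A A 1) ∘ₗ HopfAlgebra.antipode k) (comul (R := k) y)) = y ⊗ₜ 1 := by
  let G : A ⊗[k] (A ⊗[k] A) →ₗ[k] A ⊗[k] A :=
    (LinearMap.mul' k A ∘ₗ (HopfAlgebra.antipode k).lTensor A).lTensor A
  have e : ∀ t : A ⊗[k] A, LinearMap.mul' k (A ⊗[k] A) (TensorProduct.map (comul (R := k))
      ((TensorProduct.mk k A A 1) ∘ₗ HopfAlgebra.antipode k) t)
      = G (TensorProduct.assoc k A A A ((comul (R := k)).rTensor A t)) := by
    intro t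
    induction t with
    | zero => simp
    | add p q hp hq => simp only [map_add, hp, hq]
    | tmul p q =>
      simp only [TensorProduct.map_tmul, LinearMap.mul'_apply, LinearMap.rTensor_tmul]
      generalize comul (R := k) p = s
      induction s with
      | zero => simp
      | add p q hp hq => simp only [map_add, add_mul, TensorProduct.add_tmul, hp, hq]
      | tmul a b => simp [G]
  rw [e, Coalgebra.coassoc_apply]
  have e2 : ∀ t : A ⊗[k] A, G ((comul (R := k)).lTensor A t)
      = (TensorProduct.rid k A ((counit (R := k)).lTensor A t)) ⊗ₜ 1 := by
    intro t
    induction t with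
    | zero => simp
    | add p q hp hq => simp only [map_add, TensorProduct.add_tmul, hp, hq]
    | tmul p q =>
      simp only [G, LinearMap.lTensor_tmul, LinearMap.comp_apply,
        HopfAlgebra.mul_antipode_lTensor_comul_apply, Algebra.algebraMap_eq_smul_one,
        TensorProduct.rid_tmul, TensorProduct.tmul_smul, TensorProduct.smul_tmul']
  rw [e2]; simp

variable [IsCocomm k A]

/-- The functionals vanishing on `K`, an ideal of the dual algebra. -/
noncomputable def annIdeal {K : Submodule k A} (hK : IsHopfSub K) : Ideal (DualAlg k A) where
  carrier := {f | ∀ x ∈ K, f.toLin x = 0}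
  add_mem' hf hg x hx := by
    rw [DualAlg.toLin_add, LinearMap.add_apply, hf x hx, hg x hx, add_zero]
  zero_mem' x _ := rfl
  smul_mem' g f hf x hx := by
    rw [smul_eq_mul, DualAlg.mul_apply]
    refine range_map_induction (P := fun t => LinearMap.mul' k k
      (TensorProduct.map g.toLin f.toLin t) = 0) (by simp) (fun s t hs ht => ?_)
      (fun y _ z hz => ?_) (hK.comul_mem hx)
    · simp only [map_add, hs, ht, add_zero]
    · have : f.toLin z = 0 := hf z hz
      simp [this]

variable {K : Submodule k A} (hK : IsHopfSub K)

/-- The `n`-fold wedge power of `K`: the elements killed by the `n`-th power of the ideal of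
functionals vanishing on `K`. In this indexing the power `0` is `0` and the power `1` is `K`. -/
noncomputable def wedge (n : ℕ) : Submodule (DualAlg k A) A :=
  Submodule.torsionBySet (DualAlg k A) A ((annIdeal hK ^ n : Ideal (DualAlg k A)) : Set _)

theorem mem_wedge {n : ℕ} {a : A} :
    a ∈ wedge hK n ↔ ∀ f ∈ annIdeal hK ^ n, f • a = 0 := by
  simp [wedge, Submodule.mem_torsionBySet_iff]

theorem mem_wedge_zero {a : A} : a ∈ wedge hK 0 ↔ a = 0 := by
  rw [mem_wedge]
  constructor
  · intro h
    simpa using h 1 (by simp)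
  · rintro rfl
    simp

theorem mem_wedge_succ {n : ℕ} {a : A} :
    a ∈ wedge hK (n + 1) ↔ ∀ f ∈ annIdeal hK, f • a ∈ wedge hK n := by
  simp only [mem_wedge]
  constructor
  · intro h f hf g hg
    rw [smul_smul]
    exact h _ (by rw [pow_succ]; exact Ideal.mul_mem_mul hg hf)
  · intro h r hr
    rw [pow_succ] at hr
    induction hr using Submodule.mul_induction_on' with
    | mem_mul_mem g hg f hf => rw [mul_smul]; exact h f hf g hg
    | add x _ y _ hx hy => rw [add_smul, hx, hy, add_zero]

theorem wedge_mono : Monotone (wedge hK) := by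
  refine monotone_nat_of_le_succ fun n a ha => ?_
  rw [mem_wedge_succ]
  exact fun f _ => (wedge hK n).smul_mem f ha

theorem smul_eq_zero_of_mem {f : DualAlg k A} (hf : f ∈ annIdeal hK) {x : A} (hx : x ∈ K) :
    f • x = 0 := by
  rw [smul_eq_hit, hit_apply]
  refine range_map_induction (P := fun t => TensorProduct.rid k A (f.toLin.lTensor A t) = 0)
    (by simp) (fun s t hs ht => ?_) (fun y _ z hz => ?_) (hK.comul_mem hx)
  · simp only [map_add, hs, ht, add_zero]
  · have : f.toLin z = 0 := hf z hz
    simp [this]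

theorem mem_wedge_one {a : A} : a ∈ wedge hK 1 ↔ a ∈ K := by
  rw [show (1 : ℕ) = 0 + 1 from rfl, mem_wedge_succ]
  simp only [mem_wedge_zero]
  constructor
  · intro h
    by_contra ha
    obtain ⟨f, hf1, hf2⟩ := Submodule.exists_le_ker_of_notMem ha
    refine hf1 ?_
    have h3 := h (DualAlg.of f) (fun x hx => hf2 hx)
    have h4 := counit_smul (DualAlg.of f) a
    rw [h3, map_zero] at h4
    exact h4.symm
  · intro ha f hf
    exact smul_eq_zero_of_mem hK hf ha

theorem smul_mem_of_mem {K : Submodule k A} (hK : IsHopfSub K) (φ : DualAlg k A) {x : A}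
    (hx : x ∈ K) : φ • x ∈ K := by
  rw [← mem_wedge_one hK] at hx ⊢
  exact (wedge hK 1).smul_mem φ hx

theorem comp_mul_flip_mem_annIdeal {f : DualAlg k A} (hf : f ∈ annIdeal hK) {z : A} (hz : z ∈ K) :
    DualAlg.of (f.toLin ∘ₗ (LinearMap.mul k A).flip z) ∈ annIdeal hK :=
  fun x hx => hf (x * z) (hK.mul_mem hx hz)

theorem wedge_mul_mem {n : ℕ} {a x : A} (ha : a ∈ wedge hK n) (hx : x ∈ K) :
    a * x ∈ wedge hK n := by
  induction n generalizing a x with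
  | zero =>
    rw [mem_wedge_zero] at ha ⊢
    rw [ha, zero_mul]
  | succ n ih =>
    rw [mem_wedge_succ] at ha ⊢
    intro f hf
    rw [smul_eq_hit, hit_apply, Bialgebra.comul_mul]
    refine slice_mul_mem (P := (wedge hK n).restrictScalars k) f.toLin a (hK.comul_mem hx)
      fun y hy z hz => ?_
    exact ih (ha _ (comp_mul_flip_mem_annIdeal hK hf hz)) hy

/-- The union of the wedge powers of `K`. -/
noncomputable def wedgeUnion : Submodule (DualAlg k A) A where
  carrier := {a | ∃ n, a ∈ wedge hK n}
  add_mem' := by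
    rintro a b ⟨m, hm⟩ ⟨n, hn⟩
    exact ⟨max m n, add_mem (wedge_mono hK (le_max_left m n) hm)
      (wedge_mono hK (le_max_right m n) hn)⟩
  zero_mem' := ⟨0, zero_mem _⟩
  smul_mem' := by
    rintro f a ⟨n, hn⟩
    exact ⟨n, (wedge hK n).smul_mem f hn⟩

/-- The elements on which some functional vanishing on `K` acts as the identity. It is a
complement of the union of the wedge powers of `K`. -/
noncomputable def wedgeCompl : Submodule (DualAlg k A) A where
  carrier := {a | ∃ j ∈ annIdeal hK, j • a = a}
  add_mem' := by
    rintro a b ⟨i, hi, hia⟩ ⟨j, hj, hjb⟩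
    refine ⟨i + j - i * j, Ideal.sub_mem _ (Ideal.add_mem _ hi hj) (Ideal.mul_mem_left _ _ hj), ?_⟩
    have h1 : (i + j - i * j) • a = i • a + j • a - j • (i • a) := by
      rw [sub_smul, add_smul, mul_comm i j, mul_smul]
    have h2 : (i + j - i * j) • b = i • b + j • b - i • (j • b) := by
      rw [sub_smul, add_smul, mul_smul]
    rw [smul_add, h1, h2, hia, hjb]
    abel
  zero_mem' := ⟨0, zero_mem _, smul_zero _⟩
  smul_mem' := by
    rintro f a ⟨j, hj, hja⟩
    exact ⟨j, hj, by rw [smul_comm, hja]⟩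

theorem eq_zero_of_mem_of_mem {a : A} (h1 : a ∈ wedgeUnion hK) (h2 : a ∈ wedgeCompl hK) :
    a = 0 := by
  obtain ⟨n, hn⟩ := h1
  obtain ⟨j, hj, hja⟩ := h2
  have h : ∀ m : ℕ, j ^ m • a = a := by
    intro m
    induction m with
    | zero => simp
    | succ m ih => rw [pow_succ, mul_smul, hja, ih]
  rw [← h n]
  exact (mem_wedge hK).mp hn _ (Ideal.pow_mem_pow hj n)

/-- `A` is the sum of `wedgeCompl` and `wedgeUnion`, and the first component of `a` can be chosen
in the subcoalgebra generated by `a`. -/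
theorem exists_decomposition (a : A) :
    ∃ b ∈ Submodule.span (DualAlg k A) {a},
      b ∈ wedgeCompl hK ∧ a - b ∈ wedgeUnion hK := by
  have := span_finiteDimensional (k := k) a
  have : IsArtinian (DualAlg k A) (Submodule.span (DualAlg k A) {a}) :=
    isArtinian_of_tower k inferInstance
  have : IsNoetherian (DualAlg k A) (Submodule.span (DualAlg k A) {a}) :=
    isNoetherian_of_tower k inferInstance
  obtain ⟨j, hj, hja, n, hn⟩ := exists_fitting (annIdeal hK) a
  exact ⟨j • a, Submodule.smul_mem _ _ (Submodule.mem_span_singleton_self a), ⟨j, hj, hja⟩,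
    n, (mem_wedge hK).mpr hn⟩

/-- If `j` vanishes on `K` and acts as the identity on `d`, then `d y` is a sum of terms
`j' ⇀ (d y₁)` with `j'` vanishing on `K`, namely `j' = j(- S(y₂))`. Applied to the
finite-dimensional product `N` of the subcoalgebras generated by `a` and `x`, this shows that
`N = J N` for the ideal `J` of functionals vanishing on `K`, and Nakayama's lemma gives an element
of `J` acting on `N` as the identity. -/
theorem wedgeCompl_mul_mem {a x : A} (ha : a ∈ wedgeCompl hK) (hx : x ∈ K) :
    a * x ∈ wedgeCompl hK := by
  obtain ⟨j, hj, hja⟩ := ha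
  set D := (Submodule.span (DualAlg k A) {a})
  set F := (Submodule.span (DualAlg k A) {x})
  have hD : ∀ d ∈ D, j • d = d := by
    intro d hd
    obtain ⟨r, rfl⟩ := Submodule.mem_span_singleton.mp hd
    rw [smul_comm, hja]
  have hF : ∀ y ∈ F, y ∈ K := by
    intro y hy
    obtain ⟨r, rfl⟩ := Submodule.mem_span_singleton.mp hy
    exact smul_mem_of_mem hK r hx
  set Nk : Submodule k A := D.restrictScalars k * F.restrictScalars k with hNk
  have hstable : ∀ (r : DualAlg k A), ∀ n ∈ Nk, r • n ∈ Nk := by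
    intro r n hn
    induction hn using Submodule.mul_induction_on' with
    | mem_mul_mem d hd y hy =>
      rw [smul_eq_hit, hit_apply, Bialgebra.comul_mul]
      refine slice_mul_mem r.toLin d (comul_mem_of_mem F hy) fun y' hy' z hz => ?_
      exact Submodule.mul_mem_mul (D.smul_mem (DualAlg.of _) hd) hy'
    | add p _ q _ hp hq => rw [smul_add]; exact add_mem hp hq
  let N : Submodule (DualAlg k A) A :=
    { Nk with smul_mem' := fun r n hn => hstable r n hn }
  have hfin : Module.Finite k N := by
    have h1 : (D.restrictScalars k).FG :=
      Module.Finite.iff_fg.mp (span_finiteDimensional (k := k) a)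
    have h2 : (F.restrictScalars k).FG :=
      Module.Finite.iff_fg.mp (span_finiteDimensional (k := k) x)
    exact Module.Finite.iff_fg.mpr (h1.mul h2)
  have hfg : N.FG := Module.Finite.iff_fg.mp (Module.Finite.of_restrictScalars_finite k _ N)
  have hle : N ≤ annIdeal hK • N := by
    intro n hn
    change n ∈ Nk at hn
    induction hn using Submodule.mul_induction_on' with
    | add p hp q hq h1 h2 => exact add_mem h1 h2
    | mem_mul_mem d hd y hy =>
      have key : ∀ t, t ∈ range (TensorProduct.map (F.restrictScalars k).subtype
          (F.restrictScalars k).subtype) →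
          TensorProduct.rid k A (j.toLin.lTensor A (comul (R := k) d *
            LinearMap.mul' k (A ⊗[k] A) (TensorProduct.map (comul (R := k))
            ((TensorProduct.mk k A A 1) ∘ₗ HopfAlgebra.antipode k) t))) ∈ annIdeal hK • N := by
        intro t ht
        refine range_map_induction (P := fun t => TensorProduct.rid k A (j.toLin.lTensor A
          (comul (R := k) d * LinearMap.mul' k (A ⊗[k] A) (TensorProduct.map (comul (R := k))
            ((TensorProduct.mk k A A 1) ∘ₗ HopfAlgebra.antipode k) t))) ∈ annIdeal hK • N)
          (by simp only [map_zero, mul_zero, zero_mem]) (fun s t hs ht => ?_)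
          (fun y' hy' z hz => ?_) ht
        · simp only [map_add]
          rw [mul_add, map_add, map_add]
          exact add_mem hs ht
        · have h1 := Submodule.smul_mem_smul (N := N)
            (comp_mul_flip_mem_annIdeal hK hj (hK.antipode_mem (hF z hz)))
            (show d * y' ∈ N from show d * y' ∈ Nk from Submodule.mul_mem_mul hd hy')
          convert h1 using 1
          rw [smul_eq_hit, hit_apply, Bialgebra.comul_mul, TensorProduct.map_tmul,
            LinearMap.mul'_apply, ← mul_assoc]
          generalize comul (R := k) d * comul (R := k) y' = s
          induction s with
          | zero => simp
          | add p q hp hq => simp only [map_add, add_mul, hp, hq]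
          | tmul p q =>
            simp only [TensorProduct.mk_apply, LinearMap.comp_apply,
              Algebra.TensorProduct.tmul_mul_tmul, mul_one, LinearMap.lTensor_tmul,
              TensorProduct.rid_tmul]
            rfl
      have h1 := key _ (comul_mem_of_mem F hy)
      rw [mul'_comul_antipode] at h1
      have h2 : TensorProduct.rid k A (j.toLin.lTensor A (comul (R := k) d * y ⊗ₜ 1))
          = (j • d) * y := by
        rw [smul_eq_hit, hit_apply]
        generalize comul (R := k) d = s
        induction s with
        | zero => simp
        | add p q hp hq => simp only [map_add, add_mul, hp, hq]
        | tmul p q => simp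
      rw [h2, hD d hd] at h1
      exact h1
  obtain ⟨r, hr, hrN⟩ := Submodule.exists_mem_and_smul_eq_self_of_fg_of_le_smul _ N hfg hle
  exact ⟨r, hr, hrN _ (show a * x ∈ Nk from Submodule.mul_mem_mul
    (Submodule.mem_span_singleton_self a) (Submodule.mem_span_singleton_self x))⟩

end Newman

end CocommHopf

/-! ### A Hopf subalgebra is determined by its quotient -/

namespace CocommHopf

open WithConv LinearMap

theorem range_map_id_induction {k : Type*} {A : Type*} [Field k] [AddCommGroup A] [Module k A]
    {U : Submodule k A} {P : A ⊗[k] A → Prop} (h0 : P 0)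
    (hadd : ∀ s t, P s → P t → P (s + t)) (htmul : ∀ a ∈ U, ∀ b, P (a ⊗ₜ b)) {t : A ⊗[k] A}
    (ht : t ∈ range (TensorProduct.map U.subtype (LinearMap.id (R := k) (M := A)))) : P t := by
  obtain ⟨s, rfl⟩ := ht
  induction s with
  | zero => simpa using h0
  | add x y hx hy => simpa only [map_add] using hadd _ _ hx hy
  | tmul x y => exact htmul x x.2 y

section Newman

variable {k : Type*} {A : Type*} [Field k] [Ring A] [HopfAlgebra k A] {K : Submodule k A}

variable (k) in
/-- The augmentation ideal `K ∩ ker ε` of a subspace. -/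
noncomputable def augKer (K : Submodule k A) : Submodule k A := K ⊓ ker (counit (R := k) (A := A))

variable (k) in
theorem mem_top_mul_augKer_of_mem_augIdeal {x : A} (hx : x ∈ augIdeal k (K : Set A)) :
    x ∈ (⊤ : Submodule k A) * augKer k K := by
  induction hx using Submodule.span_induction with
  | zero => exact zero_mem _
  | add x y _ _ hx hy => exact add_mem hx hy
  | mem x hx => rw [← one_mul x]; exact Submodule.mul_mem_mul trivial hx
  | smul c x hx' hx =>
    clear hx'
    rw [smul_eq_mul]
    induction hx using Submodule.mul_induction_on' with
    | mem_mul_mem a _ y hy => rw [← mul_assoc]; exact Submodule.mul_mem_mul trivial hy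
    | add a _ b _ ha hb => rw [mul_add]; exact add_mem ha hb

theorem counit_eq_zero_of_mem_mul_augKer {U : Submodule k A} {x : A} (hx : x ∈ U * augKer k K) :
    counit (R := k) x = 0 := by
  induction hx using Submodule.mul_induction_on' with
  | mem_mul_mem a _ y hy =>
    have : counit (R := k) y = 0 := hy.2
    rw [Bialgebra.counit_mul, this, mul_zero]
  | add a _ b _ ha hb => rw [map_add, ha, hb, add_zero]

theorem augIdeal_induction {P : A → Prop}
    (hmul : ∀ a, ∀ x ∈ K, counit (R := k) x = 0 → P (a * x))
    (hadd : ∀ a b, P a → P b → P (a + b)) {z : A} (hz : z ∈ augIdeal k (K : Set A)) : P z := by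
  have h := mem_top_mul_augKer_of_mem_augIdeal k hz
  clear hz
  induction h using Submodule.mul_induction_on' with
  | mem_mul_mem a _ y hy => exact hmul a y hy.1 hy.2
  | add a _ b _ ha hb => exact hadd _ _ ha hb

variable [IsCocomm k A] (hK : IsHopfSub K)

/-- `Δ(Kₙ₊₁) ⊆ Kₙ₊₁ ⊗ K + Kₙ ⊗ A` for the wedge powers `Kₙ` of `K`. -/
theorem comul_mem_of_mem_wedge_succ {n : ℕ} {m : A} (hm : m ∈ wedge hK (n + 1)) :
    ∃ s₁ ∈ range (TensorProduct.map ((wedge hK (n + 1)).restrictScalars k).subtype K.subtype),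
    ∃ s₂ ∈ range (TensorProduct.map ((wedge hK n).restrictScalars k).subtype
      (LinearMap.id (R := k) (M := A))), comul (R := k) m = s₁ + s₂ := by
  obtain ⟨κ, hκ, hκK⟩ := exists_projection K
  refine ⟨κ.lTensor A (comul (R := k) m), ?_, (LinearMap.id - κ).lTensor A (comul (R := k) m), ?_,
    ?_⟩
  · refine range_map_induction (P := fun t => κ.lTensor A t ∈ range (TensorProduct.map
      ((wedge hK (n + 1)).restrictScalars k).subtype K.subtype)) (by simp)
      (fun s t hs ht => ?_) (fun a ha b _ => ?_) (comul_mem_of_mem _ hm)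
    · rw [map_add]; exact add_mem hs ht
    · exact ⟨⟨a, ha⟩ ⊗ₜ ⟨κ b, hκ b⟩, rfl⟩
  · apply mem_range_map_id_of_slices
    intro φ
    rw [mem_wedge_succ] at hm
    have h := hm (DualAlg.of (φ ∘ₗ (LinearMap.id - κ))) (fun x hx => by
      change φ (x - κ x) = 0
      rw [hκK x hx, sub_self, map_zero])
    rw [smul_eq_hit, hit_apply] at h
    change TensorProduct.rid k A ((φ ∘ₗ (LinearMap.id - κ)).lTensor A _) ∈ _ at h
    rw [LinearMap.lTensor_comp] at h
    exact h
  · rw [← LinearMap.add_apply, ← LinearMap.lTensor_add, add_sub_cancel, LinearMap.lTensor_id,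
      LinearMap.id_apply]

/-- The quotient `Kₙ₊₁/Kₙ` of successive wedge powers of `K` is a Hopf module over `K`, and every
element `v` of a Hopf module satisfies `v = P(v₀) v₁`, with `P(v) = v₀ S(v₁)` the projection onto
the coinvariants. The operator `T` lifts `v ↦ P(v₀) v₁` to `A`: it is `K`-linear and congruent to
the identity on `Kₙ₊₁` modulo `Kₙ`, and it kills `Kₙ` on the nose. -/
theorem exists_hopfModule_operator (n : ℕ) :
    ∃ T : A →ₗ[k] A,
      (∀ m ∈ wedge hK (n + 1), ∀ x ∈ K, T (m * x) = T m * x) ∧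
      (∀ m ∈ wedge hK (n + 1), m - T m ∈ wedge hK n) ∧
      (∀ m ∈ wedge hK n, T m = 0) ∧
      ∀ m, (∀ φ : DualAlg k A, φ • m ∈ (wedge hK (n + 1)).restrictScalars k * augKer k K
        ⊔ (wedge hK n).restrictScalars k) → T m = 0 := by
  obtain ⟨κ, hκ, hκK⟩ := exists_projection K
  obtain ⟨π, hπ, hπM⟩ := exists_projection ((wedge hK n).restrictScalars k)
  set τ : A →ₗ[k] A := LinearMap.id - π with hτ
  have hτM : ∀ a ∈ wedge hK n, τ a = 0 := fun a ha => by
    change a - π a = 0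
    rw [hπM a ha, sub_self]
  have hτsub : ∀ a, τ a - a ∈ wedge hK n := fun a => by
    have : τ a - a = - π a := by change a - π a - a = _; abel
    rw [this]
    exact neg_mem (hπ a)
  set Sκ : A →ₗ[k] A := HopfAlgebra.antipode k ∘ₗ κ with hSκ
  have hSκmem : ∀ a, Sκ a ∈ K := fun a => hK.antipode_mem (hκ a)
  set Θ : A ⊗[k] A →ₗ[k] A := LinearMap.mul' k A ∘ₗ TensorProduct.map LinearMap.id Sκ with hΘ
  have hΘt : ∀ a b, Θ (a ⊗ₜ b) = a * Sκ b := fun a b => rfl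
  set θ : A →ₗ[k] A := Θ ∘ₗ comul (R := k) with hθ
  -- `θ` preserves the lower wedge power
  have hΘM : ∀ t ∈ range (TensorProduct.map ((wedge hK n).restrictScalars k).subtype
      (LinearMap.id (R := k) (M := A))), Θ t ∈ wedge hK n := fun t ht =>
    range_map_id_induction (P := fun t => Θ t ∈ wedge hK n) (by rw [map_zero]; exact zero_mem _)
      (fun s t hs ht => by rw [map_add]; exact add_mem hs ht)
      (fun a ha b => wedge_mul_mem hK ha (hSκmem b)) ht
  have hcomulM : ∀ m ∈ wedge hK n, comul (R := k) m ∈ range (TensorProduct.map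
      ((wedge hK n).restrictScalars k).subtype (LinearMap.id (R := k) (M := A))) := fun m hm =>
    mem_range_map_id_of_slices _ _ fun φ => (wedge hK n).smul_mem (DualAlg.of φ) hm
  have hθM : ∀ m ∈ wedge hK n, θ m ∈ wedge hK n := fun m hm => hΘM _ (hcomulM m hm)
  -- multiplication of `wedge ⊗ A` by `Δ(x)` with `x ∈ K`
  have hmulM : ∀ x ∈ K, ∀ t ∈ range (TensorProduct.map ((wedge hK n).restrictScalars k).subtype
      (LinearMap.id (R := k) (M := A))), t * comul (R := k) x ∈ range (TensorProduct.map
      ((wedge hK n).restrictScalars k).subtype (LinearMap.id (R := k) (M := A))) := by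
    intro x hx t ht
    refine range_map_id_induction (P := fun t => t * comul (R := k) x ∈ range (TensorProduct.map
      ((wedge hK n).restrictScalars k).subtype (LinearMap.id (R := k) (M := A))))
      (by rw [zero_mul]; exact zero_mem _) (fun s t hs ht => by rw [add_mul]; exact add_mem hs ht)
      (fun a ha b => ?_) ht
    refine range_map_induction (P := fun t => a ⊗ₜ b * t ∈ range (TensorProduct.map
      ((wedge hK n).restrictScalars k).subtype (LinearMap.id (R := k) (M := A))))
      (by rw [mul_zero]; exact zero_mem _) (fun s t hs ht => by rw [mul_add]; exact add_mem hs ht)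
      (fun y hy z _ => ?_) (hK.comul_mem hx)
    rw [Algebra.TensorProduct.tmul_mul_tmul]
    exact ⟨⟨a * y, wedge_mul_mem hK ha hy⟩ ⊗ₜ (b * z), rfl⟩
  -- `θ(m x) = ε(x) θ(m)` modulo the lower wedge power
  have hθmul : ∀ m ∈ wedge hK (n + 1), ∀ x ∈ K,
      θ (m * x) - counit (R := k) x • θ m ∈ wedge hK n := by
    intro m hm x hx
    obtain ⟨s₁, hs₁, s₂, hs₂, hs⟩ := comul_mem_of_mem_wedge_succ hK hm
    have h1 : Θ (s₁ * comul (R := k) x) = counit (R := k) x • Θ s₁ := by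
      refine range_map_induction (P := fun s => Θ (s * comul (R := k) x)
        = counit (R := k) x • Θ s) (by simp) (fun s t hs ht => ?_) (fun a _ y hy => ?_) hs₁
      · rw [add_mul, map_add, map_add, smul_add, hs, ht]
      · have h2 : Θ (a ⊗ₜ y * comul (R := k) x) = a * LinearMap.mul' k A
            ((HopfAlgebra.antipode k).lTensor A (comul (R := k) x)) * HopfAlgebra.antipode k y := by
          refine range_map_induction (P := fun t => Θ (a ⊗ₜ y * t) = a * LinearMap.mul' k A
            ((HopfAlgebra.antipode k).lTensor A t) * HopfAlgebra.antipode k y) (by simp)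
            (fun s t hs ht => ?_) (fun p _ q hq => ?_) (hK.comul_mem hx)
          · rw [mul_add, map_add, map_add, map_add, mul_add, add_mul, hs, ht]
          · rw [Algebra.TensorProduct.tmul_mul_tmul, hΘt, hSκ, LinearMap.comp_apply,
              hκK _ (hK.mul_mem hy hq), HopfAlgebra.antipode_mul_antidistrib]
            simp [mul_assoc]
        rw [h2, HopfAlgebra.mul_antipode_lTensor_comul_apply, hΘt, hSκ, LinearMap.comp_apply,
          hκK y hy, Algebra.algebraMap_eq_smul_one]
        simp
    have h2 : θ (m * x) - counit (R := k) x • θ m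
        = Θ (s₂ * comul (R := k) x) - counit (R := k) x • Θ s₂ := by
      change Θ (comul (R := k) (m * x)) - counit (R := k) x • Θ (comul (R := k) m) = _
      rw [Bialgebra.comul_mul, hs, add_mul, map_add, map_add, smul_add, h1]
      abel
    rw [h2]
    exact sub_mem (hΘM _ (hmulM x hx _ hs₂))
      (((wedge hK n).restrictScalars k).smul_mem _ (hΘM _ hs₂))
  -- `T = Ξ ∘ Δ` with `Ξ (a ⊗ b) = τ(θ(a)) κ(b)`, where `θ` and `κ` extend `P` and `id` from `K`
  -- and `τ` normalizes representatives modulo the lower wedge power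
  set Ξ : A ⊗[k] A →ₗ[k] A := LinearMap.mul' k A ∘ₗ TensorProduct.map (τ ∘ₗ θ) κ with hΞ
  have hΞt : ∀ a b, Ξ (a ⊗ₜ b) = τ (θ a) * κ b := fun a b => rfl
  have hΞM : ∀ t ∈ range (TensorProduct.map ((wedge hK n).restrictScalars k).subtype
      (LinearMap.id (R := k) (M := A))), Ξ t = 0 := fun t ht =>
    range_map_id_induction (P := fun t => Ξ t = 0) (map_zero _)
      (fun s t hs ht => by rw [map_add, hs, ht, add_zero])
      (fun a ha b => by rw [hΞt, hτM _ (hθM a ha), zero_mul]) ht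
  refine ⟨Ξ ∘ₗ comul (R := k), ?_, ?_, ?_, ?_⟩
  · intro m hm x hx
    obtain ⟨s₁, hs₁, s₂, hs₂, hs⟩ := comul_mem_of_mem_wedge_succ hK hm
    change Ξ (comul (R := k) (m * x)) = Ξ (comul (R := k) m) * x
    rw [Bialgebra.comul_mul, hs, add_mul, map_add, map_add, hΞM _ hs₂, hΞM _ (hmulM x hx _ hs₂),
      add_zero, add_zero]
    refine range_map_induction (P := fun s => Ξ (s * comul (R := k) x) = Ξ s * x) (by simp)
      (fun s t hs ht => ?_) (fun a ha y hy => ?_) hs₁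
    · rw [add_mul, map_add, map_add, add_mul, hs, ht]
    · have h2 : Ξ (a ⊗ₜ y * comul (R := k) x) = τ (θ a) * y * TensorProduct.lid k A
          ((counit (R := k)).rTensor A (comul (R := k) x)) := by
        refine range_map_induction (P := fun t => Ξ (a ⊗ₜ y * t) = τ (θ a) * y *
          TensorProduct.lid k A ((counit (R := k)).rTensor A t)) (by simp)
          (fun s t hs ht => ?_) (fun p hp q hq => ?_) (hK.comul_mem hx)
        · rw [mul_add, map_add, map_add, map_add, mul_add, hs, ht]
        · have h3 : τ (θ (a * p)) = counit (R := k) p • τ (θ a) := by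
            have h4 := hτM _ (hθmul a ha p hp)
            rwa [map_sub, map_smul, sub_eq_zero] at h4
          rw [Algebra.TensorProduct.tmul_mul_tmul, hΞt, hκK _ (hK.mul_mem hy hq), h3]
          simp [mul_assoc]
      rw [h2, hΞt, hκK y hy]
      simp
  · intro m hm
    obtain ⟨s₁, hs₁, s₂, hs₂, hs⟩ := comul_mem_of_mem_wedge_succ hK hm
    set χ : A →ₗ[k] A := LinearMap.mul' k A ∘ₗ TensorProduct.map Sκ κ ∘ₗ comul (R := k) with hχ
    set Ψ : A ⊗[k] A →ₗ[k] A := LinearMap.mul' k A ∘ₗ TensorProduct.map LinearMap.id χ with hΨ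
    have hassoc : LinearMap.mul' k A (TensorProduct.map θ κ (comul (R := k) m))
        = Ψ (comul (R := k) m) :=
      LinearMap.congr_fun (congrArg WithConv.ofConv
        (mul_assoc (toConv (LinearMap.id (R := k) (M := A))) (toConv Sκ) (toConv κ))) m
    have h1 : Ξ (comul (R := k) m) - Ψ (comul (R := k) m) ∈ wedge hK n := by
      rw [← hassoc]
      generalize comul (R := k) m = t
      induction t with
      | zero => simp only [map_zero, sub_zero, zero_mem]
      | add p q hp hq =>
        rw [map_add, map_add, map_add, add_sub_add_comm]
        exact add_mem hp hq
      | tmul a b =>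
        rw [hΞt, TensorProduct.map_tmul, LinearMap.mul'_apply, ← sub_mul]
        exact wedge_mul_mem hK (hτsub _) (hκ b)
    have hχK : ∀ y ∈ K, χ y = counit (R := k) y • (1 : A) := by
      intro y hy
      have h2 : LinearMap.mul' k A (TensorProduct.map Sκ κ (comul (R := k) y))
          = LinearMap.mul' k A ((HopfAlgebra.antipode k).rTensor A (comul (R := k) y)) := by
        refine range_map_induction (P := fun t => LinearMap.mul' k A (TensorProduct.map Sκ κ t)
          = LinearMap.mul' k A ((HopfAlgebra.antipode k).rTensor A t)) (by simp)
          (fun s t hs ht => by simp only [map_add, hs, ht]) (fun p hp q hq => ?_)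
          (hK.comul_mem hy)
        simp [hSκ, hκK p hp, hκK q hq]
      exact h2.trans (by
        rw [HopfAlgebra.mul_antipode_rTensor_comul_apply, Algebra.algebraMap_eq_smul_one])
    have hχmem : ∀ b, χ b ∈ K := by
      intro b
      rw [hχ, LinearMap.comp_apply, LinearMap.comp_apply]
      generalize comul (R := k) b = t
      induction t with
      | zero => simp only [map_zero, zero_mem]
      | add p q hp hq => rw [map_add, map_add]; exact add_mem hp hq
      | tmul p q => exact hK.mul_mem (hSκmem p) (hκ q)
    have h3 : m = TensorProduct.rid k A ((counit (R := k)).lTensor A (comul (R := k) m)) := by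
      simp
    have h4 : Ψ s₁ = TensorProduct.rid k A ((counit (R := k)).lTensor A s₁) := by
      refine range_map_induction (P := fun s => Ψ s = TensorProduct.rid k A
        ((counit (R := k)).lTensor A s)) (by simp)
        (fun s t hs ht => by simp only [map_add, hs, ht]) (fun a _ y hy => ?_) hs₁
      simp [hΨ, hχK y hy]
    have h5 : TensorProduct.rid k A ((counit (R := k)).lTensor A s₂) - Ψ s₂ ∈ wedge hK n := by
      refine range_map_id_induction (P := fun s => TensorProduct.rid k A
        ((counit (R := k)).lTensor A s) - Ψ s ∈ wedge hK n)
        (by simp only [map_zero, sub_zero, zero_mem])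
        (fun s t hs ht => ?_) (fun a ha b => ?_) hs₂
      · rw [map_add, map_add, map_add, add_sub_add_comm]
        exact add_mem hs ht
      · refine sub_mem ?_ (wedge_mul_mem hK ha (hχmem b))
        rw [LinearMap.lTensor_tmul, TensorProduct.rid_tmul]
        exact ((wedge hK n).restrictScalars k).smul_mem _ ha
    have h6 : m - Ψ (comul (R := k) m) ∈ wedge hK n := by
      rw [hs] at h3
      rw [hs, map_add, h4, h3, map_add, map_add, add_sub_add_left_eq_sub]
      exact h5
    have h7 := sub_mem h6 h1
    rw [sub_sub_sub_cancel_right] at h7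
    exact h7
  · intro m hm
    exact hΞM _ (hcomulM m hm)
  · intro m hm
    have h0 : ∀ p ∈ (wedge hK (n + 1)).restrictScalars k * augKer k K, θ p ∈ wedge hK n := by
      intro p hp
      induction hp using Submodule.mul_induction_on' with
      | mem_mul_mem a ha x hx =>
        have h2 := hθmul a ha x hx.1
        have hx2 : counit (R := k) x = 0 := hx.2
        rwa [hx2, zero_smul, sub_zero] at h2
      | add a _ b _ ha hb => rw [map_add]; exact add_mem ha hb
    have h1 : ∀ φ : DualAlg k A, τ (θ (φ • m)) = 0 := by
      intro φ
      obtain ⟨p, hp, z, hz, hpz⟩ := Submodule.mem_sup.mp (hm φ)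
      rw [← hpz, map_add, map_add, hτM _ (hθM z hz), hτM _ (h0 p hp), add_zero]
    have h2 := comul_mem_of_mem (Submodule.span (DualAlg k A) {m})
      (Submodule.mem_span_singleton_self m)
    refine range_map_induction (P := fun t => Ξ t = 0) (map_zero _)
      (fun s t hs ht => by rw [map_add, hs, ht, add_zero]) (fun a ha b _ => ?_) h2
    obtain ⟨φ, rfl⟩ := Submodule.mem_span_singleton.mp ((Submodule.restrictScalars_mem k _ a).mp ha)
    rw [hΞt, h1, zero_mul]

theorem wedge_mul_augKer_mono {m n : ℕ} (h : m ≤ n) :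
    (wedge hK m).restrictScalars k * augKer k K ≤ (wedge hK n).restrictScalars k * augKer k K :=
  Submodule.mul_le.mpr fun _ ha _ hx => Submodule.mul_mem_mul (wedge_mono hK h ha) hx

/-- `Kₙ₊₁ K⁺ ∩ Kₙ ⊆ Kₙ K⁺`: on `Kₙ₊₁ K⁺` the operator `T` is congruent to the identity modulo
`Kₙ K⁺`, and it kills `Kₙ`. -/
theorem mem_wedge_mul_augKer_of_succ {n : ℕ} {z : A}
    (hz : z ∈ (wedge hK (n + 1)).restrictScalars k * augKer k K) (hzn : z ∈ wedge hK n) :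
    z ∈ (wedge hK n).restrictScalars k * augKer k K := by
  obtain ⟨T, hT1, hT2, hT3, -⟩ := exists_hopfModule_operator hK n
  have key : ∀ z ∈ (wedge hK (n + 1)).restrictScalars k * augKer k K,
      z - T z ∈ (wedge hK n).restrictScalars k * augKer k K := by
    intro z hz
    induction hz using Submodule.mul_induction_on' with
    | mem_mul_mem a ha x hx =>
      rw [hT1 a ha x hx.1, ← sub_mul]
      exact Submodule.mul_mem_mul (hT2 a ha) hx
    | add a _ b _ ha hb =>
      rw [map_add, add_sub_add_comm]
      exact add_mem ha hb
  have h := key z hz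
  rwa [hT3 z hzn, sub_zero] at h

/-- The intersection of `B K⁺`, for `B` the union of the wedge powers `Kₙ` of `K`, with `Kₙ` is
`Kₙ K⁺`. -/
theorem mem_wedge_mul_augKer {n : ℕ} {z : A}
    (hz : z ∈ (wedgeUnion hK).restrictScalars k * augKer k K) (hzn : z ∈ wedge hK n) :
    z ∈ (wedge hK n).restrictScalars k * augKer k K := by
  have h1 : ∃ N, z ∈ (wedge hK N).restrictScalars k * augKer k K := by
    clear hzn
    induction hz using Submodule.mul_induction_on' with
    | mem_mul_mem a ha x hx =>
      obtain ⟨N, hN⟩ := ha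
      exact ⟨N, Submodule.mul_mem_mul hN hx⟩
    | add a _ b _ ha hb =>
      obtain ⟨M, hM⟩ := ha
      obtain ⟨N, hN⟩ := hb
      exact ⟨max M N, add_mem (wedge_mul_augKer_mono hK (le_max_left M N) hM)
        (wedge_mul_augKer_mono hK (le_max_right M N) hN)⟩
  obtain ⟨N, hN⟩ := h1
  induction N with
  | zero => exact wedge_mul_augKer_mono hK (Nat.zero_le n) hN
  | succ N ih =>
    rcases Nat.lt_or_ge N n with h | h
    · exact wedge_mul_augKer_mono hK h hN
    · exact ih (mem_wedge_mul_augKer_of_succ hK hN (wedge_mono hK h hzn))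

/-- `A K⁺ = B K⁺ + B' K⁺`, where `A = B ⊕ B'` with `B` the union of the wedge powers of `K`. -/
theorem exists_decomposition_augIdeal {x : A} (hx : x ∈ augIdeal k (K : Set A)) :
    ∃ b ∈ (wedgeUnion hK).restrictScalars k * augKer k K,
    ∃ b' ∈ (wedgeCompl hK).restrictScalars k * augKer k K, x = b + b' := by
  have h := mem_top_mul_augKer_of_mem_augIdeal k hx
  clear hx
  induction h using Submodule.mul_induction_on' with
  | mem_mul_mem a _ y hy =>
    obtain ⟨b, -, hb1, hb2⟩ := exists_decomposition hK a
    exact ⟨(a - b) * y, Submodule.mul_mem_mul hb2 hy, b * y, Submodule.mul_mem_mul hb1 hy,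
      by rw [sub_mul, sub_add_cancel]⟩
  | add p _ q _ hp hq =>
    obtain ⟨b, hb, b', hb', rfl⟩ := hp
    obtain ⟨c, hc, c', hc', rfl⟩ := hq
    exact ⟨b + c, add_mem hb hc, b' + c', add_mem hb' hc', add_add_add_comm b b' c c'⟩

theorem mul_augKer_le (U : Submodule (DualAlg k A) A)
    (hU : ∀ {a x : A}, a ∈ U → x ∈ K → a * x ∈ U) {z : A}
    (hz : z ∈ U.restrictScalars k * augKer k K) : z ∈ U := by
  induction hz using Submodule.mul_induction_on' with
  | mem_mul_mem a ha x hx => exact hU ha hx.1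
  | add a _ b _ ha hb => exact add_mem ha hb

theorem wedgeUnion_mul_mem {a x : A} (ha : a ∈ wedgeUnion hK) (hx : x ∈ K) :
    a * x ∈ wedgeUnion hK := by
  obtain ⟨n, hn⟩ := ha
  exact ⟨n, wedge_mul_mem hK hn hx⟩

variable (k K) in
/-- The elements `c` with `c₁ ⊗ c₂ = c ⊗ 1` in `A ⊗ A/AK⁺`, a submodule over the dual algebra.
The condition is expressed by applying a functional `φ` to one tensor factor: by cocommutativity it
says that `φ(c₂) c₁ - φ(c) 1` lies in `A K⁺` for all `φ`. -/
noncomputable def coinvariants : Submodule (DualAlg k A) A where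
  carrier := {c | ∀ φ : DualAlg k A, φ • c - φ.toLin c • (1 : A) ∈ augIdeal k (K : Set A)}
  add_mem' ha hb φ := by
    rw [smul_add, map_add, add_smul, add_sub_add_comm]
    exact add_mem (ha φ) (hb φ)
  zero_mem' φ := by simp
  smul_mem' ψ a ha φ := by
    rw [smul_smul, apply_smul]
    exact ha _

/-- The component `b` in `wedgeCompl` of a coinvariant `c` lies in the subcoalgebra generated by `c`,
so it is coinvariant. Comparing components of `φ ⇀ b - φ(b) 1 ∈ A K⁺` and applying `ε` gives
`φ(b) = 0` for all functionals `φ`. -/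
theorem mem_wedgeUnion_of_mem_coinvariants {c : A} (hc : c ∈ coinvariants k K) :
    c ∈ wedgeUnion hK := by
  have h0 : ∀ c ∈ coinvariants k K, c ∈ wedgeCompl hK → c = 0 := by
    intro c hc hc'
    rw [← Module.forall_dual_apply_eq_zero_iff k]
    intro φ
    obtain ⟨b, hb, b', hb', h⟩ := exists_decomposition_augIdeal hK (hc (DualAlg.of φ))
    have h1 : φ c • (1 : A) + b = 0 := by
      refine eq_zero_of_mem_of_mem hK ?_ ?_
      · exact add_mem (((wedgeUnion hK).restrictScalars k).smul_mem _
          ⟨1, (mem_wedge_one hK).mpr hK.one_mem⟩) (mul_augKer_le _ (wedgeUnion_mul_mem hK) hb)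
      · have h2 : φ c • (1 : A) + b = DualAlg.of φ • c - b' := by
          have h3 : DualAlg.of φ • c = b + b' + φ c • (1 : A) := sub_eq_iff_eq_add.mp h
          rw [h3]; abel
        rw [h2]
        exact sub_mem ((wedgeCompl hK).smul_mem _ hc')
          (mul_augKer_le _ (wedgeCompl_mul_mem hK) hb')
    have h4 := congrArg (counit (R := k)) h1
    simpa [counit_eq_zero_of_mem_mul_augKer hb] using h4
  obtain ⟨b, hb, hb1, hb2⟩ := exists_decomposition hK c
  have hbc : b ∈ coinvariants k K :=
    (Submodule.span_singleton_le_iff_mem c (coinvariants k K)).mpr hc hb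
  rwa [h0 b hbc hb1, sub_zero] at hb2

/-- Newman's theorem: if `c ∈ A` satisfies `c₁ ⊗ c₂ = c ⊗ 1` in `A ⊗ A/AK⁺`, then `c ∈ K`. So `K`
is recovered from the quotient `A/AK⁺`. -/
theorem mem_of_mem_coinvariants {K : Submodule k A} (hK : IsHopfSub K) {c : A}
    (hc : c ∈ coinvariants k K) : c ∈ K := by
  have h1 : ∀ φ : DualAlg k A, φ • c - φ.toLin c • (1 : A)
      ∈ (wedgeUnion hK).restrictScalars k * augKer k K := by
    intro φ
    obtain ⟨b, hb, b', hb', h⟩ := exists_decomposition_augIdeal hK (hc φ)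
    have h2 : b' = 0 := by
      refine eq_zero_of_mem_of_mem hK ?_ (mul_augKer_le _ (wedgeCompl_mul_mem hK) hb')
      have h3 : b' = φ • c - φ.toLin c • (1 : A) - b := by rw [h]; abel
      rw [h3]
      exact sub_mem (sub_mem ((wedgeUnion hK).smul_mem _ (mem_wedgeUnion_of_mem_coinvariants hK hc))
        (((wedgeUnion hK).restrictScalars k).smul_mem _
          ⟨1, (mem_wedge_one hK).mpr hK.one_mem⟩)) (mul_augKer_le _ (wedgeUnion_mul_mem hK) hb)
    rw [h, h2, add_zero]
    exact hb
  have h2 : ∀ n, c ∈ wedge hK (n + 1) → c ∈ K := by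
    intro n
    induction n with
    | zero => exact (mem_wedge_one hK).mp
    | succ n ih =>
      intro hn
      apply ih
      obtain ⟨T, -, hT2, -, hT4⟩ := exists_hopfModule_operator hK (n + 1)
      have hone : (1 : A) ∈ wedge hK (n + 1) :=
        wedge_mono hK (Nat.le_add_left 1 n) ((mem_wedge_one hK).mpr hK.one_mem)
      have hT : T c = 0 := hT4 c fun φ => by
        refine Submodule.mem_sup.mpr ⟨φ • c - φ.toLin c • (1 : A),
          mem_wedge_mul_augKer hK (h1 φ) (sub_mem ((wedge hK _).smul_mem _ hn) ?_),
          φ.toLin c • (1 : A), ?_, sub_add_cancel _ _⟩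
        · exact ((wedge hK _).restrictScalars k).smul_mem _ (wedge_mono hK (Nat.le_succ _) hone)
        · exact ((wedge hK _).restrictScalars k).smul_mem _ hone
      have h3 := hT2 c hn
      rwa [hT, sub_zero] at h3
  obtain ⟨n, hn⟩ := mem_wedgeUnion_of_mem_coinvariants hK hc
  exact h2 n (wedge_mono hK (Nat.le_succ n) hn)

end Newman

end CocommHopf

/-! ### The second Hopf algebra structure of a Hopf brace -/

/-- The Hopf algebra `(A, •, 1, Δ, ε, T)` of a Hopf brace `A`, on a type synonym of `A`. The field
`k` is a parameter because `•` belongs to the Hopf brace structure over `k`. -/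
def BulletAlg (_k : Type v) (A : Type u) : Type u := A

namespace BulletAlg

variable {k : Type v} {A : Type u} [Field k] [Ring A] [HopfBrace k A]

instance : AddCommGroup (BulletAlg k A) := inferInstanceAs (AddCommGroup A)

noncomputable instance : Ring (BulletAlg k A) where
  __ := (inferInstance : AddCommGroup (BulletAlg k A))
  mul a b := HopfBrace.bullet k (A := A) a b
  one := (1 : A)
  mul_assoc a b c := HopfBrace.bullet_assoc (k := k) (A := A) a b c
  one_mul a := HopfBrace.one_bullet (k := k) (A := A) a
  mul_one a := HopfBrace.bullet_one (k := k) (A := A) a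
  left_distrib a b c := map_add (HopfBrace.bullet k (A := A) a) b c
  right_distrib a b c := LinearMap.map_add₂ (HopfBrace.bullet k (A := A)) a b c
  zero_mul a := LinearMap.map_zero₂ (HopfBrace.bullet k (A := A)) a
  mul_zero a := map_zero (HopfBrace.bullet k (A := A) a)

noncomputable instance : Module k (BulletAlg k A) := inferInstanceAs (Module k A)

noncomputable instance : Algebra k (BulletAlg k A) :=
  Algebra.ofModule (fun c a b => LinearMap.map_smul₂ (HopfBrace.bullet k (A := A)) c a b)
    (fun c a b => map_smul (HopfBrace.bullet k (A := A) a) c b)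

noncomputable instance : Coalgebra k (BulletAlg k A) := inferInstanceAs (Coalgebra k A)

theorem tensor_mul (s t : BulletAlg k A ⊗[k] BulletAlg k A) :
    s * t = TensorProduct.map₂ (LinearMap.mul k (BulletAlg k A))
      (LinearMap.mul k (BulletAlg k A)) s t := by
  induction s with
  | zero => simp
  | add x y hx hy => simp only [map_add, LinearMap.add_apply, add_mul, hx, hy]
  | tmul a b =>
    induction t with
    | zero => simp
    | add x y hx hy => simp only [map_add, mul_add, hx, hy]
    | tmul c d => simp

noncomputable instance : Bialgebra k (BulletAlg k A) :=
  Bialgebra.mk' k (BulletAlg k A) (Bialgebra.counit_one (R := k) (A := A))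
    (fun {a b} => HopfBrace.counit_bullet (k := k) (A := A) a b)
    (Bialgebra.comul_one (R := k) (A := A))
    (fun {a b} => (HopfBrace.comul_bullet (k := k) (A := A) a b).trans (tensor_mul _ _).symm)

noncomputable instance : HopfAlgebra k (BulletAlg k A) where
  antipode := HopfBrace.bulletAntipode k (A := A)
  mul_antipode_rTensor_comul := by
    ext a
    exact (HopfBrace.bulletAntipode_left (k := k) (A := A) a).trans
      (Algebra.algebraMap_eq_smul_one (A := BulletAlg k A) (counit (R := k) (A := A) a)).symm
  mul_antipode_lTensor_comul := by
    ext a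
    exact (HopfBrace.bulletAntipode_right (k := k) (A := A) a).trans
      (Algebra.algebraMap_eq_smul_one (A := BulletAlg k A) (counit (R := k) (A := A) a)).symm

instance [IsCocomm k A] : IsCocomm k (BulletAlg k A) := inferInstanceAs (IsCocomm k A)

end BulletAlg

namespace HopfBrace

open CocommHopf LinearMap

variable {k : Type v} {A : Type u} [Field k] [Ring A] [HopfBrace k A]

theorem act_apply (a b : A) :
    act k a b = LinearMap.mul' k A
      (TensorProduct.map (HopfAlgebra.antipode k) ((bullet k).flip b) (comul (R := k) a)) := rfl

theorem counit_act (a b : A) :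
    counit (R := k) (act k a b) = counit (R := k) a * counit (R := k) b := by
  have e : ∀ t : A ⊗[k] A, counit (R := k) (LinearMap.mul' k A (TensorProduct.map
      (HopfAlgebra.antipode k) ((bullet k).flip b) t))
      = counit (R := k) (TensorProduct.rid k A ((counit (R := k)).lTensor A t))
        * counit (R := k) b := by
    intro t
    induction t with
    | zero => simp
    | add x y hx hy => simp only [map_add, hx, hy, add_mul]
    | tmul x y => simp [counit_bullet]; ring
  rw [act_apply, e]; simp

/-- `a • (b · c) = (a₁ • b) · (a₂ ⇀ c)`. -/
theorem bullet_mul_act (a b c : A) :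
    bullet k a (b * c) = LinearMap.mul' k A
      (TensorProduct.map ((bullet k).flip b) ((act k).flip c) (comul (R := k) a)) :=
  bullet_mul a b c

/-- `a • c = a₁ · (a₂ ⇀ c)`. -/
theorem bullet_eq_mul_act (a c : A) :
    bullet k a c = LinearMap.mul' k A
      (TensorProduct.map LinearMap.id ((act k).flip c) (comul (R := k) a)) := by
  have h := bullet_mul_act (k := k) a 1 c
  rw [one_mul] at h
  have e : (bullet k).flip (1 : A) = LinearMap.id := by
    ext a; exact bullet_one a
  rwa [e] at h

variable [IsCocomm k A]

/-- `T(b₁) • (b₂ · x) = T(b) ⇀ x`. -/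
theorem bulletAntipode_bullet_mul (b x : A) :
    TensorProduct.lift (bullet k) (TensorProduct.map (bulletAntipode k)
      ((LinearMap.mul k A).flip x) (comul (R := k) b)) = act k (bulletAntipode k b) x := by
  have hcop : ∀ a : A, comul (R := k) (bulletAntipode k a)
      = TensorProduct.map (bulletAntipode k) (bulletAntipode k) (comul (R := k) a) := fun a =>
    comul_antipode (k := k) (H := BulletAlg k A) a
  -- `G (p ⊗ (q ⊗ r)) = (T(p) • r) · (T(q) ⇀ x)`
  let G : A ⊗[k] (A ⊗[k] A) →ₗ[k] A := LinearMap.mul' k A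
    ∘ₗ TensorProduct.map (TensorProduct.lift (bullet k)) LinearMap.id
    ∘ₗ (TensorProduct.assoc k A A A).symm.toLinearMap
    ∘ₗ TensorProduct.map (bulletAntipode k)
      ((TensorProduct.comm k A A).toLinearMap
        ∘ₗ ((act k).flip x ∘ₗ bulletAntipode k).rTensor A)
  have hG : ∀ p q r : A, G (p ⊗ₜ (q ⊗ₜ r))
      = bullet k (bulletAntipode k p) r * act k (bulletAntipode k q) x := fun p q r => rfl
  have e1 : ∀ t : A ⊗[k] A, TensorProduct.lift (bullet k) (TensorProduct.map (bulletAntipode k)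
      ((LinearMap.mul k A).flip x) t)
      = G (TensorProduct.assoc k A A A ((comul (R := k)).rTensor A t)) := by
    intro t
    induction t with
    | zero => simp
    | add p q hp hq => simp only [map_add, hp, hq]
    | tmul p q =>
      simp only [TensorProduct.map_tmul, TensorProduct.lift.tmul, LinearMap.rTensor_tmul,
        LinearMap.flip_apply, LinearMap.mul_apply', bullet_mul_act, hcop]
      generalize comul (R := k) p = s
      induction s with
      | zero => simp
      | add p q hp hq => simp only [map_add, TensorProduct.add_tmul, hp, hq]
      | tmul a b => simp [hG]
  have e2 : (comul (R := k)).lTensor A (comul (R := k) b)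
      = (TensorProduct.comm k A A).toLinearMap.lTensor A
        ((comul (R := k)).lTensor A (comul (R := k) b)) := by
    rw [← LinearMap.lTensor_comp_apply, comm_comp_comul]
  have e3 : ∀ t : A ⊗[k] A, G ((TensorProduct.comm k A A).toLinearMap.lTensor A
      (TensorProduct.assoc k A A A ((comul (R := k)).rTensor A t)))
      = act k (bulletAntipode k (TensorProduct.lid k A ((counit (R := k)).rTensor A t))) x := by
    intro t
    induction t with
    | zero => simp
    | add p q hp hq => simp only [map_add, LinearMap.add_apply, hp, hq]
    | tmul p q =>
      have e4 : ∀ s : A ⊗[k] A, G ((TensorProduct.comm k A A).toLinearMap.lTensor A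
          (TensorProduct.assoc k A A A (s ⊗ₜ q)))
          = TensorProduct.lift (bullet k) (TensorProduct.map (bulletAntipode k) LinearMap.id s)
            * act k (bulletAntipode k q) x := by
        intro s
        induction s with
        | zero => simp
        | add p q hp hq => simp only [map_add, TensorProduct.add_tmul, add_mul, hp, hq]
        | tmul a b => simp [hG]
      rw [LinearMap.rTensor_tmul, e4, bulletAntipode_left]
      simp
  rw [e1, Coalgebra.coassoc_apply, e2, ← Coalgebra.coassoc_apply, e3]
  simp

/-- `b · x = b₁ • (T(b₂) ⇀ x)`. -/
theorem mul_eq_bullet_act (b x : A) :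
    b * x = TensorProduct.lift (bullet k) (TensorProduct.map LinearMap.id
      ((act k).flip x ∘ₗ bulletAntipode k) (comul (R := k) b)) := by
  let R : A →ₗ[k] BulletAlg k A := (LinearMap.mul k A).flip x
  have h1 := mul_assoc (WithConv.toConv (LinearMap.id (R := k) (M := BulletAlg k A)))
    (WithConv.toConv (HopfAlgebra.antipode k (A := BulletAlg k A))) (WithConv.toConv R)
  rw [LinearMap.id_mul_antipode, one_mul] at h1
  have h2 := LinearMap.congr_fun (congrArg WithConv.ofConv h1) b
  refine h2.trans ?_
  have h3 : (act k).flip x ∘ₗ bulletAntipode k = TensorProduct.lift (bullet k) ∘ₗ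
      TensorProduct.map (bulletAntipode k) ((LinearMap.mul k A).flip x) ∘ₗ comul (R := k) := by
    ext b; exact (bulletAntipode_bullet_mul b x).symm
  rw [h3]
  rfl

end HopfBrace

/-! ### The quotient of a cocommutative Hopf brace by a normal sub-Hopf brace -/

namespace CocommHopf

open LinearMap

variable {k : Type*} {A : Type*} [Field k] [Ring A] [HopfAlgebra k A]

theorem counit_eq_zero_of_mem_augIdeal {K : Submodule k A} {x : A}
    (hx : x ∈ augIdeal k (K : Set A)) : counit (R := k) x = 0 :=
  counit_eq_zero_of_mem_mul_augKer (mem_top_mul_augKer_of_mem_augIdeal k hx)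

/-- If the left ideal `A K⁺` of a Hopf subalgebra `K` is two-sided, it is a Hopf ideal. -/
theorem augIdeal_isHopfIdeal {K : Submodule k A} (hK : IsHopfSub K)
    [hI : (augIdeal k (K : Set A)).IsTwoSided] : (augIdeal k (K : Set A)).IsHopfIdeal k where
  counit_eq_zero _ hx := counit_eq_zero_of_mem_augIdeal hx
  map_mkQ_comul_eq_zero x hx := by
    set I := augIdeal k (K : Set A)
    let Q := Algebra.TensorProduct.map (Ideal.Quotient.mkₐ k I) (Ideal.Quotient.mkₐ k I)
    change Q (comul (R := k) x) = 0
    have hq : ∀ y ∈ K, Ideal.Quotient.mkₐ k I y = counit (R := k) y • 1 := by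
      intro y hy
      have h := sub_counit_mem_augIdeal hK.one_mem hy
      have h2 : Ideal.Quotient.mkₐ k I (y - counit (R := k) y • (1 : A)) = 0 :=
        Ideal.Quotient.eq_zero_iff_mem.mpr h
      rwa [map_sub, map_smul, map_one, sub_eq_zero] at h2
    have hQ : ∀ y ∈ K, Q (comul (R := k) y) = counit (R := k) y • 1 := by
      intro y hy
      have e : Q (comul (R := k) y) = counit (R := k)
          (TensorProduct.lid k A ((counit (R := k)).rTensor A (comul (R := k) y))) • 1 := by
        refine range_map_induction (P := fun t => Q t = counit (R := k)
          (TensorProduct.lid k A ((counit (R := k)).rTensor A t)) • 1) (by simp)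
          (fun s t hs ht => by simp only [map_add, add_smul, hs, ht]) (fun a ha b hb => ?_)
          (hK.comul_mem hy)
        simp only [Q, Algebra.TensorProduct.map_tmul, hq a ha, hq b hb]
        simp [TensorProduct.smul_tmul', smul_smul, Algebra.TensorProduct.one_def, mul_comm]
      rw [e]; simp
    have h := mem_top_mul_augKer_of_mem_augIdeal k
      ((Submodule.restrictScalars_mem k _ x).mp hx)
    clear hx
    induction h using Submodule.mul_induction_on' with
    | mem_mul_mem a _ y hy =>
      have hy2 : counit (R := k) y = 0 := hy.2
      rw [Bialgebra.comul_mul, map_mul, hQ y hy.1, hy2, zero_smul, mul_zero]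
    | add a _ b _ ha hb => rw [map_add, map_add, ha, hb, add_zero]
  antipode_mem x hx := by
    have h := mem_top_mul_augKer_of_mem_augIdeal k hx
    clear hx
    induction h using Submodule.mul_induction_on' with
    | mem_mul_mem a _ y hy =>
      rw [HopfAlgebra.antipode_mul_antidistrib]
      refine hI.mul_mem_of_left _ (Ideal.subset_span ⟨hK.antipode_mem hy.1, ?_⟩)
      rw [HopfAlgebra.counit_antipode]
      exact hy.2
    | add a _ b _ ha hb => rw [map_add]; exact add_mem ha hb

end CocommHopf

namespace HopfBrace

open LinearMap

variable {k : Type v} {A : Type u} [Field k] [Ring A] [HopfBrace k A]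

/-- The Hopf brace structure induced on a quotient Hopf algebra `q : A → Q` whose kernel is an
ideal for `•` stable under `T`. The operations are defined through a linear section `s` of `q`. -/
noncomputable abbrev ofSurjective {Q : Type*} [Ring Q] [HopfAlgebra k Q] (q : A →ₐc[k] Q)
    (s : Q →ₗ[k] A) (hs : ∀ x, q (s x) = x)
    (hl : ∀ a b b', q b = q b' → q (bullet k a b) = q (bullet k a b'))
    (hr : ∀ a a' b, q a = q a' → q (bullet k a b) = q (bullet k a' b))
    (hT : ∀ a a', q a = q a' → q (bulletAntipode k a) = q (bulletAntipode k a'))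
    (hS : ∀ a, q (HopfAlgebra.antipode k a) = HopfAlgebra.antipode k (q a)) : HopfBrace k Q :=
  let ql : A →ₗ[k] Q := (q : A →ₐ[k] Q).toLinearMap
  let bu : Q →ₗ[k] Q →ₗ[k] Q := ((bullet k).compl₁₂ s s).compr₂ ql
  let T : Q →ₗ[k] Q := ql ∘ₗ bulletAntipode k ∘ₗ s
  have hsurj : Function.Surjective q := fun x => ⟨s x, hs x⟩
  have hbu : ∀ a b, bu (q a) (q b) = q (bullet k a b) := fun a b =>
    (hl _ _ _ (hs (q b))).trans (hr _ _ _ (hs (q a)))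
  have hTq : ∀ a, T (q a) = q (bulletAntipode k a) := fun a => hT _ _ (hs (q a))
  have hΔ : ∀ a, comul (R := k) (q a) = TensorProduct.map ql ql (comul (R := k) a) := fun a =>
    (LinearMap.congr_fun q.map_comp_comul a).symm
  have hε : ∀ a, counit (R := k) (q a) = counit (R := k) a := fun a =>
    LinearMap.congr_fun q.counit_comp a
  have hql : ∀ a, ql a = q a := fun _ => rfl
  { bullet := bu
    bulletAntipode := T
    bullet_assoc := by
      intro a b c
      obtain ⟨a, rfl⟩ := hsurj a
      obtain ⟨b, rfl⟩ := hsurj b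
      obtain ⟨c, rfl⟩ := hsurj c
      rw [hbu, hbu, hbu, hbu, bullet_assoc]
    one_bullet := by
      intro a
      obtain ⟨a, rfl⟩ := hsurj a
      rw [← map_one q, hbu, one_bullet]
    bullet_one := by
      intro a
      obtain ⟨a, rfl⟩ := hsurj a
      rw [← map_one q, hbu, bullet_one]
    counit_bullet := by
      intro a b
      obtain ⟨a, rfl⟩ := hsurj a
      obtain ⟨b, rfl⟩ := hsurj b
      rw [hbu, hε, hε, hε, counit_bullet]
    comul_bullet := by
      intro a b
      obtain ⟨a, rfl⟩ := hsurj a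
      obtain ⟨b, rfl⟩ := hsurj b
      rw [hbu, hΔ, hΔ, hΔ, comul_bullet]
      generalize comul (R := k) a = s
      generalize comul (R := k) b = t
      induction s with
      | zero => simp
      | add x y hx hy => simp only [map_add, LinearMap.add_apply, hx, hy]
      | tmul x y =>
        induction t with
        | zero => simp
        | add x y hx hy => simp only [map_add, hx, hy]
        | tmul z w => simp only [TensorProduct.map₂_apply_tmul, TensorProduct.map_tmul, hql, hbu]
    bulletAntipode_left := by
      intro a
      obtain ⟨a, rfl⟩ := hsurj a
      have e : ∀ t : A ⊗[k] A, TensorProduct.lift bu (TensorProduct.map T LinearMap.id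
          (TensorProduct.map ql ql t)) = q (TensorProduct.lift (bullet k)
            (TensorProduct.map (bulletAntipode k) LinearMap.id t)) := by
        intro t
        induction t with
        | zero => simp
        | add x y hx hy => simp only [map_add, hx, hy]
        | tmul x y =>
          simp only [TensorProduct.map_tmul, hql, hTq, LinearMap.id_apply, TensorProduct.lift.tmul,
            hbu]
      rw [hΔ, e, bulletAntipode_left, hε, map_smul, map_one]
    bulletAntipode_right := by
      intro a
      obtain ⟨a, rfl⟩ := hsurj a
      have e : ∀ t : A ⊗[k] A, TensorProduct.lift bu (TensorProduct.map LinearMap.id T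
          (TensorProduct.map ql ql t)) = q (TensorProduct.lift (bullet k)
            (TensorProduct.map LinearMap.id (bulletAntipode k) t)) := by
        intro t
        induction t with
        | zero => simp
        | add x y hx hy => simp only [map_add, hx, hy]
        | tmul x y =>
          simp only [TensorProduct.map_tmul, hql, hTq, LinearMap.id_apply, TensorProduct.lift.tmul,
            hbu]
      rw [hΔ, e, bulletAntipode_right, hε, map_smul, map_one]
    bullet_mul := by
      intro a b c
      obtain ⟨a, rfl⟩ := hsurj a
      obtain ⟨b, rfl⟩ := hsurj b
      obtain ⟨c, rfl⟩ := hsurj c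
      have e1 : ∀ t : A ⊗[k] A, LinearMap.mul' k Q (TensorProduct.map (HopfAlgebra.antipode k)
          (bu.flip (q c)) (TensorProduct.map ql ql t)) = q (LinearMap.mul' k A
            (TensorProduct.map (HopfAlgebra.antipode k) ((bullet k).flip c) t)) := by
        intro t
        induction t with
        | zero => simp
        | add x y hx hy => simp only [map_add, hx, hy]
        | tmul x y =>
          simp only [TensorProduct.map_tmul, hql, LinearMap.flip_apply, LinearMap.mul'_apply, hbu,
            map_mul, hS]
      have e2 : ∀ t : A ⊗[k] A, LinearMap.mul' k Q (TensorProduct.map (bu.flip (q b))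
          (LinearMap.mul' k Q ∘ₗ TensorProduct.map (HopfAlgebra.antipode k) (bu.flip (q c))
            ∘ₗ comul (R := k)) (TensorProduct.map ql ql t)) = q (LinearMap.mul' k A
            (TensorProduct.map ((bullet k).flip b) (LinearMap.mul' k A ∘ₗ
              TensorProduct.map (HopfAlgebra.antipode k) ((bullet k).flip c)
                ∘ₗ comul (R := k)) t)) := by
        intro t
        induction t with
        | zero => simp
        | add x y hx hy => simp only [map_add, hx, hy]
        | tmul x y =>
          simp only [TensorProduct.map_tmul, hql, LinearMap.flip_apply, LinearMap.mul'_apply, hbu,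
            map_mul, LinearMap.comp_apply, hΔ, e1]
      rw [← map_mul, hbu, bullet_mul, hΔ, e2] }

end HopfBrace

namespace SubHopfBrace

open CocommHopf LinearMap HopfBrace

variable {k : Type v} {A : Type u} [Field k] [Ring A] [HopfBrace k A]

/-- The underlying subspace of a sub-Hopf brace. -/
abbrev toSubm (K : SubHopfBrace k A) : Submodule k A := Subalgebra.toSubmodule K.toSubalgebra

theorem isHopfSub (K : SubHopfBrace k A) : IsHopfSub K.toSubm where
  one_mem := K.toSubalgebra.one_mem
  mul_mem := K.toSubalgebra.mul_mem
  comul_mem := K.comul_mem'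
  antipode_mem := K.antipode_mem'

/-- The same sub-Hopf brace, as a Hopf subalgebra for `•`. -/
def toBulletSubm (K : SubHopfBrace k A) : Submodule k (BulletAlg k A) := K.toSubm

theorem isHopfSub_bullet (K : SubHopfBrace k A) : IsHopfSub K.toBulletSubm where
  one_mem := K.toSubalgebra.one_mem
  mul_mem := K.bullet_mem'
  comul_mem := K.comul_mem'
  antipode_mem := K.bulletAntipode_mem'

/-- The ideal `A · K⁺`. -/
noncomputable abbrev ideal (K : SubHopfBrace k A) : Ideal A := augIdeal k (K.toSubm : Set A)

/-- The ideal `A • K⁺` for the second multiplication. -/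
noncomputable abbrev bulletIdeal (K : SubHopfBrace k A) : Ideal (BulletAlg k A) :=
  augIdeal k (K.toBulletSubm : Set (BulletAlg k A))

variable {K : SubHopfBrace k A}

theorem act_mem_augmentation (hK : K.IsNormal) (a : A) {x : A} (hx : x ∈ K)
    (hε : counit (R := k) x = 0) :
    act k a x ∈ K.toSubm ∧ counit (R := k) (act k a x) = 0 :=
  ⟨hK.act_mem a x hx, by rw [counit_act, hε, mul_zero]⟩

/-- `a • (b · x) = (a₁ • b) · (a₂ ⇀ x)`, and `K⁺` is stable under `⇀`. -/
theorem bullet_mem_ideal (hK : K.IsNormal) (a : A) {z : A} (hz : z ∈ K.ideal) :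
    bullet k a z ∈ K.ideal := by
  refine augIdeal_induction (P := fun z => bullet k a z ∈ K.ideal) (fun b x hx hε => ?_)
    (fun b c hb hc => by rw [map_add]; exact add_mem hb hc) hz
  rw [bullet_mul_act]
  exact mul'_map_mem _ _ _ (fun y => Ideal.subset_span (act_mem_augmentation hK y hx hε)) _

theorem mem_ideal_of_mem_bulletIdeal (hK : K.IsNormal) {z : BulletAlg k A}
    (hz : z ∈ K.bulletIdeal) : (show A from z) ∈ K.ideal :=
  augIdeal_induction (A := BulletAlg k A) (K := K.toBulletSubm)
    (P := fun z => (show A from z) ∈ K.ideal)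
    (fun b _ hx hε => bullet_mem_ideal hK b (Ideal.subset_span ⟨hx, hε⟩))
    (fun _ _ hb hc => Submodule.add_mem K.ideal hb hc) hz

variable [IsCocomm k A]

/-- `b · x = b₁ • (T(b₂) ⇀ x)`, and `K⁺` is stable under `⇀`. -/
theorem mem_bulletIdeal_of_mem_ideal (hK : K.IsNormal) {z : A}
    (hz : z ∈ K.ideal) : (show BulletAlg k A from z) ∈ K.bulletIdeal := by
  refine augIdeal_induction (K := K.toSubm)
    (P := fun z => (show BulletAlg k A from z) ∈ K.bulletIdeal) (fun b x hx hε => ?_)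
    (fun _ _ hb hc => Submodule.add_mem K.bulletIdeal hb hc) hz
  have h := mul'_map_mem (k := k) (H := BulletAlg k A) K.bulletIdeal LinearMap.id
    ((act k (A := A)).flip x ∘ₗ bulletAntipode k (A := A))
    (fun y => Ideal.subset_span
      (act_mem_augmentation hK (bulletAntipode k (A := A) y) hx hε)) (comul (R := k) (A := A) b)
  have e : (show BulletAlg k A from b * x) = LinearMap.mul' k (BulletAlg k A)
      (TensorProduct.map LinearMap.id ((act k (A := A)).flip x ∘ₗ bulletAntipode k (A := A))
        (comul (R := k) (A := A) b)) := mul_eq_bullet_act (k := k) b x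
  rw [e]
  exact h

theorem ideal_isTwoSided (hK : K.IsNormal) : K.ideal.IsTwoSided := augIdeal_isTwoSided hK.conj_mem

theorem bulletIdeal_isTwoSided (hK : K.IsNormal) : K.bulletIdeal.IsTwoSided :=
  augIdeal_isTwoSided (H := BulletAlg k A) hK.bulletConj_mem

theorem isCocomm_of_surjective {Q : Type*} [AddCommGroup Q] [Module k Q] [Coalgebra k Q]
    (q : A →ₗc[k] Q) (hq : Function.Surjective q) : IsCocomm k Q where
  comm_comp_comul := by
    ext x
    obtain ⟨a, rfl⟩ := hq x
    have h : comul (R := k) (q a) = TensorProduct.map q.toLinearMap q.toLinearMap (comul a) :=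
      (LinearMap.congr_fun q.map_comp_comul a).symm
    have e : ∀ t : A ⊗[k] A, TensorProduct.comm k Q Q
        (TensorProduct.map q.toLinearMap q.toLinearMap t)
        = TensorProduct.map q.toLinearMap q.toLinearMap (TensorProduct.comm k A A t) := by
      intro t
      induction t with
      | zero => simp
      | add x y hx hy => simp only [map_add, hx, hy]
      | tmul x y => simp
    simp only [LinearMap.comp_apply, LinearEquiv.coe_coe]
    rw [h, e]
    congr 1
    exact LinearMap.congr_fun (comm_comp_comul k A) a

/-- For a normal sub-Hopf brace `K` of a cocommutative Hopf brace `A`, the ideals `A · K⁺` and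
`A • K⁺` coincide, and the quotient by them is a cocommutative Hopf brace. -/
theorem exists_quotient (hK : K.IsNormal) :
    ∃ (Q : Type u) (_ : Ring Q) (_ : HopfBrace k Q) (_ : IsCocomm k Q) (q : HopfBraceHom k A Q),
      Function.Surjective q ∧ ∀ a, q a = 0 ↔ a ∈ K.ideal := by
  have h1 := ideal_isTwoSided hK
  have h2 := bulletIdeal_isTwoSided hK
  have h3 : K.ideal.IsHopfIdeal k := augIdeal_isHopfIdeal K.isHopfSub
  have h4 : K.bulletIdeal.IsHopfIdeal k := augIdeal_isHopfIdeal K.isHopfSub_bullet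
  let q : A →ₐc[k] A ⧸ K.ideal := Bialgebra.Quotient.mkBialgHom K.ideal
  have hqsurj : Function.Surjective q := Ideal.Quotient.mk_surjective
  obtain ⟨s, hs⟩ := (q : A →ₐ[k] A ⧸ K.ideal).toLinearMap.exists_rightInverse_of_surjective
    (LinearMap.range_eq_top.mpr hqsurj)
  have hs' : ∀ x, q (s x) = x := fun x => LinearMap.congr_fun hs x
  have hq : ∀ a b, q a = q b ↔ a - b ∈ K.ideal := fun a b =>
    Ideal.Quotient.mk_eq_mk_iff_sub_mem a b
  have hl : ∀ a b b', q b = q b' → q (bullet k a b) = q (bullet k a b') := fun a b b' h => by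
      rw [hq] at h ⊢
      rw [← map_sub]
      exact bullet_mem_ideal hK a h
  have hr : ∀ a a' b, q a = q a' → q (bullet k a b) = q (bullet k a' b) := fun a a' b h => by
      rw [hq] at h ⊢
      rw [← LinearMap.map_sub₂]
      exact mem_ideal_of_mem_bulletIdeal hK
        (h2.mul_mem_of_left (show BulletAlg k A from b) (mem_bulletIdeal_of_mem_ideal hK h))
  have hT : ∀ a a', q a = q a' → q (bulletAntipode k a) = q (bulletAntipode k a') :=
    fun a a' h => by
      rw [hq] at h ⊢
      rw [← map_sub]
      exact mem_ideal_of_mem_bulletIdeal hK (h4.antipode_mem (mem_bulletIdeal_of_mem_ideal hK h))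
  let inst : HopfBrace k (A ⧸ K.ideal) := HopfBrace.ofSurjective q s hs' hl hr hT (fun _ => rfl)
  let q' : HopfBraceHom k A (A ⧸ K.ideal) :=
    { q with map_bullet' := fun a b => ((hl _ _ _ (hs' (q b))).trans (hr _ _ _ (hs' (q a)))).symm }
  refine ⟨A ⧸ K.ideal, inferInstance, inst, ?_, q', hqsurj, fun a => Ideal.Quotient.eq_zero_iff_mem⟩
  exact isCocomm_of_surjective (q'.toBialgHom : A →ₗc[k] A ⧸ K.ideal) hqsurj

end SubHopfBrace

/-! ### Commutators under morphisms -/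

namespace CocommHopf

open WithConv LinearMap

variable {k : Type*} {C D A H : Type*} [Field k]
  [AddCommGroup C] [Module k C] [Coalgebra k C] [AddCommGroup D] [Module k D] [Coalgebra k D]
  [Ring A] [HopfAlgebra k A] [Ring H] [HopfAlgebra k H]

theorem map_hopfCommutator (q : A →ₗ[k] H) (hmul : ∀ a b, q (a * b) = q a * q b)
    (hcomul : ∀ a, TensorProduct.map q q (comul (R := k) a) = comul (R := k) (q a))
    (hanti : ∀ a, q (HopfAlgebra.antipode k a) = HopfAlgebra.antipode k (q a)) (x y : A) :
    q (hopfCommutator (k := k) x y) = hopfCommutator (k := k) (q x) (q y) := by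
  rw [hopfCommutator, hopfCommutator, ← hcomul, ← hcomul]
  generalize comul (R := k) x = s
  generalize comul (R := k) y = t
  induction s with
  | zero => simp
  | add a b ha hb => simp only [map_add, LinearMap.add_apply, ha, hb]
  | tmul a b =>
    induction t with
    | zero => simp
    | add c d hc hd => simp only [map_add, hc, hd]
    | tmul c d => simp [hmul, hanti]

theorem counit_hopfCommutator [IsCocomm k A] (x y : A) :
    counit (R := k) (hopfCommutator (k := k) x y) = counit (R := k) x * counit (R := k) y := by
  have h := LinearMap.congr_fun
    (hopfCommutatorHom (CoalgHom.id k A) (CoalgHom.id k A)).counit_comp (x ⊗ₜ[k] y)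
  refine ((congrArg (counit (R := k)) (hopfCommutatorHom_tmul _ _ x y)).symm.trans h).trans ?_
  simp [mul_comm]

theorem conv_comp_prRight (F : C ⊗[k] D →ₗ[k] H) (g : D →ₗ[k] H) (x : C) (y : D) :
    (toConv F * toConv (g ∘ₗ (prRight k C D).toLinearMap)) (x ⊗ₜ[k] y)
      = LinearMap.mul' k H (TensorProduct.map (F ∘ₗ TensorProduct.mk k C D x) g
          (comul (R := k) y)) := by
  rw [conv_tmul]
  generalize comul (R := k) y = t
  have e : ∀ s : C ⊗[k] C, LinearMap.mul' k H (TensorProduct.map F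
      (g ∘ₗ (prRight k C D).toLinearMap)
      (TensorProduct.tensorTensorTensorComm k C C D D (s ⊗ₜ t)))
      = LinearMap.mul' k H (TensorProduct.map (F ∘ₗ TensorProduct.mk k C D
        (TensorProduct.rid k C ((counit (R := k)).lTensor C s))) g t) := by
    intro s
    induction t with
    | zero => simp
    | add a b ha hb => simp only [map_add, TensorProduct.tmul_add, ha, hb]
    | tmul c d =>
      induction s with
      | zero => simp
      | add a b ha hb =>
        rw [TensorProduct.add_tmul, map_add, map_add, map_add, ha, hb]
        simp [TensorProduct.add_tmul]
      | tmul a b => simp [prRight_tmul, TensorProduct.smul_tmul]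
  rw [e]
  simp

/-- If `q ∘ φ` is trivial for `q : A → A/AK⁺`, then `c = φ(t)` satisfies
`c₁ ⊗ q(c₂) = φ(t₁) ⊗ q(φ(t₂)) = c ⊗ 1`. -/
theorem mem_coinvariants_of_comp [IsCocomm k A] {K : Submodule k A} (φ : C →ₗc[k] A)
    (h : ∀ t, φ t - counit (R := k) t • (1 : A) ∈ augIdeal k (K : Set A)) (t : C) :
    φ t ∈ coinvariants k K := by
  intro ψ
  have h1 : comul (R := k) (φ t) = TensorProduct.map φ.toLinearMap φ.toLinearMap (comul t) :=
    (LinearMap.congr_fun φ.map_comp_comul t).symm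
  rw [smul_eq_hit, hit_apply, h1]
  have e : ∀ s : C ⊗[k] C, TensorProduct.rid k A (ψ.toLin.lTensor A
      (TensorProduct.map φ.toLinearMap φ.toLinearMap s))
      - ψ.toLin (φ (TensorProduct.lid k C ((counit (R := k)).rTensor C s))) • (1 : A)
      ∈ augIdeal k (K : Set A) := by
    intro s
    induction s with
    | zero => simp
    | add a b ha hb =>
      simp only [map_add, add_smul, add_sub_add_comm]
      exact add_mem ha hb
    | tmul a b =>
      have h2 := ((augIdeal k (K : Set A)).restrictScalars k).smul_mem (ψ.toLin (φ b)) (h a)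
      simp only [smul_sub, smul_smul] at h2
      simpa [smul_smul, mul_comm] using h2
  simpa using e (comul t)

end CocommHopf

namespace HopfBrace

open CocommHopf LinearMap WithConv

variable {k : Type v} {A : Type u} [Field k] [Ring A] [HopfBrace k A]

theorem counit_dotCommutator [IsCocomm k A] (x y : A) :
    counit (R := k) (dotCommutator k x y) = counit (R := k) x * counit (R := k) y :=
  counit_hopfCommutator x y

theorem counit_bulletCommutator [IsCocomm k A] (x y : A) :
    counit (R := k) (bulletCommutator k x y) = counit (R := k) x * counit (R := k) y :=
  counit_hopfCommutator (A := BulletAlg k A) x y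

variable (k A) in
/-- The multiplication `•` as a morphism of coalgebras. -/
noncomputable def bulletCoalgHom : A ⊗[k] A →ₗc[k] A where
  __ := TensorProduct.lift (bullet k)
  counit_comp := (Bialgebra.mulCoalgHom k (BulletAlg k A)).counit_comp
  map_comp_comul := (Bialgebra.mulCoalgHom k (BulletAlg k A)).map_comp_comul

theorem bulletCoalgHom_tmul (x y : A) : bulletCoalgHom k A (x ⊗ₜ y) = bullet k x y := rfl

variable [IsCocomm k A]

variable (k A) in
/-- The action `⇀` of a cocommutative Hopf brace as a morphism of coalgebras. -/
noncomputable def actCoalgHom : A ⊗[k] A →ₗc[k] A :=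
  convHom ((antipodeCoalgHom k A).comp (prLeft k A A)) (bulletCoalgHom k A)

theorem actCoalgHom_tmul (x y : A) : actCoalgHom k A (x ⊗ₜ y) = act k x y := by
  have h := toConv_convHom ((antipodeCoalgHom k A).comp (prLeft k A A)) (bulletCoalgHom k A)
  have h1 := congrArg (fun w : WithConv (A ⊗[k] A →ₗ[k] A) => w (x ⊗ₜ[k] y)) h
  refine h1.trans ?_
  have h2 := conv_prLeft_comp (HopfAlgebra.antipode k) (bulletCoalgHom k A).toLinearMap x y
  refine Eq.trans ?_ (h2.trans ?_)
  · rfl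
  have e : (bulletCoalgHom k A).toLinearMap ∘ₗ (TensorProduct.mk k A A).flip y
      = (bullet k).flip y := by
    ext x; exact bulletCoalgHom_tmul x y
  rw [e, act_apply]

variable (k A) in
/-- `x ⊗ y ↦ (x ⇀ y₁) · S(y₂)` as a morphism of coalgebras. -/
noncomputable def starCommutatorHom : A ⊗[k] A →ₗc[k] A :=
  convHom (actCoalgHom k A) ((antipodeCoalgHom k A).comp (prRight k A A))

theorem starCommutatorHom_tmul (x y : A) :
    starCommutatorHom k A (x ⊗ₜ y) = starCommutator k x y := by
  refine (conv_comp_prRight (actCoalgHom k A).toLinearMap (HopfAlgebra.antipode k) x y).trans ?_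
  have e : (actCoalgHom k A).toLinearMap ∘ₗ TensorProduct.mk k A A x = act k x := by
    ext y; exact actCoalgHom_tmul x y
  rw [e]; rfl

theorem counit_starCommutator (x y : A) :
    counit (R := k) (starCommutator k x y) = counit (R := k) x * counit (R := k) y := by
  have h := LinearMap.congr_fun (starCommutatorHom k A).counit_comp (x ⊗ₜ[k] y)
  refine ((congrArg (counit (R := k)) (starCommutatorHom_tmul x y)).symm.trans h).trans ?_
  simp [mul_comm]

end HopfBrace

namespace HopfBraceHom

open HopfBrace CocommHopf

variable {k : Type v} {A B : Type*} [Field k] [Ring A] [Ring B] [HopfBrace k A] [HopfBrace k B]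
  (f : HopfBraceHom k A B)

theorem map_dotCommutator (x y : A) :
    f (dotCommutator k x y) = dotCommutator k (f x) (f y) :=
  map_hopfCommutator f.lin (fun a b => map_mul f.toBialgHom a b) f.lin_comul f.map_antipode x y

theorem map_bulletCommutator (x y : A) :
    f (bulletCommutator k x y) = bulletCommutator k (f x) (f y) :=
  map_hopfCommutator (A := BulletAlg k A) (H := BulletAlg k B) f.lin f.map_bullet f.lin_comul
    f.map_bulletAntipode x y

theorem map_act (x y : A) : f (act k x y) = act k (f x) (f y) := by
  rw [act_apply, act_apply, ← f.lin_comul]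
  generalize comul (R := k) x = s
  induction s with
  | zero => simp
  | add a b ha hb => simp only [map_add, ha, hb]
  | tmul a b => simp [lin_apply, map_bullet, map_antipode]

theorem map_starCommutator (x y : A) :
    f (starCommutator k x y) = starCommutator k (f x) (f y) := by
  rw [starCommutator, starCommutator, ← f.lin_comul]
  generalize comul (R := k) y = s
  induction s with
  | zero => simp
  | add a b ha hb => simp only [map_add, ha, hb]
  | tmul a b => simp [lin_apply, map_act, map_antipode]

/-- A linear map preserving all the operations, as a morphism of Hopf braces. -/
def ofLinearMap (f : A →ₗ[k] B) (h1 : f 1 = 1) (hmul : ∀ a b, f (a * b) = f a * f b)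
    (hbullet : ∀ a b, f (bullet k a b) = bullet k (f a) (f b))
    (hcounit : ∀ a, counit (R := k) (f a) = counit (R := k) a)
    (hcomul : ∀ a, TensorProduct.map f f (comul (R := k) a) = comul (R := k) (f a)) :
    HopfBraceHom k A B where
  __ := f
  map_one' := h1
  map_mul' := hmul
  map_bullet' := hbullet
  counit_comp := LinearMap.ext hcounit
  map_comp_comul := LinearMap.ext hcomul

end HopfBraceHom

namespace HopfBrace

open CocommHopf LinearMap WithConv

variable {k : Type v} {A C D : Type*} [Field k] [Ring A] [HopfBrace k A]
  [AddCommGroup C] [Module k C] [Coalgebra k C] [AddCommGroup D] [Module k D] [Coalgebra k D]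

/-- The elements `(a ⇀ y₁) · S(y₂)` are trivial iff `a ⇀ y` is: one passes from `y ↦ a ⇀ y` to them
by convolving with the inverse of the coalgebra morphism `g`. The scalar `r` plays the role of
`ε(a)`. -/
theorem starCommutator_eq_counit_iff (a : A) (r : k) (g : D →ₗc[k] A) :
    (∀ y, starCommutator k a (g y) = (r * counit (R := k) y) • (1 : A)) ↔
      ∀ y, act k a (g y) = r • g y := by
  set F := toConv (act k a ∘ₗ g.toLinearMap) with hF
  set v := toConv g.toLinearMap with hv
  set v' := toConv (HopfAlgebra.antipode k ∘ₗ g.toLinearMap) with hv'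
  have hvv : v * v' = 1 := mul_antipode_comp g
  have hvv' : v' * v = 1 := antipode_comp_mul g
  have hstar : ∀ y, (F * v') y = starCommutator k a (g y) := by
    intro y
    have h : comul (R := k) (g y) = TensorProduct.map g.toLinearMap g.toLinearMap (comul y) :=
      (LinearMap.congr_fun g.map_comp_comul y).symm
    rw [starCommutator, h, TensorProduct.map_map]
    rfl
  have h1 : (∀ y, starCommutator k a (g y) = (r * counit (R := k) y) • (1 : A)) ↔
      F * v' = r • 1 := by
    constructor
    · intro h
      apply WithConv.ext
      ext y
      refine (hstar y).trans ((h y).trans ?_)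
      simp [LinearMap.convOne_def, Algebra.algebraMap_eq_smul_one, smul_smul]
    · intro h y
      rw [← hstar]
      refine (congrArg (fun w : WithConv (D →ₗ[k] A) => w y) h).trans ?_
      simp [LinearMap.convOne_def, Algebra.algebraMap_eq_smul_one, smul_smul]
  have h2 : (∀ y, act k a (g y) = r • g y) ↔ F = r • v :=
    ⟨fun h => WithConv.ext (LinearMap.ext h),
      fun h y => congrArg (fun w : WithConv (D →ₗ[k] A) => w y) h⟩
  rw [h1, h2]
  constructor
  · intro h
    rw [← mul_one F, ← hvv', ← mul_assoc, h, smul_mul_assoc, one_mul]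
  · intro h
    rw [h, smul_mul_assoc, hvv]

/-- The image of a coalgebra acts trivially on `b` iff `•` and `·` by `b` agree on it, because
`a • b = a₁ · (a₂ ⇀ b)` and `a ⇀ b = S(a₁) · (a₂ • b)`. -/
theorem act_eq_counit_iff (f : C →ₗc[k] A) (b : A) :
    (∀ x, act k (f x) b = counit (R := k) x • b) ↔ ∀ x, bullet k (f x) b = f x * b := by
  have hΔ : ∀ x, comul (R := k) (f x) = TensorProduct.map f.toLinearMap f.toLinearMap (comul x) :=
    fun x => (LinearMap.congr_fun f.map_comp_comul x).symm
  constructor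
  · intro h x
    have e : ∀ s : C ⊗[k] C, LinearMap.mul' k A (TensorProduct.map LinearMap.id ((act k).flip b)
        (TensorProduct.map f.toLinearMap f.toLinearMap s))
        = f (TensorProduct.rid k C ((counit (R := k)).lTensor C s)) * b := by
      intro s
      induction s with
      | zero => simp
      | add x y hx hy => simp only [map_add, add_mul, hx, hy]
      | tmul x y => simp [h]
    rw [bullet_eq_mul_act, hΔ, e]; simp
  · intro h x
    have e : ∀ s : C ⊗[k] C, LinearMap.mul' k A (TensorProduct.map (HopfAlgebra.antipode k)
        ((bullet k).flip b) (TensorProduct.map f.toLinearMap f.toLinearMap s))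
        = LinearMap.mul' k A ((HopfAlgebra.antipode k).rTensor A
          (TensorProduct.map f.toLinearMap f.toLinearMap s)) * b := by
      intro s
      induction s with
      | zero => simp
      | add x y hx hy => simp only [map_add, add_mul, hx, hy]
      | tmul x y => simp [h, mul_assoc]
    rw [act_apply, hΔ, e, ← hΔ, HopfAlgebra.mul_antipode_rTensor_comul_apply]
    have : counit (R := k) (f x) = counit (R := k) x := LinearMap.congr_fun f.counit_comp x
    rw [this, Algebra.algebraMap_eq_smul_one, smul_mul_assoc, one_mul]

end HopfBrace

/-! ### Cokernels and Huq commutators -/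

namespace HopfBraceHom

open HopfBrace

/-- Two morphisms into `A` whose values commute for both multiplications, and on whose values
these multiplications agree, induce a morphism on the tensor product. -/
noncomputable def liftOfCommute {k : Type v} {A B C : Type*} [Field k] [Ring A] [HopfBrace k A]
    [Ring B] [HopfBrace k B] [Ring C] [HopfBrace k C] (i : HopfBraceHom k B A)
    (j : HopfBraceHom k C A)
    (h : ∀ b c, i b * j c = j c * i b ∧ bullet k (i b) (j c) = i b * j c ∧
      bullet k (i b) (j c) = bullet k (j c) (i b)) : HopfBraceHom k (B ⊗[k] C) A :=
  ofLinearMap (LinearMap.mul' k A ∘ₗ TensorProduct.map i.lin j.lin)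
    (by simp [Algebra.TensorProduct.one_def, lin_apply])
    (fun s t => by
      induction s with
      | zero => simp
      | add a b ha hb => simp only [add_mul, map_add, ha, hb]
      | tmul x y =>
        induction t with
        | zero => simp
        | add a b ha hb => simp only [mul_add, map_add, ha, hb]
        | tmul x' y' =>
          simp only [Algebra.TensorProduct.tmul_mul_tmul, LinearMap.comp_apply,
            TensorProduct.map_tmul, LinearMap.mul'_apply, lin_apply, map_mul]
          rw [mul_assoc, mul_assoc, ← mul_assoc (i x'), (h x' y).1, mul_assoc])
    (fun s t => by
      induction s with
      | zero => simp
      | add a b ha hb => simp only [map_add, LinearMap.add_apply, ha, hb]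
      | tmul x y =>
        induction t with
        | zero => simp
        | add a b ha hb => simp only [map_add, ha, hb]
        | tmul x' y' =>
          change i (bullet k x x') * j (bullet k y y') = bullet k (i x * j y) (i x' * j y')
          rw [← (h _ _).2.1, ← (h _ _).2.1, ← (h _ _).2.1, i.map_bullet, j.map_bullet,
            bullet_assoc, bullet_assoc, ← bullet_assoc (i x'), (h x' y).2.2, bullet_assoc])
    (fun s => by
      induction s with
      | zero => simp
      | add a b ha hb => simp only [map_add, ha, hb]
      | tmul x y => simp [lin_apply, mul_comm])
    (fun s => by
      induction s with
      | zero => simp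
      | add a b ha hb => simp only [map_add, ha, hb]
      | tmul x y =>
        rw [comul_tmul', LinearMap.comp_apply, TensorProduct.map_tmul, LinearMap.mul'_apply,
          Bialgebra.comul_mul, lin_apply, lin_apply, ← i.lin_comul, ← j.lin_comul]
        generalize comul (R := k) x = s
        generalize comul (R := k) y = t
        induction s with
        | zero => simp
        | add a b ha hb => simp only [map_add, TensorProduct.add_tmul, add_mul, ha, hb]
        | tmul a b =>
          induction t with
          | zero => simp
          | add c d hc hd => simp only [map_add, TensorProduct.tmul_add, mul_add, hc, hd]
          | tmul c d => simp)

end HopfBraceHom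

namespace SubHopfBrace

open CocommHopf LinearMap HopfBrace

variable {k : Type v} {A : Type u} [Field k] [Ring A] [HopfBrace k A]

/-- The inclusion of a sub-Hopf brace as a morphism of Hopf braces. -/
noncomputable def inclBrace (X : SubHopfBrace k A) : HopfBraceHom k X.Carrier A :=
  HopfBraceHom.ofLinearMap X.incl rfl (fun _ _ => rfl) (fun _ _ => rfl) (fun _ => rfl)
    X.map_incl_comul

/-- The inclusion of a sub-Hopf brace as a morphism of coalgebras. -/
noncomputable def inclHom (X : SubHopfBrace k A) : X.Carrier →ₗc[k] A where
  __ := X.incl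
  counit_comp := rfl
  map_comp_comul := LinearMap.ext X.map_incl_comul

instance instIsCocomm [IsCocomm k A] (X : SubHopfBrace k A) : IsCocomm k X.Carrier where
  comm_comp_comul := by
    ext x
    apply X.map_incl_injective
    have e : ∀ t : X.Carrier ⊗[k] X.Carrier,
        TensorProduct.map X.incl X.incl (TensorProduct.comm k _ _ t)
        = TensorProduct.comm k A A (TensorProduct.map X.incl X.incl t) := by
      intro t
      induction t with
      | zero => simp
      | add x y hx hy => simp only [map_add, hx, hy]
      | tmul x y => simp
    simp only [LinearMap.comp_apply, LinearEquiv.coe_coe]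
    rw [e, X.map_incl_comul]
    exact LinearMap.congr_fun (comm_comp_comul k A) (x : A)

/-- A surjective morphism with kernel `A · K⁺` is a cokernel of the inclusion of `K`. -/
theorem isCokernel_of_surjective {K : SubHopfBrace k A} {Q : Type u} [Ring Q] [HopfBrace k Q]
    (q : HopfBraceHom k A Q) (hsurj : Function.Surjective q) (hker : ∀ a, q a = 0 ↔ a ∈ K.ideal) :
    K.IsCokernel q := by
  have hK : ∀ x ∈ K, q x = counit (R := k) x • (1 : Q) := by
    intro x hx
    have h := (hker _).mpr (sub_counit_mem_augIdeal (K := K.toSubm) K.isHopfSub.one_mem hx)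
    rwa [map_sub, map_smul, map_one, sub_eq_zero] at h
  refine ⟨hK, fun C _ _ _ h hh => ?_⟩
  have hideal : ∀ a ∈ K.ideal, h a = 0 := by
    intro a ha
    refine augIdeal_induction (P := fun a => h a = 0) (fun a x hx hε => ?_) (fun a b ha hb => ?_) ha
    · rw [map_mul, hh x hx, hε, zero_smul, mul_zero]
    · rw [map_add, ha, hb, add_zero]
  obtain ⟨s, hs⟩ := q.lin.exists_rightInverse_of_surjective (LinearMap.range_eq_top.mpr hsurj)
  have hg : ∀ a, h (s (q a)) = h a := by
    intro a
    rw [← sub_eq_zero, ← map_sub]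
    apply hideal
    rw [← hker, map_sub, sub_eq_zero]
    exact LinearMap.congr_fun hs (q a)
  let g : Q →ₗ[k] C := h.lin ∘ₗ s
  have hg : ∀ a, g (q a) = h a := hg
  have hcomp : g ∘ₗ q.lin = h.lin := LinearMap.ext hg
  refine ⟨HopfBraceHom.ofLinearMap g ?_ ?_ ?_ ?_ ?_, hg, ?_⟩
  · rw [← map_one q.toBialgHom, hg, map_one]
  · intro x y
    obtain ⟨a, rfl⟩ := hsurj x
    obtain ⟨b, rfl⟩ := hsurj y
    rw [← map_mul, hg, hg, hg, map_mul]
  · intro x y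
    obtain ⟨a, rfl⟩ := hsurj x
    obtain ⟨b, rfl⟩ := hsurj y
    rw [← q.map_bullet, hg, hg, hg, h.map_bullet]
  · intro x
    obtain ⟨a, rfl⟩ := hsurj x
    rw [hg, h.lin_counit, q.lin_counit]
  · intro x
    obtain ⟨a, rfl⟩ := hsurj x
    rw [← q.lin_comul, TensorProduct.map_map, hcomp, h.lin_comul, hg]
  · intro g' hg'
    have h1 : ∀ x, g' x = g x := by
      intro x
      obtain ⟨a, rfl⟩ := hsurj x
      rw [hg', hg]
    obtain ⟨g', _⟩ := g'
    congr 1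
    exact DFunLike.ext _ _ h1

/-- Two sub-Hopf braces commute in the sense of Huq iff their elements commute for both
multiplications and these agree on them. -/
theorem huqCommute_iff (X Y : SubHopfBrace k A) :
    HuqCommute X Y ↔ ∀ x ∈ X, ∀ y ∈ Y, x * y = y * x ∧ bullet k x y = x * y ∧
      bullet k x y = bullet k y x := by
  constructor
  · rintro ⟨p, hp1, hp2⟩ x hx y hy
    let x' : X.Carrier := ⟨x, hx⟩
    let y' : Y.Carrier := ⟨y, hy⟩
    have h1 := map_mul p.toBialgHom (x' ⊗ₜ[k] 1) (1 ⊗ₜ[k] y')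
    have h2 := map_mul p.toBialgHom (1 ⊗ₜ[k] y') (x' ⊗ₜ[k] 1)
    have h3 := p.map_bullet (x' ⊗ₜ[k] 1) (1 ⊗ₜ[k] y')
    have h4 := p.map_bullet (1 ⊗ₜ[k] y') (x' ⊗ₜ[k] 1)
    have h5 : bullet k (x' ⊗ₜ[k] (1 : Y.Carrier)) (1 ⊗ₜ[k] y') = x' ⊗ₜ y' :=
      congrArg₂ (· ⊗ₜ[k] ·) (bullet_one x') (one_bullet y')
    have h6 : bullet k ((1 : X.Carrier) ⊗ₜ[k] y') (x' ⊗ₜ[k] 1) = x' ⊗ₜ y' :=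
      congrArg₂ (· ⊗ₜ[k] ·) (one_bullet x') (bullet_one y')
    rw [hp1, hp2, Algebra.TensorProduct.tmul_mul_tmul, one_mul, mul_one] at h1 h2
    rw [hp1, hp2, h5] at h3
    rw [hp1, hp2, h6] at h4
    exact ⟨h1.symm.trans h2, h3.symm.trans h1, h3.symm.trans h4⟩
  · intro h
    refine ⟨HopfBraceHom.liftOfCommute X.inclBrace Y.inclBrace fun x y => h x x.2 y y.2,
      fun x => mul_one (x : A), fun y => one_mul (y : A)⟩

/-- The images of `X` and `Y` under `q` commute in the sense of Huq iff `q` sends all the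
generators of the commutator `[X, Y]` to scalars. -/
theorem huqCommute_map_iff {Q : Type*} [Ring Q] [HopfBrace k Q] (q : HopfBraceHom k A Q)
    (X Y : SubHopfBrace k A) :
    HuqCommute (X.map q) (Y.map q) ↔ ∀ (x : X.Carrier) (y : Y.Carrier),
      q (dotCommutator k x y) = (counit (R := k) x * counit (R := k) y) • (1 : Q) ∧
      q (starCommutator k x y) = (counit (R := k) x * counit (R := k) y) • (1 : Q) ∧
      q (bulletCommutator k x y) = (counit (R := k) x * counit (R := k) y) • (1 : Q) := by
  let f : X.Carrier →ₗc[k] Q := (q.toBialgHom : A →ₗc[k] Q).comp X.inclHom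
  let g : Y.Carrier →ₗc[k] Q := (q.toBialgHom : A →ₗc[k] Q).comp Y.inclHom
  have h1 := hopfCommutator_eq_counit_iff f g
  have h2 := hopfCommutator_eq_counit_iff (H := BulletAlg k Q) f g
  have h3 : (∀ x y, starCommutator k (f x) (g y) =
      (counit (R := k) x * counit (R := k) y) • (1 : Q)) ↔
      ∀ x y, bullet k (f x) (g y) = f x * g y := by
    refine (forall_congr' fun x => starCommutator_eq_counit_iff (f x) _ g).trans ?_
    rw [forall_comm]
    exact (forall_congr' fun y => act_eq_counit_iff f (g y)).trans forall_comm
  have h4 : HuqCommute (X.map q) (Y.map q) ↔ ∀ x y, f x * g y = g y * f x ∧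
      bullet k (f x) (g y) = f x * g y ∧ bullet k (f x) (g y) = bullet k (g y) (f x) := by
    rw [huqCommute_iff]
    constructor
    · exact fun h x y => h _ ⟨x, x.2, rfl⟩ _ ⟨y, y.2, rfl⟩
    · rintro h _ ⟨x, hx, rfl⟩ _ ⟨y, hy, rfl⟩
      exact h ⟨x, hx⟩ ⟨y, hy⟩
  rw [h4]
  simp only [forall_and, q.map_dotCommutator, q.map_starCommutator, q.map_bulletCommutator]
  exact and_congr h1.symm (and_congr h3.symm h2.symm)

/-- A coalgebra morphism that becomes trivial modulo the ideal `A · N⁺` takes values in `N`. -/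
theorem mem_of_comp_trivial [IsCocomm k A] {C : Type*} [AddCommGroup C] [Module k C] [Coalgebra k C]
    {N : SubHopfBrace k A} (φ : C →ₗc[k] A)
    (h : ∀ t, φ t - counit (R := k) t • (1 : A) ∈ N.ideal) (t : C) : φ t ∈ N :=
  mem_of_mem_coinvariants N.isHopfSub (mem_coinvariants_of_comp φ h t)

theorem normalClosure_isNormal (E : Set A) : (normalClosure (k := k) E).IsNormal where
  conj_mem a b hb B hB := hB.1.conj_mem a b (hb B hB)
  bulletConj_mem a b hb B hB := hB.1.bulletConj_mem a b (hb B hB)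
  act_mem a b hb B hB := hB.1.act_mem a b (hb B hB)

theorem subset_normalClosure (E : Set A) : E ⊆ (normalClosure (k := k) E) :=
  fun _ ha _ hB => hB.2 ha

theorem normalClosure_le {E : Set A} {N : SubHopfBrace k A} (hN : N.IsNormal) (h : E ⊆ N) :
    normalClosure E ≤ N :=
  fun _ ha => ha N ⟨hN, h⟩

variable [IsCocomm k A]

/-- The generators of `[X, Y]` become scalars in the cokernel of `[X, Y]`. -/
theorem commuteModulo_commutator (X Y : SubHopfBrace k A) :
    (commutator X Y).CommuteModulo X Y := by
  obtain ⟨Q, iQ, iH, iC, q, hsurj, hker⟩ :=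
    exists_quotient (normalClosure_isNormal (k := k) (A := A) _ : (commutator X Y).IsNormal)
  have hcok := isCokernel_of_surjective q hsurj hker
  refine ⟨Q, iQ, iH, iC, q, hcok, (huqCommute_map_iff q X Y).mpr fun x y => ?_⟩
  have hmem := fun c hc => hcok.1 c (subset_normalClosure _ ⟨x, x.2, y, y.2, hc⟩)
  refine ⟨?_, ?_, ?_⟩
  · rw [hmem _ (Or.inl rfl), counit_dotCommutator]; rfl
  · rw [hmem _ (Or.inr (Or.inl rfl)), counit_starCommutator]; rfl
  · rw [hmem _ (Or.inr (Or.inr rfl)), counit_bulletCommutator]; rfl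

/-- If the images of `X` and `Y` in a cokernel of `N` commute, then the generators of `[X, Y]`,
as values of coalgebra morphisms on `X ⊗ Y` which are trivial modulo `A · N⁺`, lie in `N`. -/
theorem commutator_le_of_commuteModulo {X Y N : SubHopfBrace k A} (hN : N.IsNormal)
    (h : N.CommuteModulo X Y) : commutator X Y ≤ N := by
  obtain ⟨Q, iQ, iH, iC, q, hcok, hcomm⟩ := h
  obtain ⟨P, iP, iHP, iCP, π, hsurj, hker⟩ := exists_quotient hN
  obtain ⟨g, hg, -⟩ := hcok.2 P π (isCokernel_of_surjective π hsurj hker).1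
  -- whatever `q` trivializes, the quotient `π = g ∘ q` trivializes
  have htriv : ∀ (c : A) (r : k), q c = r • 1 → c - r • (1 : A) ∈ N.ideal := by
    intro c r hc
    rw [← hker, map_sub, map_smul, map_one, ← hg, hc, map_smul, map_one, sub_self]
  have hmem : ∀ (φ : X.Carrier ⊗[k] Y.Carrier →ₗc[k] A) (c : X.Carrier → Y.Carrier → A),
      (∀ x y, φ (x ⊗ₜ y) = c x y) →
      (∀ x y, q (c x y) = (counit (R := k) x * counit (R := k) y) • (1 : Q)) →
      ∀ x y, c x y ∈ N := by
    intro φ c hφ hc x y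
    rw [← hφ]
    refine mem_of_comp_trivial φ (fun t => ?_) _
    induction t with
    | zero => simp
    | add s t hs ht =>
      simp only [map_add, add_smul, add_sub_add_comm]
      exact add_mem hs ht
    | tmul x y =>
      rw [TensorProduct.counit_tmul, smul_eq_mul, mul_comm]
      rw [hφ]
      exact htriv _ _ (hc x y)
  have hgen := (huqCommute_map_iff q X Y).mp hcomm
  refine normalClosure_le hN ?_
  rintro _ ⟨x, hx, y, hy, rfl | rfl | rfl⟩
  · exact hmem (hopfCommutatorHom X.inclHom Y.inclHom) (fun x y => dotCommutator k (x : A) y)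
      (hopfCommutatorHom_tmul X.inclHom Y.inclHom) (fun x y => (hgen x y).1) ⟨x, hx⟩ ⟨y, hy⟩
  · exact hmem ((starCommutatorHom k A).comp (Coalgebra.TensorProduct.map X.inclHom Y.inclHom))
      (fun x y => starCommutator k (x : A) y)
      (fun x y => starCommutatorHom_tmul (x : A) (y : A)) (fun x y => (hgen x y).2.1)
      ⟨x, hx⟩ ⟨y, hy⟩
  · exact hmem (hopfCommutatorHom (H := BulletAlg k A) X.inclHom Y.inclHom)
      (fun x y => bulletCommutator k (x : A) y)
      (hopfCommutatorHom_tmul (H := BulletAlg k A) X.inclHom Y.inclHom)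
      (fun x y => (hgen x y).2.2) ⟨x, hx⟩ ⟨y, hy⟩

end SubHopfBrace

theorem proposition7p5 {k : Type v} {A : Type u} [Field k] [Ring A] [HopfBrace k A]
    [Coalgebra.IsCocomm k A] (X Y : SubHopfBrace k A) (hX : X.IsNormal) (hY : Y.IsNormal) :
    SubHopfBrace.IsHuqCommutator X Y (SubHopfBrace.commutator X Y) :=
  ⟨⟨SubHopfBrace.normalClosure_isNormal _, SubHopfBrace.commuteModulo_commutator X Y⟩,
    fun _ hN => SubHopfBrace.commutator_le_of_commuteModulo hN.1 hN.2⟩
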